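/- Let $d\ge1$ be an integer, $m\ge -d$ and $\nu>0$ real, and $1<p<\infty$ with conjugate exponent $p'=p/(p-1)$. For the Hermite operator $L=-\Delta+|x|^2+m$ on $\mathbb R^d$ let $[e^{-uL}f](x)=\int_{\mathbb R^d}h_u(x,y)f(y)\,dy$, $u>0$, with the Mehler kernel $$h_u(x,y)=e^{-um}\,[2\pi\sinh 2u]^{-d/2}\,e^{-\frac{|x-y|^2}{2\tanh 2u}-(\tanh u)\,x\cdot y},$$ and set $$P_tf(x)=\frac{t^{2\nu}}{4^\nu\Gamma(\nu)}\int_0^\infty e^{-\frac{t^2}{4u}}\,[e^{-uL}f](x)\,\frac{du}{u^{1+\nu}}\quad(t>0),\qquad P^*_af(x)=\sup_{0<t<a}|P_tf(x)|\quad(a>0).$$ Let $$\phi(y)=\frac{e^{-|y|^2/2}}{(1+|y|)^{\frac{d+m}2}[\ln(e+|y|)]^{1+\nu}}\ \text{ if } m>-d,\qquad \phi(y)=\frac{e^{-|y|^2/2}}{[\ln(e+|y|)]^{\nu}}\ \text{ if } m=-d,$$ and let $\mathcal M^{\rm loc}$ be the local Hardy--Littlewood maximal operator $$\mathcal M^{\rm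 loc}f(x)=\sup_{r>0}\frac1{|B_r|}\int_{B_r(x)}|f(y)|\,\chi_{\{|y|\le 3\max(|x|,1)\}}\,dy .$$ Theorem. For every $\alpha>1$ there is a number $N_0=N_0(\alpha,p,d,m,\nu)$ such that the following holds for every measurable weight $w>0$ (a.e.) on $\mathbb R^d$ with $\|w^{-1/p}\phi\|_{L^{p'}(\mathbb R^d)}<\infty$ and every $N>N_0$. Put $$v(x)=\Big[\mathcal M^{\rm loc}\big(w^{-p'/p}\,e^{-p'|y|^2/2}\big)(x)\Big]^{-\frac{\alpha}{p'/p}}\,e^{-p|x|^2/2}\,(1+|x|)^{-N}.$$ Then $v$ is a weight (measurable, $0<v<\infty$ a.e.); for every $f\in L^p(w)$ the integrals defining $P_tf(x)$ converge absolutely for all $t>0$ and $x\in\mathbb R^d$; and for every $a>0$ the operator $P^*_a$ is bounded from $L^p(w)$ to $L^p(v)$, that is, there is a constant $C$, independent of $f$, with $\|P^*_af\|_{L^p(v)}\le C\,\|f\|_{L^p(w)}$ for all $f\in L^p(w)$. Moreover, if $0<\sigma<1$ and $\alpha<1/\sigma$, then also $\|v^{-\sigma/p}\phi\|_{L^{p'}(\mathbb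 R^d)}<\infty$. -/

import Mathlib

open MeasureTheory Set
open scoped ENNReal NNReal

noncomputable section

namespace PoissonHermite

/-- Euclidean space `ℝ^d`. -/
abbrev E (d : ℕ) : Type := EuclideanSpace ℝ (Fin d)

/-- The Mehler kernel `h_u(x, y)` of the heat semigroup `e^{-uL}`, `u > 0`, generated by the
Hermite operator `L = -Δ + |x|² + m` on `ℝ^d`. -/
def mehler (d : ℕ) (m u : ℝ) (x y : E d) : ℝ :=
  Real.exp (-(u * m)) * (2 * Real.pi * Real.sinh (2 * u)) ^ (-((d : ℝ) / 2)) *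
    Real.exp (-(‖x - y‖ ^ 2 / (2 * Real.tanh (2 * u))) - Real.tanh u * inner ℝ x y)

/-- `[e^{-uL} f](x) = ∫ h_u(x, y) f(y) dy`. -/
def heat (d : ℕ) (m u : ℝ) (f : E d → ℂ) (x : E d) : ℂ :=
  ∫ y, (mehler d m u x y : ℂ) * f y

/-- The weight `e^{-t²/(4u)} u^{-(1+ν)}` of the subordination integral. -/
def subord (ν t u : ℝ) : ℝ :=
  Real.exp (-(t ^ 2 / (4 * u))) / u ^ (1 + ν)

/-- The Poisson-like integral
`P_t f(x) = t^{2ν} / (4^ν Γ(ν)) ∫_0^∞ e^{-t²/(4u)} [e^{-uL} f](x) du / u^{1+ν}`. -/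
def poisson (d : ℕ) (m ν t : ℝ) (f : E d → ℂ) (x : E d) : ℂ :=
  ((t ^ (2 * ν) / ((4 : ℝ) ^ ν * Real.Gamma ν) : ℝ) : ℂ) *
    ∫ u in Ioi (0 : ℝ), (subord ν t u : ℂ) * heat d m u f x

/-- The integrals defining `P_t f(x)` converge absolutely: the one for `[e^{-uL} f](x)` for each
`u > 0`, and the double integral in `(u, y)`. -/
def PoissonConverges (d : ℕ) (m ν t : ℝ) (f : E d → ℂ) (x : E d) : Prop :=
  (∀ u : ℝ, 0 < u → Integrable (fun y : E d => (mehler d m u x y : ℂ) * f y)) ∧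
  Integrable
    (fun z : ℝ × E d => (subord ν t z.1 : ℂ) * ((mehler d m z.1 x z.2 : ℂ) * f z.2))
    (((volume : Measure ℝ).restrict (Ioi 0)).prod (volume : Measure (E d)))

/-- The local maximal operator `P*_a f(x) = sup_{0 < t < a} |P_t f(x)|`. -/
def poissonMax (d : ℕ) (m ν a : ℝ) (f : E d → ℂ) (x : E d) : ℝ≥0∞ :=
  ⨆ t ∈ Ioo (0 : ℝ) a, ‖poisson d m ν t f x‖ₑ

/-- The function `φ`. -/
def phi (d : ℕ) (m ν : ℝ) (y : E d) : ℝ :=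
  if m = -(d : ℝ) then
    Real.exp (-(‖y‖ ^ 2 / 2)) / Real.log (Real.exp 1 + ‖y‖) ^ ν
  else
    Real.exp (-(‖y‖ ^ 2 / 2)) /
      ((1 + ‖y‖) ^ (((d : ℝ) + m) / 2) * Real.log (Real.exp 1 + ‖y‖) ^ (1 + ν))

/-- The local Hardy–Littlewood maximal operator
`M^loc f(x) = sup_{r > 0} |B_r|⁻¹ ∫_{B_r(x)} |f(y)| 1_{|y| ≤ 3 max(|x|, 1)} dy`. -/
def maxLoc (d : ℕ) (f : E d → ℝ) (x : E d) : ℝ≥0∞ :=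
  ⨆ r ∈ Ioi (0 : ℝ), (volume (Metric.ball x r))⁻¹ *
    ∫⁻ y in Metric.ball x r, {y : E d | ‖y‖ ≤ 3 * max ‖x‖ 1}.indicator (fun y => ‖f y‖ₑ) y

/-- The explicit weight
`v(x) = [M^loc(w^{-p'/p} e^{-p'|y|²/2})(x)]^{-α/(p'/p)} e^{-p|x|²/2} (1 + |x|)^{-N}`,
where `p'` is the conjugate exponent of `p`. -/
def weightV (d : ℕ) (p α N : ℝ) (w : E d → ℝ) (x : E d) : ℝ≥0∞ :=
  maxLoc d (fun y => w y ^ (-(p.conjExponent / p)) *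
      Real.exp (-(p.conjExponent * ‖y‖ ^ 2 / 2))) x ^ (-(α / (p.conjExponent / p))) *
    ENNReal.ofReal (Real.exp (-(p * ‖x‖ ^ 2 / 2)) * (1 + ‖x‖) ^ (-N))

end PoissonHermite

end

/-! Write X = max(|x|,1) and split f at |y| = 3X. Completing the square (`mehler_exponent_eq`) shows
h_u(x,y) to be e^{(|x|²-|y|²)/2} times a factor of u times a Gaussian in (1+s)x-(1-s)y, s = tanh u.

Near part, |y| ≤ 3X. If 4uX² ≤ 1 the Gaussian is comparable to an ordinary one in x-y; otherwise the
kernel is flat up to powers of X. Either way the heat integral is at most a power of X times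
e^{|x|²/2} M^loc(|f|e^{-|y|²/2})(x), uniformly in u (`exists_heat_local_le`). The normalized
subordination weight has total mass one, so the bound survives both the u-integral and the supremum
in t.

Far part, |y| > 3X. Dropping e^{-t²/4u} ≤ 1 leaves ∫ h_u(x,y) u^{-1-ν} du, which is concentrated
near the time where Xe^{2u} = |y|, or beyond it when m = -d. It is at most a power of X times
e^{|x|²/2} φ(y) (`exists_lintegral_mehler_far_le`). So this part has rank one: a function of x times
∫|f|φ, which Hölder and the hypothesis on w control.

Two-weight inequality. With S = w^{-p'/p}e^{-p'|y|²/2} and F = |f|e^{-|y|²/2} one has F^p S^{1-p} =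
|f|^p w. Put A = M^loc S, ε = (α-1)(p-1). The exponent of A in v is -(p-1+ε), so (M^loc F)^p v
carries A^{1-ε}(M^loc F/A)^p. The map taking F/S to M^loc F/A is trivially bounded on L^∞, since F ≤
λS gives M^loc F ≤ λA. It is of weak type (1,1) from S dx to W dx whenever W ≤ A·min(A^ε,A^{-ε}): A
min(A^ε,A^{-ε}) is dominated by a layer-cake integral of min(t^ε,t^{-ε}), and the classical weak
type bound leaves the convergent integral of min(t^ε,t^{-ε}) dt/t. Marcinkiewicz interpolation gives
`lintegral_locMax_div_rpow_le`. The missing half W ≤ A^{1+ε} is paid for by (1+|x|)^{-N}, because A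
≥ c(1+|x|)^{-d}; the same power absorbs all powers of X.

Finally v^{-σp'/p} contains A^{ασ} with ασ < 1, integrable against the remaining Gaussian by
Kolmogorov's inequality. -/

noncomputable section

namespace PoissonHermite

/-! ### The centered maximal function: weak type, measurability, Gaussian averages. -/

section Maximal

variable {d : ℕ}

/-- The centered Hardy–Littlewood maximal function of a nonnegative function. -/
def hlMax (G : E d → ℝ≥0∞) (x : E d) : ℝ≥0∞ :=
  ⨆ r ∈ Ioi (0 : ℝ), (volume (Metric.ball x r))⁻¹ * ∫⁻ y in Metric.ball x r, G y

theorem volume_ball_eq (x : E d) {r : ℝ} (hr : 0 < r) :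
    volume (Metric.ball x r) = ENNReal.ofReal (r ^ d) * volume (Metric.ball (0 : E d) 1) := by
  have := Measure.addHaar_ball_of_pos (volume : Measure (E d)) x hr
  simpa using this

theorem volume_ball_pos (x : E d) {r : ℝ} (hr : 0 < r) : volume (Metric.ball x r) ≠ 0 :=
  (Metric.measure_ball_pos volume x hr).ne'

theorem volume_ball_ne_top (x : E d) (r : ℝ) : volume (Metric.ball x r) ≠ ∞ :=
  measure_ball_lt_top.ne

theorem setLIntegral_ball_le_hlMax (G : E d → ℝ≥0∞) (x : E d) {r : ℝ} (hr : 0 < r) :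
    ∫⁻ y in Metric.ball x r, G y ≤ volume (Metric.ball x r) * hlMax G x := by
  have h : (volume (Metric.ball x r))⁻¹ * ∫⁻ y in Metric.ball x r, G y ≤ hlMax G x :=
    le_iSup₂ (f := fun (r : ℝ) (_ : r ∈ Ioi (0 : ℝ)) =>
      (volume (Metric.ball x r))⁻¹ * ∫⁻ y in Metric.ball x r, G y) r hr
  calc ∫⁻ y in Metric.ball x r, G y
      = volume (Metric.ball x r) *
        ((volume (Metric.ball x r))⁻¹ * ∫⁻ y in Metric.ball x r, G y) := by
        rw [← mul_assoc, ENNReal.mul_inv_cancel (volume_ball_pos x hr) (volume_ball_ne_top x r),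
          one_mul]
    _ ≤ _ := by gcongr

theorem hlMax_mono {G H : E d → ℝ≥0∞} (h : ∀ᵐ y, G y ≤ H y) (x : E d) : hlMax G x ≤ hlMax H x := by
  refine iSup₂_mono fun r _ => ?_
  exact mul_le_mul_right (lintegral_mono_ae (ae_restrict_of_ae h)) _

theorem hlMax_congr {G H : E d → ℝ≥0∞} (h : G =ᵐ[volume] H) (x : E d) :
    hlMax G x = hlMax H x :=
  le_antisymm (hlMax_mono (h.mono fun _ h => h.le) x) (hlMax_mono (h.mono fun _ h => h.ge) x)

theorem hlMax_add_le {G H : E d → ℝ≥0∞} (hG : AEMeasurable G) (x : E d) :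
    hlMax (fun y => G y + H y) x ≤ hlMax G x + hlMax H x := by
  refine iSup₂_le fun r hr => ?_
  rw [lintegral_add_left' hG.restrict, mul_add]
  exact add_le_add
    (le_iSup₂ (f := fun (r : ℝ) (_ : r ∈ Ioi (0 : ℝ)) =>
      (volume (Metric.ball x r))⁻¹ * ∫⁻ y in Metric.ball x r, G y) r hr)
    (le_iSup₂ (f := fun (r : ℝ) (_ : r ∈ Ioi (0 : ℝ)) =>
      (volume (Metric.ball x r))⁻¹ * ∫⁻ y in Metric.ball x r, H y) r hr)

theorem hlMax_const_mul (c : ℝ≥0∞) (hc : c ≠ ∞) (G : E d → ℝ≥0∞) (x : E d) :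
    hlMax (fun y => c * G y) x = c * hlMax G x := by
  simp only [hlMax, ENNReal.mul_iSup]
  refine iSup_congr fun r => iSup_congr fun _ => ?_
  rw [lintegral_const_mul' _ _ hc, mul_left_comm]

theorem le_setLIntegral_of_lt_hlMax {G : E d → ℝ≥0∞} {x : E d} {t : ℝ≥0∞} (h : t < hlMax G x) :
    ∃ r : ℝ, 0 < r ∧ t * volume (Metric.ball x r) ≤ ∫⁻ y in Metric.ball x r, G y := by
  simp only [hlMax, lt_iSup_iff] at h
  obtain ⟨r, hr, h⟩ := h
  refine ⟨r, hr, ?_⟩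
  calc t * volume (Metric.ball x r)
      ≤ ((volume (Metric.ball x r))⁻¹ * ∫⁻ y in Metric.ball x r, G y) *
        volume (Metric.ball x r) := by gcongr
    _ = _ := by
      rw [mul_comm, ← mul_assoc,
        ENNReal.mul_inv_cancel (volume_ball_pos x hr) (volume_ball_ne_top x r), one_mul]

/-- The weak type `(1, 1)` inequality for the maximal function. -/
theorem mul_volume_lt_hlMax_le (hd : 1 ≤ d) (G : E d → ℝ≥0∞) (t : ℝ≥0∞) :
    t * volume {x | t < hlMax G x} ≤ 5 ^ d * ∫⁻ y, G y := by
  rcases eq_or_ne t 0 with rfl | ht0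
  · simp
  rcases eq_or_ne t ∞ with rfl | htt
  · simp
  rcases eq_or_ne (∫⁻ y, G y) ∞ with hI | hI
  · rw [hI, ENNReal.mul_top (by simp)]; exact le_top
  let T : Set (E d × ℝ) := {a | 0 < a.2 ∧
    t * volume (Metric.ball a.1 a.2) ≤ ∫⁻ y in Metric.ball a.1 a.2, G y}
  have hc0 : t * volume (Metric.ball (0 : E d) 1) ≠ 0 :=
    mul_ne_zero ht0 (volume_ball_pos 0 one_pos)
  have hct : t * volume (Metric.ball (0 : E d) 1) ≠ ∞ :=
    ENNReal.mul_ne_top htt (volume_ball_ne_top 0 1)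
  set B : ℝ := ((∫⁻ y, G y) / (t * volume (Metric.ball (0 : E d) 1))).toReal with hB
  -- Vitali's lemma needs bounded radii: a ball in T has volume at most ∫G / t, and since d ≥ 1 a
  -- radius r ≥ 1 is at most r^d.
  have hR : ∀ a ∈ T, a.2 ≤ max 1 B := by
    rintro ⟨x, r⟩ ⟨hr, h⟩
    rcases le_total r 1 with h1 | h1
    · exact h1.trans (le_max_left _ _)
    refine le_trans ?_ (le_max_right _ _)
    have h2 : ENNReal.ofReal (r ^ d) ≤ (∫⁻ y, G y) / (t * volume (Metric.ball (0 : E d) 1)) := by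
      rw [ENNReal.le_div_iff_mul_le (Or.inl hc0) (Or.inl hct)]
      calc _ = t * volume (Metric.ball x r) := by rw [volume_ball_eq x hr]; ring
        _ ≤ _ := h.trans (setLIntegral_le_lintegral _ _)
    have h3 : r ^ d ≤ B := by
      rw [hB]
      exact (ENNReal.ofReal_le_iff_le_toReal (ENNReal.div_ne_top hI hc0)).1 h2
    calc r = r ^ 1 := (pow_one r).symm
      _ ≤ r ^ d := pow_le_pow_right₀ h1 hd
      _ ≤ B := h3
  obtain ⟨u, huT, hdisj, hcov⟩ := Vitali.exists_disjoint_subfamily_covering_enlargement_closedBall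
    T Prod.fst Prod.snd (max 1 B) hR 5 (by norm_num)
  have hu : u.Countable := hdisj.countable_of_nonempty_interior fun a ha =>
    ⟨a.1, Metric.ball_subset_interior_closedBall (Metric.mem_ball_self (huT ha).1)⟩
  have hsub : {x | t < hlMax G x} ⊆ ⋃ a ∈ u, Metric.closedBall a.1 (5 * a.2) := by
    intro x hx
    obtain ⟨r, hr, h⟩ := le_setLIntegral_of_lt_hlMax hx
    obtain ⟨b, hb, hb'⟩ := hcov (x, r) ⟨hr, h⟩
    exact mem_biUnion hb (hb' (Metric.mem_closedBall_self hr.le))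
  have : Countable u := hu.to_subtype
  calc t * volume {x | t < hlMax G x}
      ≤ t * ∑' a : u, volume (Metric.closedBall a.1.1 (5 * a.1.2)) := by
        gcongr
        refine (measure_mono hsub).trans ?_
        rw [biUnion_eq_iUnion]
        exact measure_iUnion_le _
    _ = ∑' a : u, 5 ^ d * (t * volume (Metric.ball a.1.1 a.1.2)) := by
        rw [← ENNReal.tsum_mul_left]
        congr 1 with a
        have ha := (huT a.2).1
        rw [Measure.addHaar_closedBall _ _ (by positivity), volume_ball_eq _ ha, mul_pow,
          ENNReal.ofReal_mul (by positivity), finrank_euclideanSpace_fin, ENNReal.ofReal_pow (by simp)]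
        simp only [ENNReal.ofReal_ofNat]
        ring
    _ ≤ ∑' a : u, 5 ^ d * ∫⁻ y in Metric.ball a.1.1 a.1.2, G y := by
        gcongr with a
        exact (huT a.2).2
    _ = 5 ^ d * ∫⁻ y in ⋃ a : u, Metric.ball a.1.1 a.1.2, G y := by
        rw [ENNReal.tsum_mul_left, lintegral_iUnion (fun _ => measurableSet_ball)]
        intro a b hab
        exact (hdisj a.2 b.2 (fun h => hab (Subtype.ext h))).mono Metric.ball_subset_closedBall
          Metric.ball_subset_closedBall
    _ ≤ 5 ^ d * ∫⁻ y, G y := mul_le_mul_right (setLIntegral_le_lintegral _ _) _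

theorem volume_lt_hlMax_le (hd : 1 ≤ d) (G : E d → ℝ≥0∞) {t : ℝ} (ht : 0 < t) :
    volume {x | ENNReal.ofReal t < hlMax G x} ≤ 5 ^ d * (∫⁻ y, G y) / ENNReal.ofReal t := by
  rw [ENNReal.le_div_iff_mul_le (Or.inl (by simpa using ht)) (Or.inl (by simp)), mul_comm]
  exact mul_volume_lt_hlMax_le hd G _

theorem ae_hlMax_lt_top (hd : 1 ≤ d) {G : E d → ℝ≥0∞} (hG : ∫⁻ y, G y ≠ ∞) :
    ∀ᵐ x, hlMax G x < ∞ := by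
  have hK : (5 : ℝ≥0∞) ^ d * ∫⁻ y, G y ≠ ∞ := ENNReal.mul_ne_top (by simp) hG
  rw [ae_iff]
  by_contra h0
  have key : ∀ n : ℕ, (n : ℝ≥0∞) * volume {x | ¬ hlMax G x < ∞} ≤ 5 ^ d * ∫⁻ y, G y := fun n =>
    le_trans (by
      gcongr
      intro hx
      rw [show hlMax G _ = ∞ from not_lt_top_iff.1 hx]
      exact ENNReal.natCast_lt_top n) (mul_volume_lt_hlMax_le hd G n)
  obtain ⟨n, hn⟩ := ENNReal.exists_nat_mul_gt h0 hK
  exact absurd hn (not_lt.2 (key n))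

/-- The averages over balls of a jointly measurable family have a measurable supremum. -/
theorem measurable_hlMax {G : E d → E d → ℝ≥0∞} (hG : Measurable (Function.uncurry G)) :
    Measurable fun x => hlMax (G x) x := by
  -- Rational radii suffice: a ball is the increasing union of its rational subballs, and these have
  -- the larger inverse volume.
  have hrat : ∀ x, hlMax (G x) x = ⨆ q : {q : ℚ // 0 < q},
      (volume (Metric.ball x (q : ℝ)))⁻¹ * ∫⁻ y in Metric.ball x (q : ℝ), G x y := by
    intro x
    refine le_antisymm (iSup₂_le fun r hr => ?_) (iSup_le fun q => ?_)
    · have hr : 0 < r := hr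
      obtain ⟨q, hqm, hq, hlim⟩ := Real.exists_seq_rat_strictMono_tendsto r
      have hU : Metric.ball x r = ⋃ n, Metric.ball x (q n : ℝ) := by
        refine subset_antisymm (fun y hy => ?_)
          (iUnion_subset fun n => Metric.ball_subset_ball (hq n).le)
        obtain ⟨n, hn⟩ := (hlim.eventually (lt_mem_nhds (Metric.mem_ball.1 hy))).exists
        exact mem_iUnion.2 ⟨n, hn⟩
      have hmono : Monotone fun n => Metric.ball x (q n : ℝ) := fun m n hmn =>
        Metric.ball_subset_ball (by exact_mod_cast hqm.monotone hmn)
      have hI : ∫⁻ y in Metric.ball x r, G x y = ⨆ n, ∫⁻ y in Metric.ball x (q n : ℝ), G x y := by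
        simp_rw [← withDensity_apply (G x) measurableSet_ball]
        rw [hU, hmono.measure_iUnion]
      rw [hI, ENNReal.mul_iSup]
      refine iSup_le fun n => ?_
      rcases le_or_gt (q n) 0 with h0 | h0
      · have : Metric.ball x (q n : ℝ) = ∅ := Metric.ball_eq_empty.2 (by exact_mod_cast h0)
        simp [this]
      · refine le_trans ?_ (le_iSup (fun q : {q : ℚ // 0 < q} =>
          (volume (Metric.ball x (q : ℝ)))⁻¹ * ∫⁻ y in Metric.ball x (q : ℝ), G x y) ⟨q n, h0⟩)
        exact mul_le_mul_left (ENNReal.inv_le_inv.2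
          (measure_mono (Metric.ball_subset_ball (hq n).le))) _
    · exact le_iSup₂ (f := fun (r : ℝ) (_ : r ∈ Ioi (0 : ℝ)) =>
        (volume (Metric.ball x r))⁻¹ * ∫⁻ y in Metric.ball x r, G x y) (q : ℝ)
        (show (0 : ℝ) < (q : ℝ) by exact_mod_cast q.2)
  simp_rw [hrat]
  refine Measurable.iSup fun q => ?_
  have hq : (0 : ℝ) < ((q : ℚ) : ℝ) := by exact_mod_cast q.2
  simp_rw [volume_ball_eq _ hq]
  refine Measurable.const_mul ?_ _
  have hset : MeasurableSet {z : E d × E d | dist z.2 z.1 < ((q : ℚ) : ℝ)} :=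
    measurableSet_lt (by fun_prop) (by fun_prop)
  have := (hG.indicator hset).lintegral_prod_right' (ν := (volume : Measure (E d)))
  convert this using 2 with x
  rw [← lintegral_indicator measurableSet_ball]
  rfl

theorem ball_eq_superlevel_gaussian (x : E d) {b t : ℝ} (hb : 0 < b) (ht : 0 < t) :
    {y : E d | t < Real.exp (-b * ‖x - y‖ ^ 2)} = Metric.ball x (√(-Real.log t / b)) := by
  ext y
  rw [mem_ofPred_eq, Metric.mem_ball, dist_comm, dist_eq_norm,
    Real.lt_sqrt (norm_nonneg _), lt_div_iff₀ hb, ← Real.log_lt_iff_lt_exp ht]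
  constructor <;> intro h <;> linarith

/-- A Gaussian convolution is dominated by the maximal function. -/
theorem lintegral_gaussian_mul_le {G : E d → ℝ≥0∞} (hG : AEMeasurable G) (x : E d) {b : ℝ}
    (hb : 0 < b) :
    ∫⁻ y, ENNReal.ofReal (Real.exp (-b * ‖x - y‖ ^ 2)) * G y ≤
      ENNReal.ofReal ((Real.pi / b) ^ ((d : ℝ) / 2)) * hlMax G x := by
  have hmeas : Measurable fun y : E d => Real.exp (-b * ‖x - y‖ ^ 2) := by fun_prop
  have hint : Integrable fun y : E d => Real.exp (-b * ‖y‖ ^ 2) := by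
    apply Integrable.of_integral_ne_zero
    rw [GaussianFourier.integral_rexp_neg_mul_sq_norm hb]
    positivity
  -- Layer cake under both G dy and dy: the superlevel sets of the Gaussian are balls about x, where
  -- the G-mass is at most the volume times the maximal function.
  have h1 : ∫⁻ y, ENNReal.ofReal (Real.exp (-b * ‖x - y‖ ^ 2)) * G y =
      ∫⁻ y, ENNReal.ofReal (Real.exp (-b * ‖x - y‖ ^ 2)) ∂(volume.withDensity G) := by
    rw [lintegral_withDensity_eq_lintegral_mul₀ hG hmeas.ennreal_ofReal.aemeasurable]
    simp only [Pi.mul_apply, mul_comm]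
  have h2 : ∫⁻ y : E d, ENNReal.ofReal (Real.exp (-b * ‖x - y‖ ^ 2)) =
      ENNReal.ofReal ((Real.pi / b) ^ ((d : ℝ) / 2)) := by
    rw [lintegral_sub_left_eq_self (fun y : E d => ENNReal.ofReal (Real.exp (-b * ‖y‖ ^ 2))) x,
      ← ofReal_integral_eq_lintegral_ofReal hint (by filter_upwards with y; positivity),
      GaussianFourier.integral_rexp_neg_mul_sq_norm hb]
    simp
  rw [h1, ← h2, lintegral_eq_lintegral_meas_lt _ (by filter_upwards with y; positivity)
    hmeas.aemeasurable, lintegral_eq_lintegral_meas_lt _ (by filter_upwards with y; positivity)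
    hmeas.aemeasurable, mul_comm]
  have hanti : Measurable fun t : ℝ => volume {y : E d | t < Real.exp (-b * ‖x - y‖ ^ 2)} := by
    apply Antitone.measurable
    intro s t hst
    exact measure_mono fun y hy => lt_of_le_of_lt hst hy
  rw [← lintegral_const_mul _ hanti]
  refine setLIntegral_mono' measurableSet_Ioi fun t ht => ?_
  have ht : 0 < t := ht
  rcases lt_or_ge t 1 with ht1 | ht1
  · rw [ball_eq_superlevel_gaussian x hb ht, withDensity_apply _ measurableSet_ball, mul_comm]
    exact setLIntegral_ball_le_hlMax G x
      (Real.sqrt_pos.2 (div_pos (neg_pos.2 (Real.log_neg ht ht1)) hb))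
  · have : {y : E d | t < Real.exp (-b * ‖x - y‖ ^ 2)} = ∅ := by
      ext y
      simp only [mem_ofPred_eq, mem_empty_iff_false, iff_false, not_lt]
      refine le_trans (Real.exp_le_one_iff.2 ?_) ht1
      nlinarith [sq_nonneg ‖x - y‖]
    rw [this]
    simp

end Maximal

/-! ### Layer-cake formulas, interpolation and consequences of weak type bounds. -/

section LayerCake

variable {X Y : Type*} [MeasurableSpace X] [MeasurableSpace Y]

theorem lintegral_lintegral_superlevel (μ : Measure X) [SFinite μ] {H : X → ℝ≥0∞}
    (hH : Measurable H) {k : ℝ → ℝ≥0∞} (hk : Measurable k) :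
    ∫⁻ x, (∫⁻ t in Ioi (0 : ℝ), {t : ℝ | ENNReal.ofReal t < H x}.indicator k t) ∂μ =
      ∫⁻ t in Ioi (0 : ℝ), k t * μ {x | ENNReal.ofReal t < H x} := by
  have hset : MeasurableSet {z : X × ℝ | ENNReal.ofReal z.2 < H z.1} :=
    measurableSet_lt (by fun_prop) (by fun_prop)
  rw [lintegral_lintegral_swap]
  · refine lintegral_congr fun t => ?_
    rw [← lintegral_indicator_const (measurableSet_lt measurable_const hH)]
    rfl
  · exact ((hk.comp measurable_snd).indicator hset).aemeasurable

theorem rpow_eq_lintegral_superlevel (a : ℝ≥0∞) {p : ℝ} (hp : 0 < p) :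
    a ^ p = ∫⁻ t in Ioi (0 : ℝ), {t : ℝ | ENNReal.ofReal t < a}.indicator
      (fun t => ENNReal.ofReal (p * t ^ (p - 1))) t := by
  have hfin : ∀ b : ℝ, 0 ≤ b →
      ∫⁻ t in Ioc 0 b, ENNReal.ofReal (p * t ^ (p - 1)) = ENNReal.ofReal (b ^ p) := by
    intro b hb
    have hi : IntervalIntegrable (fun t : ℝ => p * t ^ (p - 1)) volume 0 b :=
      (intervalIntegral.intervalIntegrable_rpow' (by linarith)).const_mul p
    rw [← ofReal_integral_eq_lintegral_ofReal
      ((intervalIntegrable_iff_integrableOn_Ioc_of_le hb).1 hi), ←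
      intervalIntegral.integral_of_le hb, intervalIntegral.integral_const_mul,
      integral_rpow (Or.inl (by linarith))]
    · congr 1
      rw [sub_add_cancel, Real.zero_rpow hp.ne']
      field_simp
      ring
    · filter_upwards [ae_restrict_mem measurableSet_Ioc] with t ht
      have := ht.1
      positivity
  induction a using ENNReal.recTopCoe with
  | top =>
    rw [ENNReal.top_rpow_of_pos hp]
    symm
    -- At an infinite value the integral up to r^{1/p} already equals r, for every r.
    refine ENNReal.eq_top_of_forall_nnreal_le fun r => ?_
    have h := hfin ((r : ℝ) ^ (1 / p)) (by positivity)
    rw [← Real.rpow_mul r.coe_nonneg, one_div_mul_cancel hp.ne', Real.rpow_one, ENNReal.ofReal_coe_nnreal]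
      at h
    rw [← h]
    refine (lintegral_mono_set Ioc_subset_Ioi_self).trans (lintegral_mono fun t => ?_)
    simp [indicator_of_mem]
  | coe a =>
    have h := hfin a a.2
    rw [← ENNReal.ofReal_rpow_of_nonneg a.coe_nonneg hp.le, ENNReal.ofReal_coe_nnreal] at h
    rw [← h, setLIntegral_congr (Ioo_ae_eq_Ioc (α := ℝ) (μ := volume) (a := 0) (b := (a : ℝ))).symm,
      ← lintegral_indicator measurableSet_Ioo, ← lintegral_indicator measurableSet_Ioi]
    refine lintegral_congr fun t => ?_
    by_cases h0 : 0 < t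
    · have : ENNReal.ofReal t < a ↔ t < a := by
        rw [← ENNReal.ofReal_coe_nnreal, ENNReal.ofReal_lt_ofReal_iff_of_nonneg h0.le]
      by_cases h1 : t < a
      · rw [indicator_of_mem (show t ∈ Ioo 0 (a : ℝ) from ⟨h0, h1⟩),
          indicator_of_mem (show t ∈ Ioi 0 from h0), indicator_of_mem (by exact this.2 h1)]
      · rw [indicator_of_notMem (fun h => h1 h.2),
          indicator_of_mem (show t ∈ Ioi 0 from h0), indicator_of_notMem
            (show t ∉ {t : ℝ | ENNReal.ofReal t < a} from fun h => h1 (this.1 h))]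
    · rw [indicator_of_notMem (fun h => h0 h.1), indicator_of_notMem
        (show t ∉ Ioi (0 : ℝ) from h0)]

theorem lintegral_rpow_eq_superlevel (μ : Measure X) [SFinite μ] {H : X → ℝ≥0∞}
    (hH : Measurable H) {p : ℝ} (hp : 0 < p) :
    ∫⁻ x, H x ^ p ∂μ =
      ∫⁻ t in Ioi (0 : ℝ), ENNReal.ofReal (p * t ^ (p - 1)) * μ {x | ENNReal.ofReal t < H x} := by
  rw [← lintegral_lintegral_superlevel μ hH (by fun_prop)]
  exact lintegral_congr fun x => rpow_eq_lintegral_superlevel _ hp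

/-- Marcinkiewicz interpolation between weak type `(1, 1)` and strong type `(∞, ∞)`, for a pair of
functions. -/
theorem lintegral_rpow_le_of_weak_type (μ : Measure X) [SFinite μ] (ρ : Measure Y) [SFinite ρ]
    {T : X → ℝ≥0∞} (hT : Measurable T) {g : Y → ℝ≥0∞} (hg : Measurable g) {p : ℝ} (hp : 1 < p)
    {K : ℝ≥0∞} (h : ∀ t : ℝ, 0 < t → μ {x | ENNReal.ofReal t < T x} ≤
      K / ENNReal.ofReal t * ∫⁻ y in {y | ENNReal.ofReal t < 2 * g y}, g y ∂ρ) :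
    ∫⁻ x, T x ^ p ∂μ ≤
      K * ENNReal.ofReal (p / (p - 1)) * 2 ^ (p - 1) * ∫⁻ y, g y ^ p ∂ρ := by
  have hp1 : 0 < p - 1 := by linarith
  have hset : ∀ t : ℝ, MeasurableSet {y | ENNReal.ofReal t < 2 * g y} := fun t =>
    measurableSet_lt measurable_const (by fun_prop)
  rw [lintegral_rpow_eq_superlevel μ hT (by linarith)]
  -- The factor 1/t of the weak type bound lowers t^{p-1} to t^{p-2}, which is the layer cake of
  -- (2g)^{p-1} for the measure g dρ.
  calc ∫⁻ t in Ioi (0 : ℝ), ENNReal.ofReal (p * t ^ (p - 1)) * μ {x | ENNReal.ofReal t < T x}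
      ≤ ∫⁻ t in Ioi (0 : ℝ), K * ENNReal.ofReal (p / (p - 1)) *
          (ENNReal.ofReal ((p - 1) * t ^ (p - 1 - 1)) *
            (ρ.withDensity g) {y | ENNReal.ofReal t < 2 * g y}) := by
        refine setLIntegral_mono' measurableSet_Ioi fun t ht => ?_
        have ht : 0 < t := ht
        rw [withDensity_apply _ (hset t)]
        refine (mul_le_mul_right (h t ht) _).trans (le_of_eq ?_)
        have : ENNReal.ofReal (p * t ^ (p - 1)) * (ENNReal.ofReal t)⁻¹ =
            ENNReal.ofReal (p / (p - 1)) * ENNReal.ofReal ((p - 1) * t ^ (p - 1 - 1)) := by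
          rw [← ENNReal.ofReal_inv_of_pos ht, ← ENNReal.ofReal_mul (by positivity),
            ← ENNReal.ofReal_mul (by positivity), Real.rpow_sub_one ht.ne' (p - 1)]
          congr 1
          field_simp
        rw [div_eq_mul_inv]
        calc _ = K * (ENNReal.ofReal (p * t ^ (p - 1)) * (ENNReal.ofReal t)⁻¹) *
            ∫⁻ y in {y | ENNReal.ofReal t < 2 * g y}, g y ∂ρ := by ring
          _ = _ := by rw [this]; ring
    _ = K * ENNReal.ofReal (p / (p - 1)) * ∫⁻ y, (2 * g y) ^ (p - 1) ∂(ρ.withDensity g) := by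
        rw [lintegral_rpow_eq_superlevel (ρ.withDensity g) (by fun_prop) hp1, lintegral_const_mul]
        refine Measurable.mul (by fun_prop) (Antitone.measurable fun s t hst => ?_)
        exact measure_mono fun y hy => lt_of_le_of_lt (ENNReal.ofReal_le_ofReal hst) hy
    _ = _ := by
        rw [lintegral_withDensity_eq_lintegral_mul _ hg (by fun_prop)]
        have : ∀ y, (g * fun y => (2 * g y) ^ (p - 1)) y = 2 ^ (p - 1) * g y ^ p := by
          intro y
          simp only [Pi.mul_apply]
          rw [ENNReal.mul_rpow_of_nonneg _ _ hp1.le, mul_left_comm]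
          congr 1
          nth_rw 1 [← ENNReal.rpow_one (g y)]
          rw [← ENNReal.rpow_add_of_nonneg _ _ zero_le_one hp1.le]
          congr 1
          ring
        simp_rw [this]
        rw [lintegral_const_mul _ (by fun_prop)]
        ring

/-- A bare weak L¹ bound would give the divergent ∫ dt/t; the gain ε at both ends is what makes the
weak type argument close. -/
theorem lintegral_min_rpow_div_lt_top {ε : ℝ} (hε : 0 < ε) :
    ∫⁻ t in Ioi (0 : ℝ), ENNReal.ofReal (min (t ^ ε) (t ^ (-ε))) / ENNReal.ofReal t < ∞ := by
  have h1 : IntegrableOn (fun t : ℝ => t ^ (ε - 1)) (Ioc 0 1) :=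
    (intervalIntegrable_iff_integrableOn_Ioc_of_le zero_le_one).1
      (intervalIntegral.intervalIntegrable_rpow' (by linarith))
  have h2 : IntegrableOn (fun t : ℝ => t ^ (-ε - 1)) (Ioi 1) :=
    integrableOn_Ioi_rpow_of_lt (by linarith) one_pos
  rw [← Ioc_union_Ioi_eq_Ioi (zero_le_one (α := ℝ))]
  refine (lintegral_union_le _ _ _).trans_lt (ENNReal.add_lt_top.2 ⟨?_, ?_⟩)
  · refine lt_of_le_of_lt (setLIntegral_mono' measurableSet_Ioc fun t ht => ?_) h1.lintegral_lt_top
    rw [← ENNReal.ofReal_div_of_pos ht.1, Real.rpow_sub_one ht.1.ne']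
    exact ENNReal.ofReal_le_ofReal (div_le_div_of_nonneg_right (min_le_left _ _) ht.1.le)
  · refine lt_of_le_of_lt (setLIntegral_mono' measurableSet_Ioi fun t ht => ?_) h2.lintegral_lt_top
    have ht : 0 < t := zero_lt_one.trans ht
    rw [← ENNReal.ofReal_div_of_pos ht, Real.rpow_sub_one ht.ne']
    exact ENNReal.ofReal_le_ofReal (div_le_div_of_nonneg_right (min_le_right _ _) ht.le)

/-- The interval (a/2, a) alone suffices: it has length a/2, lies below H, and there the integrand
is at least 2^{-ε} min(a^ε, a^{-ε}). -/
theorem ofReal_mul_min_rpow_le {ε a : ℝ} (hε : 0 < ε) (ha : 0 < a) {H : ℝ≥0∞}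
    (h : ENNReal.ofReal a < H) :
    ENNReal.ofReal (a * min (a ^ ε) (a ^ (-ε))) ≤ ENNReal.ofReal (2 ^ (1 + ε)) *
      ∫⁻ t in Ioi (0 : ℝ), {t : ℝ | ENNReal.ofReal t < H}.indicator
        (fun t => ENNReal.ofReal (min (t ^ ε) (t ^ (-ε)))) t := by
  have hlow : ENNReal.ofReal (2 ^ (-ε) * min (a ^ ε) (a ^ (-ε))) * ENNReal.ofReal (a / 2) ≤
      ∫⁻ t in Ioi (0 : ℝ), {t : ℝ | ENNReal.ofReal t < H}.indicator
        (fun t => ENNReal.ofReal (min (t ^ ε) (t ^ (-ε)))) t := by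
    calc _ = ∫⁻ t in Ioo (a / 2) a, ENNReal.ofReal (2 ^ (-ε) * min (a ^ ε) (a ^ (-ε))) := by
          rw [setLIntegral_const, Real.volume_Ioo, sub_half]
      _ ≤ ∫⁻ t in Ioo (a / 2) a, {t : ℝ | ENNReal.ofReal t < H}.indicator
            (fun t => ENNReal.ofReal (min (t ^ ε) (t ^ (-ε)))) t := by
          refine setLIntegral_mono' measurableSet_Ioo fun t ht => ?_
          have ht0 : 0 < t := (half_pos ha).trans ht.1
          rw [indicator_of_mem (show t ∈ {t : ℝ | ENNReal.ofReal t < H} from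
            (ENNReal.ofReal_le_ofReal ht.2.le).trans_lt h)]
          refine ENNReal.ofReal_le_ofReal (le_min ?_ ?_)
          · calc 2 ^ (-ε) * min (a ^ ε) (a ^ (-ε)) ≤ 2 ^ (-ε) * a ^ ε := by
                  gcongr; exact min_le_left _ _
              _ = (a / 2) ^ ε := by
                  rw [Real.div_rpow ha.le two_pos.le, Real.rpow_neg two_pos.le]; ring
              _ ≤ t ^ ε := Real.rpow_le_rpow (by positivity) ht.1.le hε.le
          · calc 2 ^ (-ε) * min (a ^ ε) (a ^ (-ε)) ≤ 1 * a ^ (-ε) := by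
                  gcongr
                  · exact Real.rpow_le_one_of_one_le_of_nonpos one_le_two (by linarith)
                  · exact min_le_right _ _
              _ = a ^ (-ε) := one_mul _
              _ ≤ t ^ (-ε) := Real.rpow_le_rpow_of_nonpos ht0 ht.2.le (by linarith)
      _ ≤ _ := lintegral_mono_set fun t ht => (half_pos ha).trans ht.1
  refine le_trans (le_of_eq ?_) (mul_le_mul_right hlow _)
  rw [← ENNReal.ofReal_mul (by positivity), ← ENNReal.ofReal_mul (by positivity)]
  congr 1
  rw [Real.rpow_add two_pos, Real.rpow_neg two_pos.le, Real.rpow_one]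
  field_simp

/-- If `W ≤ A · min(A^ε, A^{-ε})` and `H` is in weak `L¹`, then the `W`-measure of `{A < H}` is
controlled by the weak norm of `H`. -/
theorem setLIntegral_lt_le_of_weak_type (μ : Measure X) [SFinite μ] {ε : ℝ} (hε : 0 < ε)
    {A W H : X → ℝ≥0∞} (hA : Measurable A) (hH : Measurable H)
    (hW1 : ∀ x, W x ≤ A x * A x ^ ε) (hW2 : ∀ x, W x ≤ A x * A x ^ (-ε)) {K : ℝ≥0∞}
    (hK : ∀ t : ℝ, 0 < t → μ {x | ENNReal.ofReal t < H x} ≤ K / ENNReal.ofReal t) :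
    ∫⁻ x in {x | A x < H x}, W x ∂μ ≤ ENNReal.ofReal (2 ^ (1 + ε)) *
      (∫⁻ t in Ioi (0 : ℝ), ENNReal.ofReal (min (t ^ ε) (t ^ (-ε))) / ENNReal.ofReal t) * K := by
  calc ∫⁻ x in {x | A x < H x}, W x ∂μ
      ≤ ∫⁻ x in {x | A x < H x}, ENNReal.ofReal (2 ^ (1 + ε)) *
          (∫⁻ t in Ioi (0 : ℝ), {t : ℝ | ENNReal.ofReal t < H x}.indicator
            (fun t => ENNReal.ofReal (min (t ^ ε) (t ^ (-ε)))) t) ∂μ := by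
        refine setLIntegral_mono' (measurableSet_lt hA hH) fun x hx => ?_
        have hx : A x < H x := hx
        rcases eq_or_ne (A x) 0 with h0 | h0
        · have : W x = 0 := by simpa [h0] using hW1 x
          simp [this]
        have ht : A x ≠ ∞ := hx.ne_top
        obtain ⟨a, ha, hax⟩ : ∃ a : ℝ, 0 < a ∧ A x = ENNReal.ofReal a :=
          ⟨(A x).toReal, ENNReal.toReal_pos h0 ht, (ENNReal.ofReal_toReal ht).symm⟩
        have h1 := hW1 x
        have h2 := hW2 x
        rw [hax, ENNReal.ofReal_rpow_of_pos ha, ← ENNReal.ofReal_mul ha.le] at h1 h2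
        refine le_trans ?_ (ofReal_mul_min_rpow_le hε ha (hax ▸ hx))
        rw [mul_min_of_nonneg _ _ ha.le, ENNReal.ofReal_min]
        exact le_min h1 h2
    _ ≤ ∫⁻ x, ENNReal.ofReal (2 ^ (1 + ε)) *
          (∫⁻ t in Ioi (0 : ℝ), {t : ℝ | ENNReal.ofReal t < H x}.indicator
            (fun t => ENNReal.ofReal (min (t ^ ε) (t ^ (-ε)))) t) ∂μ := setLIntegral_le_lintegral _ _
    _ = ENNReal.ofReal (2 ^ (1 + ε)) * ∫⁻ t in Ioi (0 : ℝ),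
          ENNReal.ofReal (min (t ^ ε) (t ^ (-ε))) * μ {x | ENNReal.ofReal t < H x} := by
        rw [lintegral_const_mul' _ _ (by simp), lintegral_lintegral_superlevel μ hH (by fun_prop)]
    _ ≤ ENNReal.ofReal (2 ^ (1 + ε)) * ∫⁻ t in Ioi (0 : ℝ),
          ENNReal.ofReal (min (t ^ ε) (t ^ (-ε))) / ENNReal.ofReal t * K := by
        refine mul_le_mul_right (setLIntegral_mono' measurableSet_Ioi fun t ht => ?_) _
        refine (mul_le_mul_right (hK t ht) _).trans (le_of_eq ?_)
        simp only [div_eq_mul_inv]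
        ring
    _ = _ := by
        rw [lintegral_mul_const _ (by fun_prop), mul_assoc]

/-- Kolmogorov's inequality: a function in weak `L¹` has powers `θ < 1` integrable on sets of finite
measure. -/
theorem lintegral_rpow_lt_top_of_weak_type {μ ρ : Measure X} [SFinite ρ] (hρ : ρ univ < ∞)
    (hle : ∀ s, ρ s ≤ μ s) {H : X → ℝ≥0∞} (hH : Measurable H) {θ : ℝ} (hθ : 0 < θ) (hθ1 : θ < 1)
    {K : ℝ≥0∞} (hKt : K ≠ ∞)
    (hK : ∀ t : ℝ, 0 < t → μ {x | ENNReal.ofReal t < H x} ≤ K / ENNReal.ofReal t) :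
    ∫⁻ x, H x ^ θ ∂ρ < ∞ := by
  -- Levels t ≤ 1 use the finite mass of ρ and θ > 0; levels t > 1 use the weak bound and θ < 1.
  rw [lintegral_rpow_eq_superlevel ρ hH hθ, ← Ioc_union_Ioi_eq_Ioi (zero_le_one (α := ℝ))]
  refine (lintegral_union_le _ _ _).trans_lt (ENNReal.add_lt_top.2 ⟨?_, ?_⟩)
  · have h1 : IntegrableOn (fun t : ℝ => θ * t ^ (θ - 1)) (Ioc 0 1) :=
      ((intervalIntegrable_iff_integrableOn_Ioc_of_le zero_le_one).1
        (intervalIntegral.intervalIntegrable_rpow' (by linarith))).const_mul θ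
    calc _ ≤ ∫⁻ t in Ioc (0 : ℝ) 1, ENNReal.ofReal (θ * t ^ (θ - 1)) * ρ univ := by
          refine lintegral_mono fun t => mul_le_mul_right (measure_mono (subset_univ _)) _
      _ = (∫⁻ t in Ioc (0 : ℝ) 1, ENNReal.ofReal (θ * t ^ (θ - 1))) * ρ univ :=
          lintegral_mul_const _ (by fun_prop)
      _ < ∞ := ENNReal.mul_lt_top h1.lintegral_lt_top hρ
  · have h2 : IntegrableOn (fun t : ℝ => θ * t ^ (θ - 1 - 1)) (Ioi 1) :=
      (integrableOn_Ioi_rpow_of_lt (by linarith) one_pos).const_mul θ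
    calc _ ≤ ∫⁻ t in Ioi (1 : ℝ), ENNReal.ofReal (θ * t ^ (θ - 1 - 1)) * K := by
          refine setLIntegral_mono' measurableSet_Ioi fun t ht => ?_
          have ht : 0 < t := zero_lt_one.trans ht
          refine (mul_le_mul_right ((hle _).trans (hK t ht)) _).trans (le_of_eq ?_)
          rw [Real.rpow_sub_one ht.ne' (θ - 1), ← mul_div_assoc θ, ENNReal.ofReal_div_of_pos ht]
          simp only [div_eq_mul_inv]
          ring
      _ = (∫⁻ t in Ioi (1 : ℝ), ENNReal.ofReal (θ * t ^ (θ - 1 - 1))) * K :=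
          lintegral_mul_const _ (by fun_prop)
      _ < ∞ := ENNReal.mul_lt_top h2.lintegral_lt_top hKt.lt_top

end LayerCake

/-! ### The local maximal operator and its two-weight inequality. -/

section LocalMaximal

variable {d : ℕ}

/-- The local maximal operator of a nonnegative function. -/
def locMax (G : E d → ℝ≥0∞) (x : E d) : ℝ≥0∞ :=
  hlMax ({y : E d | ‖y‖ ≤ 3 * max ‖x‖ 1}.indicator G) x

theorem measurableSet_norm_le (R : ℝ) : MeasurableSet {y : E d | ‖y‖ ≤ R} :=
  measurableSet_le measurable_norm measurable_const

theorem locMax_mono {G H : E d → ℝ≥0∞} (h : ∀ᵐ y, G y ≤ H y) (x : E d) :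
    locMax G x ≤ locMax H x :=
  hlMax_mono (h.mono fun y hy => by
    by_cases hm : y ∈ {y : E d | ‖y‖ ≤ 3 * max ‖x‖ 1} <;> simp [hm, hy]) x

theorem locMax_congr {G H : E d → ℝ≥0∞} (h : G =ᵐ[volume] H) (x : E d) :
    locMax G x = locMax H x :=
  le_antisymm (locMax_mono (h.mono fun _ h => h.le) x) (locMax_mono (h.mono fun _ h => h.ge) x)

theorem locMax_le_hlMax (G : E d → ℝ≥0∞) (x : E d) : locMax G x ≤ hlMax G x :=
  hlMax_mono (Filter.Eventually.of_forall fun _ => indicator_le_self _ _ _) x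

theorem locMax_add_const_mul_le {G H : E d → ℝ≥0∞} (hG : AEMeasurable G) {c : ℝ≥0∞} (hc : c ≠ ∞)
    (x : E d) : locMax (fun y => G y + c * H y) x ≤ locMax G x + c * locMax H x := by
  have h := hlMax_add_le (G := {y : E d | ‖y‖ ≤ 3 * max ‖x‖ 1}.indicator G)
    (H := fun y => c * {y : E d | ‖y‖ ≤ 3 * max ‖x‖ 1}.indicator H y)
    (hG.indicator (measurableSet_norm_le _)) x
  rw [hlMax_const_mul c hc] at h
  refine le_trans (hlMax_mono (Filter.Eventually.of_forall fun y => ?_) x) h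
  by_cases hm : y ∈ {y : E d | ‖y‖ ≤ 3 * max ‖x‖ 1} <;> simp [hm]

theorem measurable_locMax {G : E d → ℝ≥0∞} (hG : AEMeasurable G) : Measurable (locMax G) := by
  have : locMax G = locMax (hG.mk G) := funext fun x => locMax_congr hG.ae_eq_mk x
  rw [this]
  refine measurable_hlMax (G := fun x => {y : E d | ‖y‖ ≤ 3 * max ‖x‖ 1}.indicator (hG.mk G)) ?_
  have hset : MeasurableSet {z : E d × E d | ‖z.2‖ ≤ 3 * max ‖z.1‖ 1} :=
    measurableSet_le (by fun_prop) (by fun_prop)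
  exact (hG.measurable_mk.comp measurable_snd).indicator hset

theorem measurable_hlMax' {G : E d → ℝ≥0∞} (hG : Measurable G) : Measurable (hlMax G) :=
  measurable_hlMax (G := fun _ => G) (hG.comp measurable_snd)

/-- The two-weight inequality for the local maximal operator, in the form of a bound for
`M F / M S` against the measure `S`. -/
theorem lintegral_locMax_div_rpow_le (hd : 1 ≤ d) {p ε : ℝ} (hp : 1 < p) (hε : 0 < ε) :
    ∃ C : ℝ≥0∞, C ≠ ∞ ∧ ∀ S F W : E d → ℝ≥0∞, AEMeasurable S → AEMeasurable F → AEMeasurable W →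
      (∀ᵐ y, S y ≠ 0 ∧ S y ≠ ∞) → (∀ᵐ x, locMax S x ≠ 0 ∧ locMax S x ≠ ∞) →
      (∀ x, W x ≤ locMax S x * locMax S x ^ ε) → (∀ x, W x ≤ locMax S x * locMax S x ^ (-ε)) →
      ∫⁻ x, W x * (locMax F x / locMax S x) ^ p ≤ C * ∫⁻ y, F y ^ p * S y ^ (1 - p) := by
  set C₁ : ℝ≥0∞ := ENNReal.ofReal (2 ^ (1 + ε)) *
    (∫⁻ t in Ioi (0 : ℝ), ENNReal.ofReal (min (t ^ ε) (t ^ (-ε))) / ENNReal.ofReal t) with hC₁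
  have hC₁t : C₁ ≠ ∞ := ENNReal.mul_ne_top (by simp) (lintegral_min_rpow_div_lt_top hε).ne
  refine ⟨C₁ * (5 ^ d * 2) * ENNReal.ofReal (p / (p - 1)) * 2 ^ (p - 1), ?_, ?_⟩
  · exact ENNReal.mul_ne_top (ENNReal.mul_ne_top (ENNReal.mul_ne_top hC₁t (by finiteness))
      (by simp)) (ENNReal.rpow_ne_top_of_nonneg (by linarith) (by simp))
  -- Measurable S and F come first; the general case follows by replacing them with measurable
  -- versions, which leaves `locMax` unchanged everywhere.
  have key : ∀ S F W : E d → ℝ≥0∞, Measurable S → Measurable F → AEMeasurable W →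
      (∀ᵐ y, S y ≠ 0 ∧ S y ≠ ∞) → (∀ᵐ x, locMax S x ≠ 0 ∧ locMax S x ≠ ∞) →
      (∀ x, W x ≤ locMax S x * locMax S x ^ ε) → (∀ x, W x ≤ locMax S x * locMax S x ^ (-ε)) →
      ∫⁻ x, W x * (locMax F x / locMax S x) ^ p ≤
        C₁ * (5 ^ d * 2) * ENNReal.ofReal (p / (p - 1)) * 2 ^ (p - 1) *
          ∫⁻ y, F y ^ p * S y ^ (1 - p) := by
    intro S F W hS hF hW hS0 hA0 hW1 hW2
    have hAm := measurable_locMax hS.aemeasurable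
    have hT : Measurable fun x => locMax F x / locMax S x :=
      (measurable_locMax hF.aemeasurable).div hAm
    have hg : Measurable fun y => F y / S y := hF.div hS
    have eT : ∫⁻ x, (locMax F x / locMax S x) ^ p ∂(volume.withDensity W) =
        ∫⁻ x, W x * (locMax F x / locMax S x) ^ p :=
      lintegral_withDensity_eq_lintegral_mul₀ hW (hT.pow_const p).aemeasurable
    have eg : ∫⁻ y, (F y / S y) ^ p ∂(volume.withDensity S) =
        ∫⁻ y, S y * (F y / S y) ^ p :=
      lintegral_withDensity_eq_lintegral_mul _ hS (hg.pow_const p)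
    have h := lintegral_rpow_le_of_weak_type (volume.withDensity W) (volume.withDensity S) hT hg hp
      (K := C₁ * (5 ^ d * 2)) ?_
    · rw [eT, eg] at h
      refine h.trans (le_of_eq ?_)
      congr 1
      refine lintegral_congr_ae (hS0.mono fun y hy => ?_)
      beta_reduce
      rw [ENNReal.div_rpow_of_nonneg _ _ (by linarith), ENNReal.rpow_sub _ _ hy.1 hy.2,
        ENNReal.rpow_one]
      simp only [div_eq_mul_inv]
      ring
    · intro t ht
      have ht2 : 0 < t / 2 := half_pos ht
      have htadd : ENNReal.ofReal t = ENNReal.ofReal (t / 2) + ENNReal.ofReal (t / 2) := by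
        rw [← ENNReal.ofReal_add ht2.le ht2.le, add_halves]
      have hset : MeasurableSet {y | ENNReal.ofReal t < 2 * (F y / S y)} :=
        measurableSet_lt measurable_const (by fun_prop)
      -- Calderón-style truncation at height t/2: G is F where F/S > t/2, and elsewhere F ≤ (t/2) S.
      set G : E d → ℝ≥0∞ := {y | ENNReal.ofReal t < 2 * (F y / S y)}.indicator
        (fun y => S y * (F y / S y)) with hG
      have hGm : Measurable G := (hS.mul hg).indicator hset
      have hGint : ∫⁻ y, G y =
          ∫⁻ y in {y | ENNReal.ofReal t < 2 * (F y / S y)}, F y / S y ∂(volume.withDensity S) := by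
        rw [setLIntegral_withDensity_eq_setLIntegral_mul _ hS hg hset, hG,
          lintegral_indicator hset]
        rfl
      have hFle : ∀ᵐ y, F y ≤ G y + ENNReal.ofReal (t / 2) * S y := by
        filter_upwards [hS0] with y hy
        have hFy : S y * (F y / S y) = F y := ENNReal.mul_div_cancel hy.1 hy.2
        by_cases hm : ENNReal.ofReal t < 2 * (F y / S y)
        · rw [hG, indicator_of_mem (by exact hm), hFy]
          exact le_self_add
        · refine le_trans ?_ le_add_self
          rw [← hFy, mul_comm]
          gcongr
          rw [ENNReal.ofReal_div_of_pos two_pos, ENNReal.le_div_iff_mul_le (by simp) (by simp),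
            mul_comm]
          simpa using not_lt.1 hm
      rw [withDensity_apply _ (measurableSet_lt measurable_const hT)]
      -- If t·M S < M F ≤ M G + (t/2)·M S, half of the left side can be cancelled, and the full
      -- maximal function of G exceeds (t/2)·M S.
      have hsub : {x | ENNReal.ofReal t < locMax F x / locMax S x} ≤ᵐ[volume]
          {x | locMax S x < hlMax G x / ENNReal.ofReal (t / 2)} := by
        filter_upwards [hA0] with x hx hxt
        have hxt : ENNReal.ofReal t < locMax F x / locMax S x := hxt
        change locMax S x < hlMax G x / ENNReal.ofReal (t / 2)
        rw [ENNReal.lt_div_iff_mul_lt (Or.inl hx.1) (Or.inl hx.2), htadd, add_mul] at hxt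
        have h1 := hxt.trans_le ((locMax_mono hFle x).trans
          (locMax_add_const_mul_le hGm.aemeasurable ENNReal.ofReal_ne_top x))
        have h2 := lt_of_add_lt_add_right h1
        rw [ENNReal.lt_div_iff_mul_lt (by simp [ht]) (by simp), mul_comm]
        exact h2.trans_le (locMax_le_hlMax _ _)
      refine (lintegral_mono_set' hsub).trans ?_
      have h := setLIntegral_lt_le_of_weak_type (volume : Measure (E d)) hε hAm
        (H := fun x => hlMax G x / ENNReal.ofReal (t / 2)) ((measurable_hlMax' hGm).div_const _)
        hW1 hW2 (K := 5 ^ d * (∫⁻ y, G y) / ENNReal.ofReal (t / 2)) ?_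
      · refine h.trans (le_of_eq ?_)
        rw [← hC₁, hGint, ENNReal.ofReal_div_of_pos two_pos]
        have : (ENNReal.ofReal t / ENNReal.ofReal 2)⁻¹ = 2 * (ENNReal.ofReal t)⁻¹ := by
          rw [ENNReal.inv_div (by simp) (by simp), div_eq_mul_inv]
          simp
        rw [div_eq_mul_inv (5 ^ d * _), this]
        simp only [div_eq_mul_inv]
        ring
      · intro τ hτ
        have : {x | ENNReal.ofReal τ < hlMax G x / ENNReal.ofReal (t / 2)} =
            {x | ENNReal.ofReal (τ * (t / 2)) < hlMax G x} := by
          ext x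
          simp only [mem_ofPred_eq]
          rw [ENNReal.lt_div_iff_mul_lt (by simp [ht]) (by simp), ENNReal.ofReal_mul hτ.le]
        rw [this]
        refine (volume_lt_hlMax_le hd G (by positivity)).trans (le_of_eq ?_)
        rw [ENNReal.ofReal_mul hτ.le]
        simp only [div_eq_mul_inv]
        rw [ENNReal.mul_inv (by simp) (by simp)]
        ring
  intro S F W hS hF hW hS0 hA0 hW1 hW2
  have eS : locMax S = locMax (hS.mk S) := funext fun x => locMax_congr hS.ae_eq_mk x
  have eF : locMax F = locMax (hF.mk F) := funext fun x => locMax_congr hF.ae_eq_mk x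
  rw [eS] at hA0 hW1 hW2 ⊢
  rw [eF]
  refine (key _ _ W hS.measurable_mk hF.measurable_mk hW ?_ hA0 hW1 hW2).trans (le_of_eq ?_)
  · filter_upwards [hS0, hS.ae_eq_mk] with y h1 h2
    rwa [← h2]
  · congr 1
    refine lintegral_congr_ae ?_
    filter_upwards [hS.ae_eq_mk, hF.ae_eq_mk] with y h1 h2
    rw [← h1, ← h2]

/-- The local maximal function of an a.e. positive function decays at most polynomially. -/
theorem exists_le_locMax {S : E d → ℝ≥0∞} (hS : AEMeasurable S) (hS0 : ∀ᵐ y, S y ≠ 0) :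
    ∃ c : ℝ, 0 < c ∧ ∀ x, ENNReal.ofReal (c * (1 + ‖x‖) ^ (-(d : ℝ))) ≤ locMax S x := by
  have hI : ∫⁻ y in Metric.ball (0 : E d) 1, S y ≠ 0 := by
    rw [Ne, lintegral_eq_zero_iff' hS.restrict]
    intro h
    have h0 : ∀ᵐ y ∂(volume.restrict (Metric.ball (0 : E d) 1)), False := by
      filter_upwards [h, ae_restrict_of_ae hS0] with y h1 h2
      exact h2 h1
    rw [Filter.eventually_false_iff_eq_bot, ae_eq_bot, Measure.restrict_eq_zero] at h0
    exact volume_ball_pos 0 one_pos h0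
  set c₀ : ℝ≥0∞ := (volume (Metric.ball (0 : E d) 1))⁻¹ * ∫⁻ y in Metric.ball (0 : E d) 1, S y
    with hc₀
  have hc : c₀ ≠ 0 := mul_ne_zero (ENNReal.inv_ne_zero.2 (volume_ball_ne_top _ _)) hI
  have hmain : ∀ x, c₀ * ENNReal.ofReal ((1 + ‖x‖) ^ (-(d : ℝ))) ≤ locMax S x := by
    intro x
    have hr : 0 < 1 + ‖x‖ := by positivity
    refine le_trans ?_ (le_iSup₂ (f := fun (r : ℝ) (_ : r ∈ Ioi (0 : ℝ)) =>
      (volume (Metric.ball x r))⁻¹ * ∫⁻ y in Metric.ball x r,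
        {y : E d | ‖y‖ ≤ 3 * max ‖x‖ 1}.indicator S y) (1 + ‖x‖) hr)
    -- The ball of radius 1+|x| about x contains the unit ball at 0, and the cutoff radius is never
    -- below 3, so it does not touch that ball.
    have h1 : ∫⁻ y in Metric.ball (0 : E d) 1, S y ≤ ∫⁻ y in Metric.ball x (1 + ‖x‖),
        {y : E d | ‖y‖ ≤ 3 * max ‖x‖ 1}.indicator S y := by
      calc ∫⁻ y in Metric.ball (0 : E d) 1, S y
          ≤ ∫⁻ y in Metric.ball (0 : E d) 1, {y : E d | ‖y‖ ≤ 3 * max ‖x‖ 1}.indicator S y := by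
            refine setLIntegral_mono' measurableSet_ball fun y hy => ?_
            rw [indicator_of_mem]
            have h1 : ‖y‖ < 1 := by simpa using hy
            have h2 := le_max_right ‖x‖ 1
            change ‖y‖ ≤ 3 * max ‖x‖ 1
            linarith
        _ ≤ _ := lintegral_mono_set (Metric.ball_subset_ball' (by simp))
    rw [volume_ball_eq x hr, ENNReal.mul_inv (by simp [hr]) (by simp),
      ← ENNReal.ofReal_inv_of_pos (by positivity), ← Real.rpow_natCast, ← Real.rpow_neg hr.le]
    calc _ = ENNReal.ofReal ((1 + ‖x‖) ^ (-(d : ℝ))) * (volume (Metric.ball (0 : E d) 1))⁻¹ *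
          ∫⁻ y in Metric.ball (0 : E d) 1, S y := by rw [hc₀]; ring
      _ ≤ _ := by gcongr
  obtain ⟨c, hc1, hc2⟩ := ENNReal.lt_iff_exists_real_btwn.1 (pos_iff_ne_zero.2 hc)
  refine ⟨c, by simpa using hc2.1, fun x => le_trans ?_ (hmain x)⟩
  rw [ENNReal.ofReal_mul hc1]
  gcongr
  exact hc2.2.le

/-- Inside the cutoff 1+|y| ≤ 4(1+|x|), so a polynomial weight in y can be traded for one in x. This
is how weak type (1,1) applies to an S that is integrable only after polynomial damping. -/
theorem locMax_le_mul_hlMax {K : ℝ} (hK : 0 ≤ K) (S : E d → ℝ≥0∞) (x : E d) :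
    locMax S x ≤ ENNReal.ofReal ((4 * (1 + ‖x‖)) ^ K) *
      hlMax (fun y => S y * ENNReal.ofReal ((1 + ‖y‖) ^ (-K))) x := by
  rw [← hlMax_const_mul _ ENNReal.ofReal_ne_top]
  refine hlMax_mono (Filter.Eventually.of_forall fun y => ?_) x
  by_cases hy : ‖y‖ ≤ 3 * max ‖x‖ 1
  · rw [indicator_of_mem (by exact hy), mul_left_comm, ← ENNReal.ofReal_mul (by positivity)]
    refine le_mul_of_one_le_right' (ENNReal.one_le_ofReal.2 ?_)
    rw [Real.rpow_neg (by positivity), ← div_eq_mul_inv, one_le_div (by positivity)]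
    refine Real.rpow_le_rpow (by positivity) ?_ hK
    have : max ‖x‖ 1 ≤ ‖x‖ + 1 := max_le (by linarith) (by linarith [norm_nonneg x])
    linarith [norm_nonneg x]
  · rw [indicator_of_notMem (by exact hy)]
    exact zero_le

end LocalMaximal

/-! ### Elementary estimates for powers, exponentials and tanh. -/

section RealBounds

theorem exists_rpow_le_mul_exp {K : ℝ} (hK : 0 ≤ K) :
    ∃ C : ℝ, 0 < C ∧ ∀ z : ℝ, 0 ≤ z → z ^ K ≤ C * Real.exp z := by
  set n := ⌈K⌉₊
  refine ⟨1 + n.factorial, by positivity, fun z hz => ?_⟩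
  have h1 : z ^ K ≤ 1 + z ^ n := by
    rcases le_total z 1 with h | h
    · exact (Real.rpow_le_one hz h hK).trans (by linarith [pow_nonneg hz n])
    · calc z ^ K ≤ z ^ (n : ℝ) := Real.rpow_le_rpow_of_exponent_le h (Nat.le_ceil K)
        _ = z ^ n := Real.rpow_natCast z n
        _ ≤ 1 + z ^ n := by linarith
  have h2 : z ^ n ≤ n.factorial * Real.exp z := by
    have := Real.pow_div_factorial_le_exp z hz n
    rwa [div_le_iff₀ (by positivity), mul_comm] at this
  have h3 : 1 ≤ Real.exp z := Real.one_le_exp hz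
  nlinarith

theorem tanh_pos {u : ℝ} (hu : 0 < u) : 0 < Real.tanh u := by
  rw [Real.tanh_eq_sinh_div_cosh]
  exact div_pos (Real.sinh_pos_iff.2 hu) (Real.cosh_pos u)

theorem tanh_le_self {u : ℝ} (hu : 0 < u) : Real.tanh u ≤ u := by
  have h := Real.cosh_pos u
  rw [Real.tanh_eq_sinh_div_cosh, div_le_iff₀ h]
  have hd : ∀ x : ℝ, HasDerivAt (fun x => x * Real.cosh x - Real.sinh x) (x * Real.sinh x) x := by
    intro x
    have := ((hasDerivAt_id x).mul (Real.hasDerivAt_cosh x)).sub (Real.hasDerivAt_sinh x)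
    refine this.congr_deriv ?_
    simp
  have hmono : MonotoneOn (fun x : ℝ => x * Real.cosh x - Real.sinh x) (Ici 0) := by
    refine monotoneOn_of_deriv_nonneg (convex_Ici 0)
      (fun x _ => (hd x).continuousAt.continuousWithinAt)
      (fun x _ => (hd x).differentiableAt.differentiableWithinAt) fun x hx => ?_
    rw [(hd x).deriv]
    rw [interior_Ici] at hx
    exact mul_nonneg hx.le (Real.sinh_nonneg_iff.2 hx.le)
  have := hmono (mem_Ici.2 le_rfl) (mem_Ici.2 hu.le) hu.le
  simp only [Real.sinh_zero, zero_mul, sub_zero] at this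
  linarith

/-- For large u the coefficient of y in the completed square is 1 - tanh u; this lower bound is the
source of the scale Xe^{2u} in the far region. -/
theorem one_sub_tanh_ge {u : ℝ} (hu : 0 < u) : Real.exp (-(2 * u)) ≤ 1 - Real.tanh u := by
  have h : 1 - Real.tanh u = 2 * Real.exp (-u) / (Real.exp u + Real.exp (-u)) := by
    rw [Real.tanh_eq_sinh_div_cosh, Real.sinh_eq, Real.cosh_eq]
    field_simp
    ring
  rw [h, le_div_iff₀ (by positivity)]
  have e1 : Real.exp (-(2 * u)) * Real.exp u = Real.exp (-u) := by
    rw [← Real.exp_add]; ring_nf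
  have e2 : Real.exp (-(2 * u)) ≤ 1 := Real.exp_le_one_iff.2 (by linarith)
  have e3 := Real.exp_pos (-u)
  nlinarith

end RealBounds

/-! ### Pointwise bounds for the Mehler kernel. -/

section Mehler

variable {d : ℕ}

/-- The factor of the Mehler kernel that depends on `u` only. -/
def mehlerPref (d : ℕ) (m u : ℝ) : ℝ :=
  Real.exp (-(u * m)) * (2 * Real.pi * Real.sinh (2 * u)) ^ (-((d : ℝ) / 2))

/-- Completion of the square after tanh 2u = 2s/(1+s²) with s = tanh u. It isolates e^{-|y|²/2}, the
Gaussian in φ, and leaves a nonpositive remainder. -/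
theorem mehler_exponent_eq {u : ℝ} (hu : 0 < u) (x y : E d) :
    -(‖x - y‖ ^ 2 / (2 * Real.tanh (2 * u))) - Real.tanh u * inner ℝ x y =
      (‖x‖ ^ 2 - ‖y‖ ^ 2) / 2 -
        ‖(1 + Real.tanh u) • x - (1 - Real.tanh u) • y‖ ^ 2 / (4 * Real.tanh u) := by
  have hs := tanh_pos hu
  have hc := Real.cosh_pos u
  have ht : Real.tanh (2 * u) = 2 * Real.tanh u / (1 + Real.tanh u ^ 2) := by
    rw [Real.tanh_eq_sinh_div_cosh, Real.tanh_eq_sinh_div_cosh, Real.sinh_two_mul,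
      Real.cosh_two_mul]
    have : Real.cosh u ^ 2 + Real.sinh u ^ 2 ≠ 0 := by positivity
    field_simp
  rw [ht, norm_sub_sq_real, norm_sub_sq_real, norm_smul, norm_smul, inner_smul_left,
    inner_smul_right, mul_pow, mul_pow, Real.norm_eq_abs, Real.norm_eq_abs, sq_abs, sq_abs]
  simp only [conj_trivial]
  field_simp
  ring

theorem mehler_eq (m : ℝ) {u : ℝ} (hu : 0 < u) (x y : E d) :
    mehler d m u x y = mehlerPref d m u * (Real.exp ((‖x‖ ^ 2 - ‖y‖ ^ 2) / 2) *
      Real.exp (-(‖(1 + Real.tanh u) • x - (1 - Real.tanh u) • y‖ ^ 2 / (4 * Real.tanh u)))) := by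
  rw [mehler, mehler_exponent_eq hu, mehlerPref, sub_eq_add_neg, Real.exp_add]

theorem mehlerPref_pos (d : ℕ) (m : ℝ) {u : ℝ} (hu : 0 < u) : 0 < mehlerPref d m u := by
  have : 0 < Real.sinh (2 * u) := Real.sinh_pos_iff.2 (by linarith)
  unfold mehlerPref
  positivity

theorem mehler_nonneg (m : ℝ) {u : ℝ} (hu : 0 < u) (x y : E d) : 0 ≤ mehler d m u x y := by
  have := mehlerPref_pos d m hu
  rw [mehler_eq m hu]
  positivity

theorem mehlerPref_le_of_le {m : ℝ} (hm : -(d : ℝ) ≤ m) {u : ℝ} (hu : 0 < u) (hu1 : u ≤ 1 / 4) :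
    mehlerPref d m u ≤ Real.exp d * u ^ (-((d : ℝ) / 2)) := by
  have h1 : u ≤ 2 * Real.pi * Real.sinh (2 * u) := by
    have h2 : 2 * u ≤ Real.sinh (2 * u) := Real.self_le_sinh_iff.2 (by linarith)
    nlinarith [Real.pi_gt_three]
  unfold mehlerPref
  refine mul_le_mul (Real.exp_le_exp.2 ?_)
    (Real.rpow_le_rpow_of_nonpos hu h1 (by simp; positivity)) (by positivity) (by positivity)
  have hd : (0 : ℝ) ≤ d := d.cast_nonneg
  nlinarith

/-- Here 2π sinh 2u ≥ e^{2u}, so the dimension adds d to m: the decay rate is β = d + m, and it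
vanishes exactly in the critical case m = -d. -/
theorem mehlerPref_le_of_ge (m : ℝ) {u : ℝ} (hu : 1 / 4 ≤ u) :
    mehlerPref d m u ≤ Real.exp (-(u * (d + m))) := by
  have h1 : Real.exp (2 * u) ≤ 2 * Real.pi * Real.sinh (2 * u) := by
    have h2 : Real.exp (-(2 * u)) * 2 ≤ Real.exp (2 * u) := by
      have h3 : Real.exp (2 * u) = Real.exp (-(2 * u)) * Real.exp (4 * u) := by
        rw [← Real.exp_add]; ring_nf
      rw [h3]
      have h4 : (2 : ℝ) ≤ Real.exp (4 * u) := by linarith [Real.add_one_le_exp (4 * u)]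
      gcongr
    rw [Real.sinh_eq]
    have := Real.pi_gt_three
    nlinarith [Real.exp_pos (2 * u), Real.exp_pos (-(2 * u))]
  calc mehlerPref d m u ≤ Real.exp (-(u * m)) * (Real.exp (2 * u)) ^ (-((d : ℝ) / 2)) := by
        unfold mehlerPref
        gcongr ?_ * ?_
        exact Real.rpow_le_rpow_of_nonpos (Real.exp_pos _) h1 (by simp; positivity)
    _ = _ := by
        rw [← Real.exp_mul, ← Real.exp_add]
        ring_nf

theorem mehlerPref_le {m : ℝ} (hm : -(d : ℝ) ≤ m) {u : ℝ} (hu : 0 < u) :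
    mehlerPref d m u ≤ Real.exp d * u ^ (-((d : ℝ) / 2)) + 1 := by
  rcases le_total u (1 / 4) with h | h
  · linarith [mehlerPref_le_of_le hm hu h]
  · have : Real.exp (-(u * (d + m))) ≤ 1 := Real.exp_le_one_iff.2 (by nlinarith)
    have h2 : 0 ≤ Real.exp d * u ^ (-((d : ℝ) / 2)) := by positivity
    linarith [mehlerPref_le_of_ge (d := d) m h]

theorem mehler_le_pref (m : ℝ) {u : ℝ} (hu : 0 < u) (x y : E d) :
    mehler d m u x y ≤ mehlerPref d m u * Real.exp ((‖x‖ ^ 2 - ‖y‖ ^ 2) / 2) := by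
  rw [mehler_eq m hu, ← mul_assoc]
  have hs := tanh_pos hu
  have := mehlerPref_pos d m hu
  refine mul_le_of_le_one_right (by positivity) (Real.exp_le_one_iff.2 ?_)
  rw [neg_nonpos]
  positivity

/-- The vector differs from x - y by s(x+y), of length at most 4sX; its square over s is controlled
because sX² ≤ 1. -/
theorem sq_norm_near_ge {x y : E d} {s X : ℝ} (hs : 0 < s) (hsX : s * X ^ 2 ≤ 1)
    (hx : ‖x‖ ≤ X) (hy : ‖y‖ ≤ 3 * X) :
    ‖x - y‖ ^ 2 / (8 * s) - 4 ≤ ‖(1 + s) • x - (1 - s) • y‖ ^ 2 / (4 * s) := by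
  have e : (1 + s) • x - (1 - s) • y = (x - y) + s • (x + y) := by module
  have h1 : ‖x - y‖ ≤ ‖(1 + s) • x - (1 - s) • y‖ + s * (4 * X) := by
    calc ‖x - y‖ = ‖((1 + s) • x - (1 - s) • y) - s • (x + y)‖ := by rw [e]; simp
      _ ≤ ‖(1 + s) • x - (1 - s) • y‖ + ‖s • (x + y)‖ := norm_sub_le _ _
      _ ≤ _ := by
        rw [norm_smul, Real.norm_eq_abs, abs_of_pos hs]
        gcongr
        linarith [norm_add_le x y]
  set Q := ‖(1 + s) • x - (1 - s) • y‖
  have h2 : ‖x - y‖ ^ 2 ≤ 2 * Q ^ 2 + 32 * s * (s * X ^ 2) := by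
    have : ‖x - y‖ ^ 2 ≤ (Q + s * (4 * X)) ^ 2 := by gcongr
    nlinarith [sq_nonneg (Q - s * (4 * X))]
  have h3 : ‖x - y‖ ^ 2 ≤ 2 * Q ^ 2 + 32 * s := by nlinarith
  rw [sub_le_iff_le_add, div_le_iff₀ (by positivity)]
  have : (Q ^ 2 / (4 * s) + 4) * (8 * s) = 2 * Q ^ 2 + 32 * s := by field_simp; ring
  rw [this]
  exact h3

/-- The heat semigroup on functions supported in the local region is dominated by the local maximal
operator, up to a polynomial factor. -/
theorem exists_heat_local_le {m : ℝ} (hm : -(d : ℝ) ≤ m) :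
    ∃ C : ℝ, 0 ≤ C ∧ ∀ (u : ℝ) (_ : 0 < u) (x : E d) (F : E d → ℝ≥0∞), AEMeasurable F →
      ∫⁻ y in {y : E d | ‖y‖ ≤ 3 * max ‖x‖ 1}, ENNReal.ofReal (mehler d m u x y) *
        (ENNReal.ofReal (Real.exp (‖y‖ ^ 2 / 2)) * F y) ≤
      ENNReal.ofReal (C * max ‖x‖ 1 ^ (2 * d) * Real.exp (‖x‖ ^ 2 / 2)) * locMax F x := by
  set V : ℝ := (volume (Metric.ball (0 : E d) 1)).toReal with hV
  set C₁ : ℝ := Real.exp d * Real.exp 4 * (Real.pi * 8) ^ ((d : ℝ) / 2) with hC₁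
  set C₂ : ℝ := (Real.exp d * 2 ^ d) * (5 ^ d * V) with hC₂
  have hV0 : 0 ≤ V := ENNReal.toReal_nonneg
  have hC₁0 : 0 ≤ C₁ := by positivity
  have hC₂0 : 0 ≤ C₂ := by positivity
  refine ⟨C₁ + C₂, by positivity, fun u hu x F hF => ?_⟩
  set X := max ‖x‖ 1
  have hX1 : 1 ≤ X := le_max_right _ _
  have hxX : ‖x‖ ≤ X := le_max_left _ _
  have hX2 : 1 ≤ X ^ (2 * d) := one_le_pow₀ hX1
  have hpref := mehlerPref_pos d m hu
  have hD : MeasurableSet {y : E d | ‖y‖ ≤ 3 * X} := measurableSet_norm_le _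
  have hs := tanh_pos hu
  have hsu := tanh_le_self hu
  -- Short times give a true Gaussian average. For 4uX² > 1 the factor u^{-d/2} is at most (2X)^d,
  -- and a plain average over a ball of radius 5X, which contains the local region, is enough.
  rcases le_or_gt (4 * u * X ^ 2) 1 with huX | huX
  · have hX2' : 1 ≤ X ^ 2 := one_le_pow₀ hX1
    have hu4 : u ≤ 1 / 4 := by nlinarith
    have hpt : ∀ y ∈ {y : E d | ‖y‖ ≤ 3 * X}, ENNReal.ofReal (mehler d m u x y) *
        (ENNReal.ofReal (Real.exp (‖y‖ ^ 2 / 2)) * F y) ≤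
        ENNReal.ofReal (Real.exp d * u ^ (-((d : ℝ) / 2)) * Real.exp (‖x‖ ^ 2 / 2) * Real.exp 4) *
          (ENNReal.ofReal (Real.exp (-(1 / (8 * u)) * ‖x - y‖ ^ 2)) * F y) := by
      intro y hy
      rw [← mul_assoc, ← mul_assoc, ← ENNReal.ofReal_mul (mehler_nonneg m hu x y),
        ← ENNReal.ofReal_mul (by positivity)]
      gcongr ENNReal.ofReal ?_ * _
      rw [mehler_eq m hu]
      have h1 := sq_norm_near_ge hs (by nlinarith) hxX hy
      have h2 : ‖x - y‖ ^ 2 / (8 * u) ≤ ‖x - y‖ ^ 2 / (8 * Real.tanh u) := by gcongr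
      calc mehlerPref d m u * (Real.exp ((‖x‖ ^ 2 - ‖y‖ ^ 2) / 2) *
            Real.exp (-(‖(1 + Real.tanh u) • x - (1 - Real.tanh u) • y‖ ^ 2 /
              (4 * Real.tanh u)))) * Real.exp (‖y‖ ^ 2 / 2)
          = mehlerPref d m u * Real.exp (‖x‖ ^ 2 / 2) *
            Real.exp (-(‖(1 + Real.tanh u) • x - (1 - Real.tanh u) • y‖ ^ 2 /
              (4 * Real.tanh u))) := by
            rw [show (‖x‖ ^ 2 - ‖y‖ ^ 2) / 2 = ‖x‖ ^ 2 / 2 + -(‖y‖ ^ 2 / 2) by ring, Real.exp_add,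
              Real.exp_neg (‖y‖ ^ 2 / 2)]
            field_simp
        _ ≤ (Real.exp d * u ^ (-((d : ℝ) / 2))) * Real.exp (‖x‖ ^ 2 / 2) *
            Real.exp (4 + -(1 / (8 * u)) * ‖x - y‖ ^ 2) := by
            refine mul_le_mul (mul_le_mul_of_nonneg_right (mehlerPref_le_of_le hm hu hu4)
              (Real.exp_pos _).le) (Real.exp_le_exp.2 ?_) (Real.exp_pos _).le (by positivity)
            have : -(1 / (8 * u)) * ‖x - y‖ ^ 2 = -(‖x - y‖ ^ 2 / (8 * u)) := by ring
            rw [this]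
            linarith
        _ = _ := by rw [Real.exp_add]; ring
    have hb : 0 < 1 / (8 * u) := by positivity
    calc _ ≤ ∫⁻ y in {y : E d | ‖y‖ ≤ 3 * X},
          ENNReal.ofReal (Real.exp d * u ^ (-((d : ℝ) / 2)) * Real.exp (‖x‖ ^ 2 / 2) * Real.exp 4) *
          (ENNReal.ofReal (Real.exp (-(1 / (8 * u)) * ‖x - y‖ ^ 2)) * F y) :=
          setLIntegral_mono' hD hpt
      _ = ENNReal.ofReal (Real.exp d * u ^ (-((d : ℝ) / 2)) * Real.exp (‖x‖ ^ 2 / 2) * Real.exp 4) *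
          ∫⁻ y, ENNReal.ofReal (Real.exp (-(1 / (8 * u)) * ‖x - y‖ ^ 2)) *
            {y : E d | ‖y‖ ≤ 3 * X}.indicator F y := by
          rw [lintegral_const_mul' _ _ ENNReal.ofReal_ne_top, ← lintegral_indicator hD]
          congr 1
          refine lintegral_congr fun y => ?_
          by_cases hy : y ∈ {y : E d | ‖y‖ ≤ 3 * X} <;> simp [hy]
      _ ≤ ENNReal.ofReal (Real.exp d * u ^ (-((d : ℝ) / 2)) * Real.exp (‖x‖ ^ 2 / 2) * Real.exp 4) *
          (ENNReal.ofReal ((Real.pi / (1 / (8 * u))) ^ ((d : ℝ) / 2)) * locMax F x) := by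
          gcongr
          exact lintegral_gaussian_mul_le (hF.indicator hD) x hb
      _ = ENNReal.ofReal (C₁ * Real.exp (‖x‖ ^ 2 / 2)) * locMax F x := by
          rw [← mul_assoc, ← ENNReal.ofReal_mul (by positivity)]
          congr 2
          rw [show Real.pi / (1 / (8 * u)) = Real.pi * 8 * u by field_simp,
            Real.mul_rpow (by positivity) hu.le, Real.rpow_neg hu.le, hC₁]
          field_simp
      _ ≤ _ := by
          gcongr
          nlinarith
  · have hpref2 : mehlerPref d m u ≤ Real.exp d * 2 ^ d * X ^ d := by
      rcases le_total u (1 / 4) with h | h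
      · refine (mehlerPref_le_of_le hm hu h).trans ?_
        have h1 : 1 / (2 * X) ^ 2 ≤ u := by
          rw [div_le_iff₀ (by positivity)]
          nlinarith
        have h2 : u ^ (-((d : ℝ) / 2)) ≤ (1 / (2 * X) ^ 2) ^ (-((d : ℝ) / 2)) :=
          Real.rpow_le_rpow_of_nonpos (by positivity) h1 (by simp; positivity)
        have h3 : (1 / (2 * X) ^ 2) ^ (-((d : ℝ) / 2)) = 2 ^ d * X ^ d := by
          rw [one_div, Real.inv_rpow (by positivity), Real.rpow_neg (by positivity), inv_inv,
            ← Real.rpow_natCast (2 * X) 2, ← Real.rpow_mul (by positivity), ← mul_pow,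
            ← Real.rpow_natCast (2 * X) d]
          congr 1
          push_cast
          ring
        rw [h3] at h2
        rw [mul_assoc]
        gcongr
      · have h1 : Real.exp (-(u * (d + m))) ≤ 1 := Real.exp_le_one_iff.2 (by nlinarith)
        have h2 : (1 : ℝ) ≤ Real.exp d := Real.one_le_exp d.cast_nonneg
        have h3 : (1 : ℝ) ≤ 2 ^ d := one_le_pow₀ one_le_two
        have h4 : 1 ≤ X ^ d := one_le_pow₀ hX1
        refine ((mehlerPref_le_of_ge m h).trans h1).trans ?_
        exact one_le_mul_of_one_le_of_one_le (one_le_mul_of_one_le_of_one_le h2 h3) h4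
    have hpt : ∀ y, ENNReal.ofReal (mehler d m u x y) *
        (ENNReal.ofReal (Real.exp (‖y‖ ^ 2 / 2)) * F y) ≤
        ENNReal.ofReal (Real.exp d * 2 ^ d * X ^ d * Real.exp (‖x‖ ^ 2 / 2)) * F y := by
      intro y
      rw [← mul_assoc, ← ENNReal.ofReal_mul (mehler_nonneg m hu x y)]
      gcongr ENNReal.ofReal ?_ * _
      calc mehler d m u x y * Real.exp (‖y‖ ^ 2 / 2)
          ≤ mehlerPref d m u * Real.exp ((‖x‖ ^ 2 - ‖y‖ ^ 2) / 2) * Real.exp (‖y‖ ^ 2 / 2) := by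
            gcongr
            exact mehler_le_pref m hu x y
        _ = mehlerPref d m u * Real.exp (‖x‖ ^ 2 / 2) := by
            rw [mul_assoc, ← Real.exp_add]
            ring_nf
        _ ≤ _ := by gcongr
    have hX5 : 0 < 5 * X := by positivity
    calc _ ≤ ∫⁻ y in {y : E d | ‖y‖ ≤ 3 * X},
          ENNReal.ofReal (Real.exp d * 2 ^ d * X ^ d * Real.exp (‖x‖ ^ 2 / 2)) * F y :=
          lintegral_mono hpt
      _ = ENNReal.ofReal (Real.exp d * 2 ^ d * X ^ d * Real.exp (‖x‖ ^ 2 / 2)) *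
          ∫⁻ y in {y : E d | ‖y‖ ≤ 3 * X}, {y : E d | ‖y‖ ≤ 3 * X}.indicator F y := by
          rw [lintegral_const_mul' _ _ ENNReal.ofReal_ne_top]
          congr 1
          exact setLIntegral_congr_fun hD fun y hy => (indicator_of_mem hy F).symm
      _ ≤ ENNReal.ofReal (Real.exp d * 2 ^ d * X ^ d * Real.exp (‖x‖ ^ 2 / 2)) *
          ∫⁻ y in Metric.ball x (5 * X), {y : E d | ‖y‖ ≤ 3 * X}.indicator F y := by
          gcongr
          intro y hy
          have hy : ‖y‖ ≤ 3 * X := hy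
          rw [Metric.mem_ball, dist_eq_norm]
          linarith [norm_sub_le y x]
      _ ≤ ENNReal.ofReal (Real.exp d * 2 ^ d * X ^ d * Real.exp (‖x‖ ^ 2 / 2)) *
          (volume (Metric.ball x (5 * X)) * locMax F x) := by
          gcongr
          exact setLIntegral_ball_le_hlMax _ x hX5
      _ = ENNReal.ofReal (C₂ * X ^ (2 * d) * Real.exp (‖x‖ ^ 2 / 2)) * locMax F x := by
          rw [volume_ball_eq x hX5, ← ENNReal.ofReal_toReal (volume_ball_ne_top (0 : E d) 1), ← hV,
            ← mul_assoc, ← ENNReal.ofReal_mul (by positivity), ← ENNReal.ofReal_mul (by positivity)]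
          congr 2
          rw [hC₂]
          ring
      _ ≤ _ := by
          gcongr
          linarith

/-- Gaussian decay of the Mehler kernel in the far region for small times. -/
theorem mehler_far_le_of_le {m : ℝ} (hm : -(d : ℝ) ≤ m) {u : ℝ} (hu : 0 < u) (hu1 : u ≤ 1 / 4)
    {x y : E d} (hxy : 3 * max ‖x‖ 1 ≤ ‖y‖) :
    mehler d m u x y ≤ Real.exp ((‖x‖ ^ 2 - ‖y‖ ^ 2) / 2) *
      (Real.exp d * u ^ (-((d : ℝ) / 2)) * Real.exp (-(‖y‖ ^ 2 / (36 * u)))) := by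
  have hs := tanh_pos hu
  have hsu := tanh_le_self hu
  set s := Real.tanh u with hs'
  have hx : 3 * ‖x‖ ≤ ‖y‖ := le_trans (by gcongr; exact le_max_left _ _) hxy
  -- With s ≤ 1/4 and |x| ≤ |y|/3 the norm is at least (3/4 - 5/12)|y|.
  have h1 : ‖y‖ / 3 ≤ ‖(1 + s) • x - (1 - s) • y‖ := by
    have h2 : ‖(1 - s) • y‖ - ‖(1 + s) • x‖ ≤ ‖(1 + s) • x - (1 - s) • y‖ := by
      rw [norm_sub_rev]
      exact norm_sub_norm_le _ _
    rw [norm_smul, norm_smul, Real.norm_eq_abs, Real.norm_eq_abs, abs_of_pos (by linarith),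
      abs_of_pos (by linarith)] at h2
    nlinarith [norm_nonneg x, norm_nonneg y]
  have h2 : ‖y‖ ^ 2 / (36 * u) ≤ ‖(1 + s) • x - (1 - s) • y‖ ^ 2 / (4 * s) := by
    calc ‖y‖ ^ 2 / (36 * u) = (‖y‖ / 3) ^ 2 / (4 * u) := by field_simp; ring
      _ ≤ _ := by gcongr
  rw [mehler_eq m hu, ← hs']
  calc _ ≤ (Real.exp d * u ^ (-((d : ℝ) / 2))) * (Real.exp ((‖x‖ ^ 2 - ‖y‖ ^ 2) / 2) *
        Real.exp (-(‖y‖ ^ 2 / (36 * u)))) := by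
        refine mul_le_mul (mehlerPref_le_of_le hm hu hu1) ?_ (by positivity) (by positivity)
        gcongr
    _ = _ := by ring

/-- Decay of the Mehler kernel in the far region for large times. -/
theorem exists_mehler_far_le_of_ge (d : ℕ) (m : ℝ) {K : ℝ} (hK : 0 ≤ K) :
    ∃ C : ℝ, 0 ≤ C ∧ ∀ (u : ℝ) (_ : 1 / 4 ≤ u) (x y : E d), 3 * max ‖x‖ 1 ≤ ‖y‖ →
      mehler d m u x y ≤ Real.exp ((‖x‖ ^ 2 - ‖y‖ ^ 2) / 2) *
        (C * (Real.exp (-(u * (d + m))) * min 1 ((max ‖x‖ 1 * Real.exp (2 * u) / ‖y‖) ^ K))) := by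
  obtain ⟨C, hC, h⟩ := exists_rpow_le_mul_exp (K := K / 2) (by positivity)
  refine ⟨1 + 4 ^ K + C * 16 ^ (K / 2), by positivity, fun u hu x y hxy => ?_⟩
  have hu0 : 0 < u := by linarith
  have hs := tanh_pos hu0
  have hs1 : Real.tanh u < 1 := Real.tanh_lt_one u
  have hδ := one_sub_tanh_ge hu0
  set s := Real.tanh u with hs'
  set X := max ‖x‖ 1 with hX
  have hX1 : 1 ≤ X := le_max_right _ _
  have hxX : ‖x‖ ≤ X := le_max_left _ _
  have hy0 : 0 < ‖y‖ := by linarith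
  set Q := ‖(1 + s) • x - (1 - s) • y‖ with hQ
  set δ := 1 - s with hδ'
  have hδ0 : 0 < δ := by linarith
  have hq : 0 < δ * ‖y‖ := by positivity
  have hXq : X / (δ * ‖y‖) ≤ X * Real.exp (2 * u) / ‖y‖ := by
    rw [div_le_div_iff₀ hq hy0]
    have : 1 ≤ Real.exp (2 * u) * δ := by
      have := mul_le_mul_of_nonneg_left hδ (Real.exp_pos (2 * u)).le
      rwa [← Real.exp_add, add_neg_cancel, Real.exp_zero] at this
    nlinarith [mul_pos (zero_lt_one.trans_le hX1) hy0]
  have hXqK : (X / (δ * ‖y‖)) ^ K ≤ (X * Real.exp (2 * u) / ‖y‖) ^ K :=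
    Real.rpow_le_rpow (by positivity) hXq hK
  have hZ : 0 ≤ (X / (δ * ‖y‖)) ^ K := by positivity
  have hexp1 : Real.exp (-(Q ^ 2 / (4 * s))) ≤ 1 := by
    rw [Real.exp_le_one_iff, neg_nonpos]
    positivity
  have hexp : Real.exp (-(Q ^ 2 / (4 * s))) ≤
      (4 ^ K + C * 16 ^ (K / 2)) * (X / (δ * ‖y‖)) ^ K := by
    have hC16 : 0 ≤ C * 16 ^ (K / 2) := by positivity
    have h4 : (0 : ℝ) ≤ 4 ^ K := by positivity
    -- If δ|y| ≤ 4X the right side is already at least 1. Otherwise (1+s)|x| ≤ 2X ≤ δ|y|/2, so Q ≥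
    -- δ|y|/2 and the Gaussian beats any power.
    rcases le_total (δ * ‖y‖) (4 * X) with hc | hc
    · have h1 : 1 ≤ (4 * (X / (δ * ‖y‖))) ^ K := by
        refine Real.one_le_rpow ?_ hK
        rwa [← mul_div_assoc, one_le_div hq]
      rw [Real.mul_rpow (by positivity) (by positivity)] at h1
      nlinarith
    · have h1 : δ * ‖y‖ / 2 ≤ Q := by
        have h2 : ‖δ • y‖ - ‖(1 + s) • x‖ ≤ Q := by
          rw [hQ, norm_sub_rev]
          exact norm_sub_norm_le _ _
        rw [norm_smul, norm_smul, Real.norm_eq_abs, Real.norm_eq_abs, abs_of_pos hδ0,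
          abs_of_pos (by linarith)] at h2
        nlinarith [norm_nonneg x]
      have h2 : (δ * ‖y‖) ^ 2 / 16 ≤ Q ^ 2 / (4 * s) := by
        calc (δ * ‖y‖) ^ 2 / 16 = (δ * ‖y‖ / 2) ^ 2 / (4 * 1) := by ring
          _ ≤ _ := by gcongr
      have h3 := h ((δ * ‖y‖) ^ 2 / 16) (by positivity)
      have h5 : ((δ * ‖y‖) ^ 2 / 16) ^ (K / 2) = (δ * ‖y‖) ^ K / 16 ^ (K / 2) := by
        rw [Real.div_rpow (by positivity) (by norm_num), ← Real.rpow_natCast,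
          ← Real.rpow_mul hq.le]
        congr 2
        push_cast
        ring
      rw [h5, div_le_iff₀ (by positivity)] at h3
      have h6 : Real.exp (-((δ * ‖y‖) ^ 2 / 16)) ≤ C * 16 ^ (K / 2) * (1 / (δ * ‖y‖)) ^ K := by
        rw [Real.div_rpow zero_le_one hq.le, Real.one_rpow, Real.exp_neg, mul_one_div,
          le_div_iff₀ (by positivity), inv_mul_le_iff₀ (Real.exp_pos _)]
        linarith
      calc Real.exp (-(Q ^ 2 / (4 * s))) ≤ Real.exp (-((δ * ‖y‖) ^ 2 / 16)) :=
            Real.exp_le_exp.2 (neg_le_neg h2)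
        _ ≤ C * 16 ^ (K / 2) * (1 / (δ * ‖y‖)) ^ K := h6
        _ ≤ C * 16 ^ (K / 2) * (X / (δ * ‖y‖)) ^ K := by gcongr
        _ ≤ _ := by nlinarith
  have hfin : Real.exp (-(Q ^ 2 / (4 * s))) ≤ (1 + 4 ^ K + C * 16 ^ (K / 2)) *
      min 1 ((X * Real.exp (2 * u) / ‖y‖) ^ K) := by
    have hc : 0 ≤ 4 ^ K + C * 16 ^ (K / 2) := by positivity
    rw [mul_min_of_nonneg _ _ (by positivity)]
    refine le_min (by linarith) ?_
    calc _ ≤ (4 ^ K + C * 16 ^ (K / 2)) * (X / (δ * ‖y‖)) ^ K := hexp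
      _ ≤ (1 + 4 ^ K + C * 16 ^ (K / 2)) * (X * Real.exp (2 * u) / ‖y‖) ^ K := by
        gcongr
        linarith
  rw [mehler_eq m hu0, ← hs']
  calc _ ≤ Real.exp (-(u * (d + m))) * (Real.exp ((‖x‖ ^ 2 - ‖y‖ ^ 2) / 2) *
        ((1 + 4 ^ K + C * 16 ^ (K / 2)) * min 1 ((X * Real.exp (2 * u) / ‖y‖) ^ K))) := by
        refine mul_le_mul (mehlerPref_le_of_ge m hu) ?_ (by positivity) (by positivity)
        gcongr
    _ = _ := by ring

end Mehler

/-! ### The profile ψ and the time integrals that produce it. -/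

section Psi

/-- The radial profile of `e^{|y|²/2} φ(y)`, with `β = d + m`. -/
def psi (β ν R : ℝ) : ℝ :=
  if β = 0 then Real.log (Real.exp 1 + R) ^ (-ν)
  else (1 + R) ^ (-(β / 2)) * Real.log (Real.exp 1 + R) ^ (-(1 + ν))

theorem one_le_log_exp_one_add {R : ℝ} (hR : 0 ≤ R) : 1 ≤ Real.log (Real.exp 1 + R) := by
  rw [Real.le_log_iff_exp_le (by positivity)]
  linarith

theorem log_exp_one_add_le {R : ℝ} (hR : 0 ≤ R) : Real.log (Real.exp 1 + R) ≤ Real.exp 1 + R := by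
  have : 0 < Real.exp 1 + R := by positivity
  linarith [Real.log_le_sub_one_of_pos this]

theorem phi_eq (d : ℕ) (m ν : ℝ) (y : E d) :
    phi d m ν y = Real.exp (-(‖y‖ ^ 2 / 2)) * psi (d + m) ν ‖y‖ := by
  have hL := zero_lt_one.trans_le (one_le_log_exp_one_add (norm_nonneg y))
  have hiff : (d : ℝ) + m = 0 ↔ m = -(d : ℝ) := by
    constructor <;> intro h <;> linarith
  unfold phi psi
  by_cases h : m = -(d : ℝ)
  · rw [if_pos h, if_pos (hiff.2 h), Real.rpow_neg hL.le, div_eq_mul_inv]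
  · rw [if_neg h, if_neg (mt hiff.1 h), Real.rpow_neg hL.le, Real.rpow_neg (by positivity),
      div_eq_mul_inv, mul_inv]

variable {β ν : ℝ}

theorem psi_pos (β ν : ℝ) {R : ℝ} (hR : 0 ≤ R) : 0 < psi β ν R := by
  have hL := zero_lt_one.trans_le (one_le_log_exp_one_add hR)
  unfold psi
  split_ifs <;> positivity

theorem psi_le_one (hβ : 0 ≤ β) (hν : 0 < ν) {R : ℝ} (hR : 0 ≤ R) : psi β ν R ≤ 1 := by
  have hL := one_le_log_exp_one_add hR
  unfold psi
  split_ifs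
  · exact Real.rpow_le_one_of_one_le_of_nonpos hL (by linarith)
  · have h1 := Real.rpow_le_one_of_one_le_of_nonpos (x := 1 + R) (z := -(β / 2)) (by linarith)
      (by linarith)
    have h2 := Real.rpow_le_one_of_one_le_of_nonpos (z := -(1 + ν)) hL (by linarith)
    have h3 : 0 ≤ Real.log (Real.exp 1 + R) ^ (-(1 + ν)) := Real.rpow_nonneg (by linarith) _
    nlinarith

/-- The logarithm is at most e + R, so ψ decays no faster than a power; every estimate with rapid
decay in |y| is absorbed into ψ through this bound. -/
theorem rpow_le_psi (hβ : 0 ≤ β) (hν : 0 < ν) {R : ℝ} (hR : 0 ≤ R) :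
    (Real.exp 1 + R) ^ (-(β / 2 + 1 + ν)) ≤ psi β ν R := by
  have hL := one_le_log_exp_one_add hR
  have hL0 : 0 < Real.log (Real.exp 1 + R) := by linarith
  have hLe := log_exp_one_add_le hR
  have he : 1 ≤ Real.exp 1 := Real.one_le_exp zero_le_one
  have hz : 0 < Real.exp 1 + R := by positivity
  have h1 : (Real.exp 1 + R) ^ (-(1 + ν)) ≤ Real.log (Real.exp 1 + R) ^ (-(1 + ν)) :=
    Real.rpow_le_rpow_of_nonpos hL0 hLe (by linarith)
  unfold psi
  split_ifs with h
  · rw [h]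
    calc (Real.exp 1 + R) ^ (-(0 / 2 + 1 + ν)) = (Real.exp 1 + R) ^ (-(1 + ν)) := by ring_nf
      _ ≤ _ := h1
      _ ≤ _ := Real.rpow_le_rpow_of_exponent_le hL (by linarith)
  · calc (Real.exp 1 + R) ^ (-(β / 2 + 1 + ν))
        = (Real.exp 1 + R) ^ (-(β / 2)) * (Real.exp 1 + R) ^ (-(1 + ν)) := by
          rw [← Real.rpow_add hz]; ring_nf
      _ ≤ _ := mul_le_mul (Real.rpow_le_rpow_of_nonpos (by linarith) (by linarith) (by linarith))
          h1 (by positivity) (by positivity)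

/-- Small times contribute a term of arbitrarily fast polynomial decay. -/
theorem exists_small_time_le (d : ℕ) (hβ : 0 ≤ β) (hν : 0 < ν) :
    ∃ C : ℝ, 0 ≤ C ∧ ∀ R : ℝ, 3 ≤ R → ∀ u : ℝ, 0 < u → u ≤ 1 / 4 →
      Real.exp d * u ^ (-((d : ℝ) / 2)) * Real.exp (-(R ^ 2 / (36 * u))) / u ^ (1 + ν) ≤
        C * psi β ν R := by
  -- The power u^k cancels u^{-d/2-1-ν} with u^β ≤ 1 to spare, and R^{-2k} decays at least as fast
  -- as the lower bound for ψ.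
  set k : ℝ := d / 2 + 1 + ν + β with hk
  have hk0 : 0 ≤ k := by positivity
  obtain ⟨C, hC, h⟩ := exists_rpow_le_mul_exp hk0
  refine ⟨Real.exp d * (C * 36 ^ k * 2 ^ (β / 2 + 1 + ν)), by positivity, fun R hR u hu hu1 => ?_⟩
  have hR0 : 0 < R := by linarith
  have hz : 0 < R ^ 2 / (36 * u) := by positivity
  have h1 : Real.exp (-(R ^ 2 / (36 * u))) ≤ C * (36 ^ k * u ^ k * R ^ (-(2 * k))) := by
    have h2 := h _ hz.le
    have h3 : (36 ^ k * u ^ k * R ^ (-(2 * k))) = ((R ^ 2 / (36 * u)) ^ k)⁻¹ := by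
      rw [Real.div_rpow (by positivity) (by positivity), Real.mul_rpow (by norm_num) hu.le,
        ← Real.rpow_natCast, ← Real.rpow_mul hR0.le, Real.rpow_neg hR0.le, inv_div]
      push_cast
      field_simp
    rw [h3, Real.exp_neg, ← div_eq_mul_inv, le_div_iff₀ (by positivity), inv_mul_le_iff₀
      (Real.exp_pos _)]
    linarith
  have h4 : R ^ (-(2 * k)) ≤ 2 ^ (β / 2 + 1 + ν) * psi β ν R := by
    calc R ^ (-(2 * k)) ≤ R ^ (-(β / 2 + 1 + ν)) := by
          refine Real.rpow_le_rpow_of_exponent_le (by linarith) ?_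
          have : (0 : ℝ) ≤ d := d.cast_nonneg
          rw [hk]
          linarith
      _ = 2 ^ (β / 2 + 1 + ν) * (2 * R) ^ (-(β / 2 + 1 + ν)) := by
          rw [Real.mul_rpow two_pos.le hR0.le, ← mul_assoc, ← Real.rpow_add two_pos]
          simp
      _ ≤ 2 ^ (β / 2 + 1 + ν) * (Real.exp 1 + R) ^ (-(β / 2 + 1 + ν)) := by
          gcongr ?_ * ?_
          refine Real.rpow_le_rpow_of_nonpos (by positivity) ?_ (by linarith)
          linarith [Real.exp_one_lt_d9]
      _ ≤ _ := by
          gcongr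
          exact rpow_le_psi hβ hν hR0.le
  have h5 : u ^ (-((d : ℝ) / 2)) * u ^ k / u ^ (1 + ν) ≤ 1 := by
    rw [← Real.rpow_add hu, ← Real.rpow_sub hu]
    refine Real.rpow_le_one hu.le (by linarith) ?_
    rw [hk]
    linarith
  have hpsi := psi_pos β ν hR0.le
  calc _ ≤ Real.exp d * u ^ (-((d : ℝ) / 2)) * (C * (36 ^ k * u ^ k *
          (2 ^ (β / 2 + 1 + ν) * psi β ν R))) / u ^ (1 + ν) := by
        gcongr
        refine h1.trans ?_
        gcongr
    _ = (u ^ (-((d : ℝ) / 2)) * u ^ k / u ^ (1 + ν)) *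
        (Real.exp d * (C * 36 ^ k * 2 ^ (β / 2 + 1 + ν)) * psi β ν R) := by ring
    _ ≤ 1 * (Real.exp d * (C * 36 ^ k * 2 ^ (β / 2 + 1 + ν)) * psi β ν R) := by gcongr
    _ = _ := one_mul _

/-- Replacing log(R/X) by log(e+R) costs a factor linear in X: e + R ≤ 2R, log X ≤ X - 1, and
log(R/X) ≥ 1 since R/X ≥ 3 > e. -/
theorem log_le_mul_log_div {X R : ℝ} (hX : 1 ≤ X) (hR : 3 * X ≤ R) :
    Real.log (Real.exp 1 + R) ≤ 6 * X * (Real.log (R / X) / 2) := by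
  have hX0 : 0 < X := by linarith
  have hR0 : 0 < R := by linarith
  have h1 : Real.log (Real.exp 1 + R) ≤ Real.log (2 * X * (R / X)) := by
    refine Real.log_le_log (by positivity) ?_
    have : 2 * X * (R / X) = 2 * R := by field_simp
    rw [this]
    linarith [Real.exp_one_lt_d9]
  rw [Real.log_mul (by positivity) (by positivity), Real.log_mul two_ne_zero hX0.ne'] at h1
  have h2 := Real.log_le_sub_one_of_pos hX0
  have h3 : 1 ≤ Real.log (R / X) := by
    rw [Real.le_log_iff_exp_le (by positivity), le_div_iff₀ hX0]
    have := Real.exp_one_lt_d9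
    nlinarith
  have h4 : Real.log 2 ≤ 1 := by linarith [Real.log_two_lt_d9]
  nlinarith

theorem half_le_log_div {X R : ℝ} (hX : 1 ≤ X) (hR : 3 * X ≤ R) :
    1 / 2 ≤ Real.log (R / X) / 2 := by
  have hX0 : 0 < X := by linarith
  have h3 : 1 ≤ Real.log (R / X) := by
    rw [Real.le_log_iff_exp_le (div_pos (by linarith) hX0), le_div_iff₀ hX0]
    have := Real.exp_one_lt_d9
    nlinarith
  linarith

/-- The order of decay used for large times. -/
def farOrder (β ν : ℝ) : ℝ := (β + (4 * (1 + ν) + 1)) / 2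

/-- Up to the transition time v = log(R/X)/2, where Xe^{2v} = R, the integrand is at most the
profile e^{-βv}v^{-1-ν} times e^{u-v}, which has integral one on (-∞, v]. -/
theorem large_time_le_of_le (hν : 0 < ν) {X R u : ℝ} (hX : 1 ≤ X) (hR : 3 * X ≤ R)
    (hu : 1 / 4 ≤ u) (hu1 : u ≤ Real.log (R / X) / 2) :
    Real.exp (-(u * β)) * (X * Real.exp (2 * u) / R) ^ farOrder β ν / u ^ (1 + ν) ≤
      (R / X) ^ (-(β / 2)) * (Real.log (R / X) / 2) ^ (-(1 + ν)) *
        Real.exp (u - Real.log (R / X) / 2) := by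
  have hX0 : 0 < X := by linarith
  have hR0 : 0 < R := by linarith
  have hu0 : 0 < u := by linarith
  set v := Real.log (R / X) / 2 with hv
  have hv0 : 0 < v := by linarith
  have hY : R / X = Real.exp (2 * v) := by
    rw [hv, mul_div_cancel₀ _ two_ne_zero, Real.exp_log (by positivity)]
  have h1 : X * Real.exp (2 * u) / R = Real.exp (2 * (u - v)) := by
    rw [mul_sub, Real.exp_sub, ← hY]
    field_simp
  -- Since u ≥ 1/4, v/u ≤ 1 + 4(v-u) ≤ e^{4(v-u)}. This explains `farOrder`: twice it is β + 4(1+ν)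
  -- + 1, which moves e^{-uβ} to e^{-vβ}, pays for (v/u)^{1+ν} and leaves e^{u-v}.
  have h2 : (v / u) ^ (1 + ν) ≤ Real.exp (4 * (v - u) * (1 + ν)) := by
    rw [Real.exp_mul]
    refine Real.rpow_le_rpow (by positivity) ?_ (by linarith)
    have h3 : v / u ≤ 4 * (v - u) + 1 := by
      rw [div_le_iff₀ hu0]
      nlinarith
    exact h3.trans (Real.add_one_le_exp _)
  rw [Real.div_rpow hv0.le hu0.le, div_le_iff₀ (by positivity)] at h2
  rw [h1, hY, ← Real.exp_mul, ← Real.exp_mul, Real.rpow_neg hv0.le, div_le_iff₀ (by positivity),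
    ← Real.exp_add]
  have h4 : Real.exp (-(u * β) + 2 * (u - v) * farOrder β ν) =
      Real.exp (2 * v * -(β / 2)) * Real.exp (u - v) * Real.exp (-(4 * (v - u) * (1 + ν))) := by
    rw [← Real.exp_add, ← Real.exp_add, farOrder]
    ring_nf
  have h5 : Real.exp (-(4 * (v - u) * (1 + ν))) ≤ (v ^ (1 + ν))⁻¹ * u ^ (1 + ν) := by
    rw [Real.exp_neg, inv_le_iff_one_le_mul₀ (Real.exp_pos _), inv_mul_eq_div, div_mul_eq_mul_div,
      one_le_div (by positivity)]
    linarith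
  rw [h4]
  calc _ ≤ Real.exp (2 * v * -(β / 2)) * Real.exp (u - v) * ((v ^ (1 + ν))⁻¹ * u ^ (1 + ν)) := by
        gcongr
    _ = _ := by ring

theorem lintegral_Iic_exp_sub (v : ℝ) : ∫⁻ u in Iic v, ENNReal.ofReal (Real.exp (u - v)) = 1 := by
  have hi : IntegrableOn (fun u => Real.exp (u - v)) (Iic v) := by
    simp_rw [Real.exp_sub]
    exact (integrableOn_exp_Iic v).div_const _
  rw [← ofReal_integral_eq_lintegral_ofReal hi (by filter_upwards with u; positivity)]
  simp_rw [Real.exp_sub, integral_div, integral_exp_Iic]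
  rw [div_self (Real.exp_pos v).ne', ENNReal.ofReal_one]

theorem lintegral_Ioi_exp_neg_mul {b : ℝ} (hb : 0 < b) (v : ℝ) :
    ∫⁻ u in Ioi v, ENNReal.ofReal (Real.exp (-(u * b))) =
      ENNReal.ofReal (Real.exp (-(v * b)) / b) := by
  have e : ∀ u : ℝ, Real.exp (-(u * b)) = Real.exp (-b * u) := fun u => by ring_nf
  simp_rw [e]
  rw [← ofReal_integral_eq_lintegral_ofReal (integrableOn_exp_mul_Ioi (by linarith) v)
    (by filter_upwards with u; positivity), integral_exp_mul_Ioi (by linarith)]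
  congr 1
  field_simp

theorem lintegral_Ioi_rpow {ν v : ℝ} (hν : 0 < ν) (hv : 0 < v) :
    ∫⁻ u in Ioi v, ENNReal.ofReal (u ^ (-(1 + ν))) = ENNReal.ofReal (v ^ (-ν) / ν) := by
  rw [← ofReal_integral_eq_lintegral_ofReal (integrableOn_Ioi_rpow_of_lt (by linarith) hv)
    (by
      filter_upwards [ae_restrict_mem measurableSet_Ioi] with u hu
      exact Real.rpow_nonneg (hv.trans hu).le _), integral_Ioi_rpow_of_lt (by linarith) hv]
  congr 1
  rw [show -(1 + ν) + 1 = -ν by ring]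
  field_simp

/-- Passing from R/X to R costs X^{β/2} in the power and X^{1+ν} in the logarithm; these make up the
exponent of X. -/
theorem profile_le_psi (hβ : 0 < β) (hν : 0 < ν) {X R : ℝ} (hX : 1 ≤ X)
    (hR : 3 * X ≤ R) :
    (R / X) ^ (-(β / 2)) * (Real.log (R / X) / 2) ^ (-(1 + ν)) ≤
      2 ^ (β / 2) * 6 ^ (1 + ν) * X ^ (β / 2 + 1 + ν) * psi β ν R := by
  have hX0 : 0 < X := by linarith
  have hR0 : 0 < R := by linarith
  have hv := half_le_log_div hX hR
  have hL := log_le_mul_log_div hX hR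
  have hL1 := one_le_log_exp_one_add hR0.le
  set v := Real.log (R / X) / 2
  have h1 : v ^ (-(1 + ν)) ≤ (6 * X) ^ (1 + ν) * Real.log (Real.exp 1 + R) ^ (-(1 + ν)) := by
    have : (6 * X * v) ^ (-(1 + ν)) ≤ Real.log (Real.exp 1 + R) ^ (-(1 + ν)) :=
      Real.rpow_le_rpow_of_nonpos (by linarith) hL (by linarith)
    rw [Real.mul_rpow (by positivity) (by linarith), Real.rpow_neg (by positivity),
      inv_mul_le_iff₀ (by positivity)] at this
    exact this
  have h2 : (R / X) ^ (-(β / 2)) ≤ X ^ (β / 2) * (2 ^ (β / 2) * (1 + R) ^ (-(β / 2))) := by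
    rw [Real.div_rpow hR0.le hX0.le, Real.rpow_neg hX0.le, div_inv_eq_mul, mul_comm]
    gcongr
    have : (2 * R) ^ (-(β / 2)) ≤ (1 + R) ^ (-(β / 2)) :=
      Real.rpow_le_rpow_of_nonpos (by linarith) (by linarith) (by linarith)
    rw [Real.mul_rpow two_pos.le hR0.le, Real.rpow_neg two_pos.le, inv_mul_le_iff₀
      (by positivity)] at this
    exact this
  rw [psi, if_neg hβ.ne']
  calc _ ≤ (X ^ (β / 2) * (2 ^ (β / 2) * (1 + R) ^ (-(β / 2)))) *
        ((6 * X) ^ (1 + ν) * Real.log (Real.exp 1 + R) ^ (-(1 + ν))) := by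
        refine mul_le_mul h2 h1 (by positivity) (by positivity)
    _ = _ := by
        rw [Real.mul_rpow (by norm_num) hX0.le, add_assoc, Real.rpow_add hX0 (β / 2)]
        ring

/-- Large times produce the profile `ψ`, up to a polynomial factor. -/
theorem exists_large_time_le (hβ : 0 ≤ β) (hν : 0 < ν) :
    ∃ C : ℝ, 0 ≤ C ∧ ∀ X R : ℝ, 1 ≤ X → 3 * X ≤ R →
      ∫⁻ u in Ioi (1 / 4 : ℝ), ENNReal.ofReal (Real.exp (-(u * β)) *
        min 1 ((X * Real.exp (2 * u) / R) ^ farOrder β ν) / u ^ (1 + ν)) ≤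
      ENNReal.ofReal (C * X ^ (β / 2 + 1 + ν) * psi β ν R) := by
  have hsplit : ∀ X R : ℝ, 1 ≤ X → 3 * X ≤ R →
      ∫⁻ u in Ioi (1 / 4 : ℝ), ENNReal.ofReal (Real.exp (-(u * β)) *
        min 1 ((X * Real.exp (2 * u) / R) ^ farOrder β ν) / u ^ (1 + ν)) ≤
      ENNReal.ofReal ((R / X) ^ (-(β / 2)) * (Real.log (R / X) / 2) ^ (-(1 + ν))) +
        ∫⁻ u in Ioi (Real.log (R / X) / 2), ENNReal.ofReal
          (Real.exp (-(u * β)) * u ^ (-(1 + ν))) := by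
    intro X R hX hR
    have hX0 : 0 < X := by linarith
    have hR0 : 0 < R := by linarith
    have hv := half_le_log_div hX hR
    rw [← Ioc_union_Ioi_eq_Ioi (show (1 / 4 : ℝ) ≤ Real.log (R / X) / 2 by linarith)]
    refine (lintegral_union_le _ _ _).trans (add_le_add ?_ ?_)
    · calc _ ≤ ∫⁻ u in Ioc (1 / 4) (Real.log (R / X) / 2),
            ENNReal.ofReal ((R / X) ^ (-(β / 2)) * (Real.log (R / X) / 2) ^ (-(1 + ν))) *
              ENNReal.ofReal (Real.exp (u - Real.log (R / X) / 2)) := by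
            refine setLIntegral_mono' measurableSet_Ioc fun u hu => ?_
            rw [← ENNReal.ofReal_mul (by positivity)]
            refine ENNReal.ofReal_le_ofReal
              (le_trans ?_ (large_time_le_of_le hν hX hR hu.1.le hu.2))
            have hu0 : 0 < u := lt_trans (by norm_num) hu.1
            gcongr
            exact min_le_right _ _
        _ ≤ ENNReal.ofReal ((R / X) ^ (-(β / 2)) * (Real.log (R / X) / 2) ^ (-(1 + ν))) *
              ∫⁻ u in Iic (Real.log (R / X) / 2),
                ENNReal.ofReal (Real.exp (u - Real.log (R / X) / 2)) := by
            rw [lintegral_const_mul' _ _ ENNReal.ofReal_ne_top]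
            gcongr
            exact Ioc_subset_Iic_self
        _ = _ := by rw [lintegral_Iic_exp_sub, mul_one]
    · refine setLIntegral_mono' measurableSet_Ioi fun u hu => ENNReal.ofReal_le_ofReal ?_
      have hu0 : 0 < u := lt_trans (by linarith) (show Real.log (R / X) / 2 < u from hu)
      rw [Real.rpow_neg hu0.le, ← div_eq_mul_inv]
      gcongr
      exact mul_le_of_le_one_right (Real.exp_pos _).le (min_le_left _ _)
  -- For β = 0 the tail beyond v has no exponential decay and dominates: ∫ u^{-1-ν} du = v^{-ν}/ν,
  -- one logarithm more than the peak. For β > 0 it is comparable to the peak. This is the case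
  -- split in φ.
  rcases hβ.eq_or_lt with h0 | hβ'
  · refine ⟨(2 + 1 / ν) * 6 ^ ν, by positivity, fun X R hX hR => (hsplit X R hX hR).trans ?_⟩
    have hX0 : 0 < X := by linarith
    have hR0 : 0 < R := by linarith
    have hv := half_le_log_div hX hR
    have hL := log_le_mul_log_div hX hR
    have hL1 := one_le_log_exp_one_add hR0.le
    set v := Real.log (R / X) / 2
    have hv0 : 0 < v := by linarith
    subst h0
    simp only [mul_zero, neg_zero, Real.exp_zero, one_mul, zero_div, Real.rpow_zero, zero_add]
    rw [lintegral_Ioi_rpow hν hv0, ← ENNReal.ofReal_add (by positivity) (by positivity)]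
    refine ENNReal.ofReal_le_ofReal ?_
    have h1 : v ^ (-(1 + ν)) ≤ 2 * v ^ (-ν) := by
      rw [show -(1 + ν) = -ν - 1 by ring, Real.rpow_sub_one hv0.ne', div_le_iff₀ hv0]
      nlinarith [Real.rpow_pos_of_pos hv0 (-ν)]
    have h2 : v ^ (-ν) ≤ (6 * X) ^ ν * Real.log (Real.exp 1 + R) ^ (-ν) := by
      have : (6 * X * v) ^ (-ν) ≤ Real.log (Real.exp 1 + R) ^ (-ν) :=
        Real.rpow_le_rpow_of_nonpos (by linarith) hL (by linarith)
      rw [Real.mul_rpow (by positivity) (by linarith), Real.rpow_neg (by positivity),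
        inv_mul_le_iff₀ (by positivity)] at this
      exact this
    have h3 : X ^ ν ≤ X ^ (1 + ν) := Real.rpow_le_rpow_of_exponent_le hX (by linarith)
    rw [psi, if_pos rfl]
    have hL0 : 0 ≤ Real.log (Real.exp 1 + R) ^ (-ν) := Real.rpow_nonneg (by linarith) _
    calc v ^ (-(1 + ν)) + v ^ (-ν) / ν ≤ 2 * v ^ (-ν) + v ^ (-ν) / ν := by gcongr
      _ = (2 + 1 / ν) * v ^ (-ν) := by ring
      _ ≤ (2 + 1 / ν) * ((6 * X) ^ ν * Real.log (Real.exp 1 + R) ^ (-ν)) := by gcongr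
      _ = (2 + 1 / ν) * 6 ^ ν * X ^ ν * Real.log (Real.exp 1 + R) ^ (-ν) := by
          rw [Real.mul_rpow (by norm_num) hX0.le]; ring
      _ ≤ _ := by gcongr
  · refine ⟨(1 + 1 / β) * (2 ^ (β / 2) * 6 ^ (1 + ν)), by positivity,
      fun X R hX hR => (hsplit X R hX hR).trans ?_⟩
    have hX0 : 0 < X := by linarith
    have hR0 : 0 < R := by linarith
    have hv := half_le_log_div hX hR
    have hprof := profile_le_psi hβ' hν hX hR
    have hpsi := psi_pos β ν hR0.le
    set v := Real.log (R / X) / 2 with hvdef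
    have hv0 : 0 < v := by linarith
    have hY : R / X = Real.exp (2 * v) := by
      rw [hvdef, mul_div_cancel₀ _ two_ne_zero, Real.exp_log (by positivity)]
    have htail : ∫⁻ u in Ioi v, ENNReal.ofReal (Real.exp (-(u * β)) * u ^ (-(1 + ν))) ≤
        ENNReal.ofReal (1 / β * ((R / X) ^ (-(β / 2)) * v ^ (-(1 + ν)))) := by
      calc _ ≤ ∫⁻ u in Ioi v, ENNReal.ofReal (v ^ (-(1 + ν))) *
            ENNReal.ofReal (Real.exp (-(u * β))) := by
            refine setLIntegral_mono' measurableSet_Ioi fun u hu => ?_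
            rw [← ENNReal.ofReal_mul (by positivity)]
            refine ENNReal.ofReal_le_ofReal ?_
            rw [mul_comm]
            exact mul_le_mul_of_nonneg_right
              (Real.rpow_le_rpow_of_nonpos hv0 (le_of_lt hu) (by linarith)) (Real.exp_pos _).le
        _ = _ := by
            rw [lintegral_const_mul' _ _ ENNReal.ofReal_ne_top, lintegral_Ioi_exp_neg_mul hβ',
              ← ENNReal.ofReal_mul (by positivity), hY, ← Real.exp_mul]
            congr 1
            ring_nf
    refine (add_le_add_right htail _).trans ?_
    rw [← ENNReal.ofReal_add (by positivity) (by positivity)]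
    refine ENNReal.ofReal_le_ofReal ?_
    calc _ = (1 + 1 / β) * ((R / X) ^ (-(β / 2)) * v ^ (-(1 + ν))) := by ring
      _ ≤ (1 + 1 / β) * (2 ^ (β / 2) * 6 ^ (1 + ν) * X ^ (β / 2 + 1 + ν) * psi β ν R) := by gcongr
      _ = _ := by ring

end Psi

/-! ### The far region in terms of φ, and the kernel at a fixed time. -/

section Far

variable {d : ℕ}

/-- The far part of the subordinated kernel is controlled by `φ`. -/
theorem exists_lintegral_mehler_far_le {m ν : ℝ} (hm : -(d : ℝ) ≤ m) (hν : 0 < ν) :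
    ∃ C : ℝ, 0 ≤ C ∧ ∀ x y : E d, 3 * max ‖x‖ 1 ≤ ‖y‖ →
      ∫⁻ u in Ioi (0 : ℝ), ENNReal.ofReal (mehler d m u x y / u ^ (1 + ν)) ≤
        ENNReal.ofReal (C * max ‖x‖ 1 ^ (((d : ℝ) + m) / 2 + 1 + ν) * Real.exp (‖x‖ ^ 2 / 2)) *
          ENNReal.ofReal (phi d m ν y) := by
  have hβ : 0 ≤ (d : ℝ) + m := by linarith
  obtain ⟨C₁, hC₁, h₁⟩ := exists_small_time_le d hβ hν
  obtain ⟨C₂, hC₂, h₂⟩ := exists_mehler_far_le_of_ge d m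
    (K := farOrder (d + m) ν) (by unfold farOrder; positivity)
  obtain ⟨C₃, hC₃, h₃⟩ := exists_large_time_le hβ hν
  refine ⟨C₁ + C₂ * C₃, by positivity, fun x y hxy => ?_⟩
  set X := max ‖x‖ 1
  have hX1 : 1 ≤ X := le_max_right _ _
  have hy3 : 3 ≤ ‖y‖ := by linarith
  set G := Real.exp ((‖x‖ ^ 2 - ‖y‖ ^ 2) / 2)
  set κ := ((d : ℝ) + m) / 2 + 1 + ν
  have hpsi := psi_pos (d + m) ν (norm_nonneg y)
  have hXκ : 1 ≤ X ^ κ := Real.one_le_rpow hX1 (by positivity)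
  have hphi : Real.exp (‖x‖ ^ 2 / 2) * phi d m ν y = G * psi (d + m) ν ‖y‖ := by
    rw [phi_eq, ← mul_assoc, ← Real.exp_add,
      show ‖x‖ ^ 2 / 2 + -(‖y‖ ^ 2 / 2) = (‖x‖ ^ 2 - ‖y‖ ^ 2) / 2 by ring]
  rw [← ENNReal.ofReal_mul (by positivity), mul_assoc _ (Real.exp _), hphi,
    ← Ioc_union_Ioi_eq_Ioi (show (0 : ℝ) ≤ 1 / 4 by norm_num)]
  have hsmall : ∫⁻ u in Ioc (0 : ℝ) (1 / 4), ENNReal.ofReal (mehler d m u x y / u ^ (1 + ν)) ≤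
      ENNReal.ofReal (C₁ * X ^ κ * (G * psi (d + m) ν ‖y‖)) := by
    calc _ ≤ ∫⁻ u in Ioc (0 : ℝ) (1 / 4), ENNReal.ofReal (C₁ * X ^ κ * (G * psi (d + m) ν ‖y‖)) := by
          refine setLIntegral_mono' measurableSet_Ioc fun u hu => ENNReal.ofReal_le_ofReal ?_
          have hu0 := hu.1
          calc mehler d m u x y / u ^ (1 + ν)
              ≤ G * (Real.exp d * u ^ (-((d : ℝ) / 2)) * Real.exp (-(‖y‖ ^ 2 / (36 * u)))) /
                u ^ (1 + ν) := by
                gcongr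
                exact mehler_far_le_of_le hm hu.1 hu.2 hxy
            _ = G * (Real.exp d * u ^ (-((d : ℝ) / 2)) * Real.exp (-(‖y‖ ^ 2 / (36 * u))) /
                u ^ (1 + ν)) := by ring
            _ ≤ G * (C₁ * psi (d + m) ν ‖y‖) := by
                gcongr
                exact h₁ _ hy3 u hu.1 hu.2
            _ = C₁ * 1 * (G * psi (d + m) ν ‖y‖) := by ring
            _ ≤ _ := by gcongr
      _ ≤ _ := by
          rw [setLIntegral_const, Real.volume_Ioc]
          refine mul_le_of_le_one_right zero_le ?_
          rw [ENNReal.ofReal_le_one]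
          norm_num
  have hlarge : ∫⁻ u in Ioi (1 / 4 : ℝ), ENNReal.ofReal (mehler d m u x y / u ^ (1 + ν)) ≤
      ENNReal.ofReal (C₂ * C₃ * X ^ κ * (G * psi (d + m) ν ‖y‖)) := by
    calc _ ≤ ∫⁻ u in Ioi (1 / 4 : ℝ), ENNReal.ofReal (G * C₂) * ENNReal.ofReal
            (Real.exp (-(u * (d + m))) * min 1 ((X * Real.exp (2 * u) / ‖y‖) ^ farOrder (d + m) ν) /
              u ^ (1 + ν)) := by
          refine setLIntegral_mono' measurableSet_Ioi fun u hu => ?_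
          have hu : 1 / 4 < u := hu
          have hu0 : 0 < u := by linarith
          rw [← ENNReal.ofReal_mul (by positivity)]
          refine ENNReal.ofReal_le_ofReal ?_
          rw [← mul_div_assoc]
          gcongr
          refine (h₂ u hu.le x y hxy).trans (le_of_eq ?_)
          ring
      _ ≤ ENNReal.ofReal (G * C₂) * ENNReal.ofReal (C₃ * X ^ κ * psi (d + m) ν ‖y‖) := by
          rw [lintegral_const_mul' _ _ ENNReal.ofReal_ne_top]
          gcongr
          exact h₃ X ‖y‖ hX1 hxy
      _ = _ := by
          rw [← ENNReal.ofReal_mul (by positivity)]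
          ring_nf
  refine (lintegral_union_le _ _ _).trans ((add_le_add hsmall hlarge).trans (le_of_eq ?_))
  rw [← ENNReal.ofReal_add (by positivity) (by positivity)]
  ring_nf

/-- At a fixed time tanh u < 1 leaves an extra factor e^{-c|y|²}, which beats the slow decay of ψ.
The constant depends on u and x; the bound serves convergence of the heat integral at every single
u. -/
theorem exists_mehler_le_phi {m ν : ℝ} (hm : -(d : ℝ) ≤ m) (hν : 0 < ν) {u : ℝ} (hu : 0 < u)
    (x : E d) : ∃ C : ℝ, 0 ≤ C ∧ ∀ y, mehler d m u x y ≤ C * phi d m ν y := by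
  have hβ : 0 ≤ (d : ℝ) + m := by linarith
  set s := Real.tanh u with hs'
  have hs : 0 < s := tanh_pos hu
  have hs1 : s < 1 := Real.tanh_lt_one u
  have hpref := mehlerPref_pos d m hu
  set k := ((d : ℝ) + m) / 2 + 1 + ν with hk
  obtain ⟨C, hC, h⟩ := exists_rpow_le_mul_exp (show 0 ≤ k by positivity)
  set c := (1 - s) ^ 2 / (8 * s) with hc
  have hc0 : 0 < c := by
    have : 0 < 1 - s := by linarith
    positivity
  set b := (1 + s) ^ 2 * ‖x‖ ^ 2 / (4 * s) with hb
  refine ⟨mehlerPref d m u * Real.exp (‖x‖ ^ 2 / 2) * Real.exp b *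
    (C * Real.exp (Real.exp 1 + 1 / (4 * c))), by positivity, fun y => ?_⟩
  have hQ : c * ‖y‖ ^ 2 - b ≤ ‖(1 + s) • x - (1 - s) • y‖ ^ 2 / (4 * s) := by
    have h1 : ‖(1 - s) • y‖ ≤ ‖(1 + s) • x - (1 - s) • y‖ + ‖(1 + s) • x‖ := by
      calc ‖(1 - s) • y‖ = ‖(1 + s) • x - ((1 + s) • x - (1 - s) • y)‖ := by simp
        _ ≤ _ := (norm_sub_le _ _).trans_eq (add_comm _ _)
    rw [norm_smul, norm_smul, Real.norm_eq_abs, Real.norm_eq_abs, abs_of_pos (by linarith),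
      abs_of_pos (by linarith)] at h1
    set Q := ‖(1 + s) • x - (1 - s) • y‖
    have h2 : ((1 - s) * ‖y‖) ^ 2 ≤ (Q + (1 + s) * ‖x‖) ^ 2 :=
      pow_le_pow_left₀ (mul_nonneg (by linarith) (norm_nonneg _)) h1 2
    have h3 : ((1 - s) * ‖y‖) ^ 2 ≤ 2 * Q ^ 2 + 2 * ((1 + s) * ‖x‖) ^ 2 := by
      nlinarith [sq_nonneg (Q - (1 + s) * ‖x‖)]
    rw [hc, hb, sub_le_iff_le_add, ← add_div, le_div_iff₀ (by positivity)]
    have : (1 - s) ^ 2 / (8 * s) * ‖y‖ ^ 2 * (4 * s) = ((1 - s) * ‖y‖) ^ 2 / 2 := by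
      field_simp
      ring
    rw [this]
    linarith
  have hpsi : Real.exp (-(c * ‖y‖ ^ 2)) ≤
      C * Real.exp (Real.exp 1 + 1 / (4 * c)) * psi (d + m) ν ‖y‖ := by
    have hz : 0 < Real.exp 1 + ‖y‖ := by positivity
    have h1 := h _ hz.le
    have h2 := rpow_le_psi hβ hν (norm_nonneg y)
    rw [← hk, Real.rpow_neg hz.le, inv_le_iff_one_le_mul₀ (by positivity)] at h2
    have hpos := psi_pos (d + m) ν (norm_nonneg y)
    have h3 : ‖y‖ ≤ c * ‖y‖ ^ 2 + 1 / (4 * c) := by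
      have : c * ‖y‖ ^ 2 + 1 / (4 * c) - ‖y‖ = (2 * c * ‖y‖ - 1) ^ 2 / (4 * c) := by
        field_simp
        ring
      have : 0 ≤ (2 * c * ‖y‖ - 1) ^ 2 / (4 * c) := by positivity
      linarith
    calc Real.exp (-(c * ‖y‖ ^ 2))
        ≤ Real.exp (-(c * ‖y‖ ^ 2)) * (psi (d + m) ν ‖y‖ * (Real.exp 1 + ‖y‖) ^ k) :=
          le_mul_of_one_le_right (Real.exp_pos _).le h2
      _ ≤ Real.exp (-(c * ‖y‖ ^ 2)) * (psi (d + m) ν ‖y‖ *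
          (C * Real.exp (Real.exp 1 + ‖y‖))) := by gcongr
      _ = C * Real.exp (-(c * ‖y‖ ^ 2) + (Real.exp 1 + ‖y‖)) * psi (d + m) ν ‖y‖ := by
          rw [Real.exp_add (-(c * ‖y‖ ^ 2))]; ring
      _ ≤ _ := by
          gcongr ?_ * ?_
          exact mul_le_mul_of_nonneg_left (Real.exp_le_exp.2 (by linarith)) hC.le
  rw [mehler_eq m hu, phi_eq, ← hs']
  calc mehlerPref d m u * (Real.exp ((‖x‖ ^ 2 - ‖y‖ ^ 2) / 2) *
        Real.exp (-(‖(1 + s) • x - (1 - s) • y‖ ^ 2 / (4 * s))))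
      ≤ mehlerPref d m u * (Real.exp ((‖x‖ ^ 2 - ‖y‖ ^ 2) / 2) *
        Real.exp (b + -(c * ‖y‖ ^ 2))) := by
        gcongr
        linarith
    _ = mehlerPref d m u * Real.exp (‖x‖ ^ 2 / 2) * Real.exp b *
        (Real.exp (-(‖y‖ ^ 2 / 2)) * Real.exp (-(c * ‖y‖ ^ 2))) := by
        rw [show (‖x‖ ^ 2 - ‖y‖ ^ 2) / 2 = ‖x‖ ^ 2 / 2 + -(‖y‖ ^ 2 / 2) by ring, Real.exp_add,
          Real.exp_add]
        ring
    _ ≤ mehlerPref d m u * Real.exp (‖x‖ ^ 2 / 2) * Real.exp b *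
        (Real.exp (-(‖y‖ ^ 2 / 2)) * (C * Real.exp (Real.exp 1 + 1 / (4 * c)) *
          psi (d + m) ν ‖y‖)) := by gcongr
    _ = _ := by ring

end Far

/-! ### The subordination weight. -/

section Subordination

/-- Inverting u turns it into a Gamma integral. The value is the reciprocal of the constant in P_t,
so a bound on the heat integrals uniform in u passes to P_t with the same constant. -/
theorem integral_subord {ν t : ℝ} (hν : 0 < ν) (ht : 0 < t) :
    ∫ u in Ioi (0 : ℝ), subord ν t u = (4 : ℝ) ^ ν * Real.Gamma ν / t ^ (2 * ν) := by
  have h1 := integral_comp_rpow_Ioi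
    (fun v : ℝ => v ^ (ν - 1) * Real.exp (-(t ^ 2 / 4 * v))) (p := -1) (by norm_num)
  rw [Real.integral_rpow_mul_exp_neg_mul_Ioi hν (by positivity)] at h1
  have h2 : (1 / (t ^ 2 / 4)) ^ ν * Real.Gamma ν = (4 : ℝ) ^ ν * Real.Gamma ν / t ^ (2 * ν) := by
    rw [one_div_div, Real.div_rpow (by norm_num) (by positivity), Real.rpow_mul ht.le]
    norm_cast
    ring
  rw [← h2, ← h1]
  refine setIntegral_congr_fun measurableSet_Ioi fun u hu => ?_
  have hu : 0 < u := hu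
  simp only [subord, smul_eq_mul, abs_neg, abs_one, one_mul]
  rw [← Real.rpow_mul hu.le, Real.rpow_neg_one, ← mul_assoc, ← Real.rpow_add hu,
    show (-1 : ℝ) - 1 + -1 * (ν - 1) = -(1 + ν) by ring, Real.rpow_neg hu.le, div_eq_mul_inv,
    mul_comm (Real.exp _)]
  congr 2
  field_simp

theorem integrableOn_subord {ν t : ℝ} (hν : 0 < ν) (ht : 0 < t) :
    IntegrableOn (subord ν t) (Ioi 0) := by
  refine Integrable.of_integral_ne_zero ?_
  rw [integral_subord hν ht]
  have := Real.Gamma_pos_of_pos hν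
  positivity

theorem subord_nonneg (ν t : ℝ) {u : ℝ} (hu : 0 < u) : 0 ≤ subord ν t u := by
  unfold subord
  positivity

theorem subord_le (ν t : ℝ) {u : ℝ} (hu : 0 < u) : subord ν t u ≤ 1 / u ^ (1 + ν) := by
  unfold subord
  gcongr
  rw [Real.exp_le_one_iff, neg_nonpos]
  positivity

theorem measurable_subord (ν t : ℝ) : Measurable (subord ν t) := by
  unfold subord
  fun_prop

theorem lintegral_subord {ν t : ℝ} (hν : 0 < ν) (ht : 0 < t) :
    ∫⁻ u in Ioi (0 : ℝ), ENNReal.ofReal (subord ν t u) =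
      ENNReal.ofReal ((4 : ℝ) ^ ν * Real.Gamma ν / t ^ (2 * ν)) := by
  rw [← integral_subord hν ht, ofReal_integral_eq_lintegral_ofReal (integrableOn_subord hν ht)]
  filter_upwards [ae_restrict_mem measurableSet_Ioi] with u hu
  exact subord_nonneg ν t hu

variable {d : ℕ}

/-- The singularity u^{-d/2} only shifts ν to ν + d/2 in the subordination weight, which is
integrable for every positive index. -/
theorem lintegral_subord_mul_mehlerPref_lt_top {m ν t : ℝ} (hm : -(d : ℝ) ≤ m) (hν : 0 < ν)
    (ht : 0 < t) :
    ∫⁻ u in Ioi (0 : ℝ), ENNReal.ofReal (subord ν t u * mehlerPref d m u) < ∞ := by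
  have h : IntegrableOn (fun u => Real.exp d * subord (ν + d / 2) t u + subord ν t u) (Ioi 0) :=
    ((integrableOn_subord (by positivity) ht).const_mul _).add (integrableOn_subord hν ht)
  refine lt_of_le_of_lt (setLIntegral_mono' measurableSet_Ioi fun u hu => ?_) h.lintegral_lt_top
  have hu : 0 < u := hu
  refine ENNReal.ofReal_le_ofReal ?_
  have hs := subord_nonneg ν t hu
  have e : subord (ν + d / 2) t u = subord ν t u * u ^ (-((d : ℝ) / 2)) := by
    unfold subord
    rw [← add_assoc, Real.rpow_add hu, Real.rpow_neg hu.le]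
    field_simp
  calc subord ν t u * mehlerPref d m u
      ≤ subord ν t u * (Real.exp d * u ^ (-((d : ℝ) / 2)) + 1) := by
        gcongr
        exact mehlerPref_le hm hu
    _ = _ := by rw [e]; ring

theorem measurable_mehler (d : ℕ) (m : ℝ) :
    Measurable fun z : ℝ × E d × E d => mehler d m z.1 z.2.1 z.2.2 := by
  unfold mehler
  simp_rw [Real.tanh_eq_sinh_div_cosh]
  fun_prop

theorem measurable_mehler_left (d : ℕ) (m : ℝ) (x : E d) :
    Measurable fun z : ℝ × E d => mehler d m z.1 x z.2 :=
  (measurable_mehler d m).comp (measurable_fst.prodMk (measurable_const.prodMk measurable_snd))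

end Subordination

/-! ### Absolute convergence, pointwise domination and measurability of the Poisson maximal
function. -/

section Convergence

variable {d : ℕ} {m ν : ℝ}

theorem enorm_ofReal_mul {r : ℝ} (hr : 0 ≤ r) (z : ℂ) :
    ‖(r : ℂ) * z‖ₑ = ENNReal.ofReal r * ‖z‖ₑ := by
  rw [enorm_mul, ← ofReal_norm (r : ℂ), Complex.norm_real, Real.norm_of_nonneg hr]

/-- The integral `∫ |f| φ`. -/
def phiNorm (d : ℕ) (m ν : ℝ) (f : E d → ℂ) : ℝ≥0∞ :=
  ∫⁻ y, ‖f y‖ₑ * ENNReal.ofReal (phi d m ν y)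

theorem exists_le_phi_of_norm_le (hm : -(d : ℝ) ≤ m) (hν : 0 < ν) {R : ℝ} (hR : 0 ≤ R) :
    ∃ c : ℝ, 0 < c ∧ ∀ y : E d, ‖y‖ ≤ R → c ≤ phi d m ν y := by
  refine ⟨Real.exp (-(R ^ 2 / 2)) * (Real.exp 1 + R) ^ (-(((d : ℝ) + m) / 2 + 1 + ν)),
    by positivity, fun y hy => ?_⟩
  rw [phi_eq]
  have hβ : 0 ≤ (d : ℝ) + m := by linarith
  refine mul_le_mul (Real.exp_le_exp.2 (by gcongr)) ?_ (by positivity) (by positivity)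
  refine le_trans ?_ (rpow_le_psi hβ hν (norm_nonneg y))
  exact Real.rpow_le_rpow_of_nonpos (by positivity) (by gcongr) (by linarith)

theorem setLIntegral_enorm_lt_top (hm : -(d : ℝ) ≤ m) (hν : 0 < ν) {f : E d → ℂ}
    (hf : phiNorm d m ν f < ∞) {R : ℝ} (hR : 0 ≤ R) :
    ∫⁻ y in {y : E d | ‖y‖ ≤ R}, ‖f y‖ₑ < ∞ := by
  obtain ⟨c, hc, h⟩ := exists_le_phi_of_norm_le (d := d) hm hν hR
  have hle : ∫⁻ y in {y : E d | ‖y‖ ≤ R}, ‖f y‖ₑ ≤ (ENNReal.ofReal c)⁻¹ * phiNorm d m ν f := by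
    rw [phiNorm, ← lintegral_const_mul' _ _ (ENNReal.inv_ne_top.2 (by simpa using hc))]
    refine (setLIntegral_mono' (measurableSet_norm_le R) fun y hy => ?_).trans
      (setLIntegral_le_lintegral _ _)
    calc ‖f y‖ₑ = (ENNReal.ofReal c)⁻¹ * (‖f y‖ₑ * ENNReal.ofReal c) := by
          rw [mul_left_comm, ENNReal.inv_mul_cancel (by simpa using hc) ENNReal.ofReal_ne_top,
            mul_one]
      _ ≤ _ := by
          gcongr
          exact h y hy
  exact hle.trans_lt (ENNReal.mul_lt_top (ENNReal.inv_lt_top.2 (by simpa using hc)) hf)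

/-- The contribution of the far region to the subordinated semigroup. -/
theorem exists_lintegral_far_le (hm : -(d : ℝ) ≤ m) (hν : 0 < ν) :
    ∃ C : ℝ, 0 ≤ C ∧ ∀ (t : ℝ) (f : E d → ℂ), AEStronglyMeasurable f → ∀ x : E d,
      ∫⁻ u in Ioi (0 : ℝ), ENNReal.ofReal (subord ν t u) *
        ∫⁻ y in {y : E d | ‖y‖ ≤ 3 * max ‖x‖ 1}ᶜ, ENNReal.ofReal (mehler d m u x y) * ‖f y‖ₑ ≤
      ENNReal.ofReal (C * max ‖x‖ 1 ^ (((d : ℝ) + m) / 2 + 1 + ν) * Real.exp (‖x‖ ^ 2 / 2)) *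
        phiNorm d m ν f := by
  obtain ⟨C, hC, h⟩ := exists_lintegral_mehler_far_le (d := d) hm hν
  refine ⟨C, hC, fun t f hf x => ?_⟩
  set D := {y : E d | ‖y‖ ≤ 3 * max ‖x‖ 1}
  have hD : MeasurableSet D := measurableSet_norm_le _
  calc _ ≤ ∫⁻ u in Ioi (0 : ℝ), ∫⁻ y in Dᶜ,
        ENNReal.ofReal (mehler d m u x y / u ^ (1 + ν)) * ‖f y‖ₑ := by
        refine setLIntegral_mono' measurableSet_Ioi fun u hu => ?_
        have hu : 0 < u := hu
        rw [← lintegral_const_mul' _ _ ENNReal.ofReal_ne_top]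
        refine lintegral_mono fun y => ?_
        rw [← mul_assoc, ← ENNReal.ofReal_mul (subord_nonneg ν t hu)]
        gcongr
        have := mul_le_mul_of_nonneg_right (subord_le ν t hu) (mehler_nonneg m hu x y)
        rwa [one_div_mul_eq_div] at this
    _ = ∫⁻ y in Dᶜ, ∫⁻ u in Ioi (0 : ℝ),
        ENNReal.ofReal (mehler d m u x y / u ^ (1 + ν)) * ‖f y‖ₑ := by
        have h1 : AEMeasurable
            (fun z : ℝ × E d => ENNReal.ofReal (mehler d m z.1 x z.2 / z.1 ^ (1 + ν)) * ‖f z.2‖ₑ)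
            ((volume.restrict (Ioi 0)).prod (volume.restrict Dᶜ)) :=
          ((measurable_mehler_left d m x).div
            (measurable_fst.pow_const _)).ennreal_ofReal.aemeasurable.mul
            (AEStronglyMeasurable.comp_snd hf.restrict).enorm
        exact lintegral_lintegral_swap h1
    _ ≤ ∫⁻ y in Dᶜ, ENNReal.ofReal
          (C * max ‖x‖ 1 ^ (((d : ℝ) + m) / 2 + 1 + ν) * Real.exp (‖x‖ ^ 2 / 2)) *
        (‖f y‖ₑ * ENNReal.ofReal (phi d m ν y)) := by
        refine setLIntegral_mono' hD.compl fun y hy => ?_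
        have hy : 3 * max ‖x‖ 1 < ‖y‖ := not_le.1 hy
        have h1 : Measurable fun u : ℝ => mehler d m u x y :=
          (measurable_mehler_left d m x).comp (measurable_id.prodMk measurable_const)
        have h2 : Measurable fun u : ℝ => ENNReal.ofReal (mehler d m u x y / u ^ (1 + ν)) :=
          (h1.div (measurable_id.pow_const _)).ennreal_ofReal
        rw [lintegral_mul_const _ h2]
        refine (mul_le_mul_left (h x y hy.le) _).trans (le_of_eq ?_)
        ring
    _ ≤ _ := by
        rw [lintegral_const_mul' _ _ ENNReal.ofReal_ne_top]
        gcongr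
        exact setLIntegral_le_lintegral _ _

/-- Convergence is claimed at every x, whereas the maximal function may be infinite on a null set.
So the near part uses the cruder bound by ∫|f| over a ball, finite because φ is bounded below there;
its constant may depend on t and x. -/
theorem lintegral_subord_heat_lt_top (hm : -(d : ℝ) ≤ m) (hν : 0 < ν) {t : ℝ} (ht : 0 < t)
    {f : E d → ℂ} (hf : AEStronglyMeasurable f) (hfφ : phiNorm d m ν f < ∞) (x : E d) :
    ∫⁻ u in Ioi (0 : ℝ), ENNReal.ofReal (subord ν t u) *
      ∫⁻ y, ENNReal.ofReal (mehler d m u x y) * ‖f y‖ₑ < ∞ := by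
  obtain ⟨C, -, hfar⟩ := exists_lintegral_far_le (d := d) hm hν
  set D := {y : E d | ‖y‖ ≤ 3 * max ‖x‖ 1} with hDdef
  have hD : MeasurableSet D := measurableSet_norm_le _
  have hnear : ∫⁻ u in Ioi (0 : ℝ), ENNReal.ofReal (subord ν t u) *
      ∫⁻ y in D, ENNReal.ofReal (mehler d m u x y) * ‖f y‖ₑ < ∞ := by
    calc _ ≤ ∫⁻ u in Ioi (0 : ℝ), ENNReal.ofReal (subord ν t u * mehlerPref d m u) *
          (ENNReal.ofReal (Real.exp (‖x‖ ^ 2 / 2)) * ∫⁻ y in D, ‖f y‖ₑ) := by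
          refine setLIntegral_mono' measurableSet_Ioi fun u hu => ?_
          have hu : 0 < u := hu
          have hp := mehlerPref_pos d m hu
          rw [ENNReal.ofReal_mul (subord_nonneg ν t hu), mul_assoc]
          gcongr
          rw [← mul_assoc, ← ENNReal.ofReal_mul hp.le,
            ← lintegral_const_mul' _ _ ENNReal.ofReal_ne_top]
          gcongr with y
          refine (mehler_le_pref m hu x y).trans ?_
          gcongr
          linarith [sq_nonneg ‖y‖]
      _ = (∫⁻ u in Ioi (0 : ℝ), ENNReal.ofReal (subord ν t u * mehlerPref d m u)) *
          (ENNReal.ofReal (Real.exp (‖x‖ ^ 2 / 2)) * ∫⁻ y in D, ‖f y‖ₑ) := by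
          refine lintegral_mul_const _ ?_
          have := measurable_subord ν t
          unfold mehlerPref
          fun_prop
      _ < ∞ := ENNReal.mul_lt_top (lintegral_subord_mul_mehlerPref_lt_top hm hν ht)
          (ENNReal.mul_lt_top ENNReal.ofReal_lt_top
            (setLIntegral_enorm_lt_top hm hν hfφ (by positivity)))
  have hsum : ∀ u : ℝ, ENNReal.ofReal (subord ν t u) *
      ∫⁻ y, ENNReal.ofReal (mehler d m u x y) * ‖f y‖ₑ =
      ENNReal.ofReal (subord ν t u) *
        (∫⁻ y in D, ENNReal.ofReal (mehler d m u x y) * ‖f y‖ₑ) +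
      ENNReal.ofReal (subord ν t u) *
        ∫⁻ y in Dᶜ, ENNReal.ofReal (mehler d m u x y) * ‖f y‖ₑ := fun u => by
    rw [← lintegral_add_compl _ hD, mul_add]
  simp_rw [hsum]
  rw [lintegral_add_left']
  · exact ENNReal.add_lt_top.2 ⟨hnear,
      (hfar t f hf x).trans_lt (ENNReal.mul_lt_top ENNReal.ofReal_lt_top hfφ)⟩
  · refine AEMeasurable.mul (measurable_subord ν t).ennreal_ofReal.aemeasurable ?_
    refine AEMeasurable.lintegral_prod_right' (f := fun z : ℝ × E d =>
      ENNReal.ofReal (mehler d m z.1 x z.2) * ‖f z.2‖ₑ) ?_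
    exact (measurable_mehler_left d m x).ennreal_ofReal.aemeasurable.mul
      (AEStronglyMeasurable.comp_snd hf.restrict).enorm

theorem poissonConverges (hm : -(d : ℝ) ≤ m) (hν : 0 < ν) {t : ℝ} (ht : 0 < t)
    {f : E d → ℂ} (hf : AEStronglyMeasurable f) (hfφ : phiNorm d m ν f < ∞) (x : E d) :
    PoissonConverges d m ν t f x := by
  have hmeh : Measurable fun z : ℝ × E d => (mehler d m z.1 x z.2 : ℂ) :=
    Complex.measurable_ofReal.comp (measurable_mehler_left d m x)
  refine ⟨fun u hu => ⟨?_, ?_⟩, ?_, ?_⟩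
  · exact (hmeh.comp (f := fun y : E d => (u, y)) (by fun_prop)).aestronglyMeasurable.mul hf
  · obtain ⟨C, hC, h⟩ := exists_mehler_le_phi (d := d) hm hν hu x
    rw [hasFiniteIntegral_iff_enorm]
    calc ∫⁻ y, ‖(mehler d m u x y : ℂ) * f y‖ₑ
        ≤ ∫⁻ y, ENNReal.ofReal C * (‖f y‖ₑ * ENNReal.ofReal (phi d m ν y)) := by
          refine lintegral_mono fun y => ?_
          rw [enorm_ofReal_mul (mehler_nonneg m hu x y), mul_left_comm, ← ENNReal.ofReal_mul hC,
            mul_comm]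
          gcongr
          exact h y
      _ = ENNReal.ofReal C * phiNorm d m ν f := lintegral_const_mul' _ _ ENNReal.ofReal_ne_top
      _ < ∞ := ENNReal.mul_lt_top ENNReal.ofReal_lt_top hfφ
  · exact ((Complex.measurable_ofReal.comp
      ((measurable_subord ν t).comp measurable_fst)).aestronglyMeasurable).mul
      (hmeh.aestronglyMeasurable.mul (AEStronglyMeasurable.comp_snd hf))
  · rw [hasFiniteIntegral_iff_enorm, lintegral_prod _ (by
      refine AEStronglyMeasurable.enorm ?_
      exact ((Complex.measurable_ofReal.comp
        ((measurable_subord ν t).comp measurable_fst)).aestronglyMeasurable).mul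
        (hmeh.aestronglyMeasurable.mul (AEStronglyMeasurable.comp_snd hf)))]
    refine lt_of_le_of_lt (setLIntegral_mono' measurableSet_Ioi fun u hu => ?_)
      (lintegral_subord_heat_lt_top hm hν ht hf hfφ x)
    have hu : 0 < u := hu
    rw [← lintegral_const_mul' _ _ ENNReal.ofReal_ne_top]
    refine lintegral_mono fun y => le_of_eq ?_
    rw [enorm_ofReal_mul (subord_nonneg ν t hu), enorm_ofReal_mul (mehler_nonneg m hu x y)]

/-- The weighted function `|f| e^{-|y|²/2}`. -/
def gaussAbs (f : E d → ℂ) (y : E d) : ℝ≥0∞ :=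
  ‖f y‖ₑ * ENNReal.ofReal (Real.exp (-(‖y‖ ^ 2 / 2)))

theorem exp_mul_gaussAbs (f : E d → ℂ) (y : E d) :
    ENNReal.ofReal (Real.exp (‖y‖ ^ 2 / 2)) * gaussAbs f y = ‖f y‖ₑ := by
  rw [gaussAbs, mul_left_comm, ← ENNReal.ofReal_mul (Real.exp_pos _).le, ← Real.exp_add]
  simp

theorem aemeasurable_gaussAbs {f : E d → ℂ} (hf : AEStronglyMeasurable f) :
    AEMeasurable (gaussAbs f) :=
  hf.enorm.mul (by fun_prop)

theorem enorm_heat_le {u : ℝ} (hu : 0 < u) (f : E d → ℂ) (x : E d) :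
    ‖heat d m u f x‖ₑ ≤ ∫⁻ y, ENNReal.ofReal (mehler d m u x y) * ‖f y‖ₑ :=
  (enorm_integral_le_lintegral_enorm _).trans
    (lintegral_mono fun y => (enorm_ofReal_mul (mehler_nonneg m hu x y) _).le)

theorem enorm_poisson_le (t : ℝ) (f : E d → ℂ) (x : E d) :
    ‖poisson d m ν t f x‖ₑ ≤
      ‖t ^ (2 * ν) / ((4 : ℝ) ^ ν * Real.Gamma ν)‖ₑ * ∫⁻ u in Ioi (0 : ℝ),
        ENNReal.ofReal (subord ν t u) *
          ∫⁻ y, ENNReal.ofReal (mehler d m u x y) * ‖f y‖ₑ := by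
  rw [poisson, enorm_mul, ← ofReal_norm, Complex.norm_real, ofReal_norm]
  gcongr
  refine (enorm_integral_le_lintegral_enorm _).trans
    (setLIntegral_mono' measurableSet_Ioi fun u hu => ?_)
  have hu : 0 < u := hu
  rw [enorm_ofReal_mul (subord_nonneg ν t hu)]
  gcongr
  exact enorm_heat_le hu f x

/-- The pointwise bound for the local maximal Poisson operator by the local Hardy–Littlewood maximal
operator plus a rank-one term. -/
theorem exists_poissonMax_le (hm : -(d : ℝ) ≤ m) (hν : 0 < ν) {a : ℝ} (ha : 0 < a) :
    ∃ C : ℝ, 0 ≤ C ∧ ∀ f : E d → ℂ, AEStronglyMeasurable f → ∀ x : E d,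
      poissonMax d m ν a f x ≤
        ENNReal.ofReal (C * max ‖x‖ 1 ^ (2 * d) * Real.exp (‖x‖ ^ 2 / 2)) *
          locMax (gaussAbs f) x +
        ENNReal.ofReal (C * max ‖x‖ 1 ^ (((d : ℝ) + m) / 2 + 1 + ν) * Real.exp (‖x‖ ^ 2 / 2)) *
          phiNorm d m ν f := by
  obtain ⟨C₁, hC₁, hfar⟩ := exists_lintegral_far_le (d := d) hm hν
  obtain ⟨C₂, hC₂, hnear⟩ := exists_heat_local_le (d := d) hm
  have hΓ := Real.Gamma_pos_of_pos hν
  set B : ℝ := a ^ (2 * ν) / ((4 : ℝ) ^ ν * Real.Gamma ν) with hB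
  have hB0 : 0 ≤ B := by positivity
  refine ⟨C₂ + B * C₁, by positivity, fun f hf x => iSup₂_le fun t ht => ?_⟩
  have ht0 : 0 < t := ht.1
  set X := max ‖x‖ 1
  have hX1 : 1 ≤ X := le_max_right _ _
  set D := {y : E d | ‖y‖ ≤ 3 * X} with hDdef
  have hD : MeasurableSet D := measurableSet_norm_le _
  set A : ℝ := t ^ (2 * ν) / ((4 : ℝ) ^ ν * Real.Gamma ν) with hA
  have hA0 : 0 < A := by positivity
  have hAB : A ≤ B := by
    rw [hA, hB]
    have := ht.2.le
    gcongr
  refine (enorm_poisson_le t f x).trans ?_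
  rw [← hA, ← ofReal_norm, Real.norm_eq_abs, abs_of_pos hA0]
  have h1 : ∫⁻ u in Ioi (0 : ℝ), ENNReal.ofReal (subord ν t u) *
      ∫⁻ y in D, ENNReal.ofReal (mehler d m u x y) * ‖f y‖ₑ ≤
      ENNReal.ofReal (A⁻¹ * (C₂ * X ^ (2 * d) * Real.exp (‖x‖ ^ 2 / 2))) *
        locMax (gaussAbs f) x := by
    calc _ ≤ ∫⁻ u in Ioi (0 : ℝ), ENNReal.ofReal (subord ν t u) *
          (ENNReal.ofReal (C₂ * X ^ (2 * d) * Real.exp (‖x‖ ^ 2 / 2)) *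
            locMax (gaussAbs f) x) := by
          refine setLIntegral_mono' measurableSet_Ioi fun u hu => ?_
          gcongr
          have := hnear u hu x (gaussAbs f) (aemeasurable_gaussAbs hf)
          simp_rw [exp_mul_gaussAbs] at this
          exact this
      _ = _ := by
          rw [lintegral_mul_const _ (measurable_subord ν t).ennreal_ofReal,
            lintegral_subord hν ht0, ← mul_assoc, ← ENNReal.ofReal_mul (by positivity), hA, inv_div]
  have h2 := hfar t f hf x
  calc ENNReal.ofReal A * ∫⁻ u in Ioi (0 : ℝ), ENNReal.ofReal (subord ν t u) *
        ∫⁻ y, ENNReal.ofReal (mehler d m u x y) * ‖f y‖ₑ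
      = ENNReal.ofReal A * (∫⁻ u in Ioi (0 : ℝ), ENNReal.ofReal (subord ν t u) *
          ∫⁻ y in D, ENNReal.ofReal (mehler d m u x y) * ‖f y‖ₑ) +
        ENNReal.ofReal A * (∫⁻ u in Ioi (0 : ℝ), ENNReal.ofReal (subord ν t u) *
          ∫⁻ y in Dᶜ, ENNReal.ofReal (mehler d m u x y) * ‖f y‖ₑ) := by
        rw [← mul_add, ← lintegral_add_left']
        · congr 1
          refine lintegral_congr fun u => ?_
          rw [← mul_add, lintegral_add_compl _ hD]
        · refine AEMeasurable.mul (measurable_subord ν t).ennreal_ofReal.aemeasurable ?_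
          refine AEMeasurable.lintegral_prod_right' (f := fun z : ℝ × E d =>
            ENNReal.ofReal (mehler d m z.1 x z.2) * ‖f z.2‖ₑ) ?_
          exact (measurable_mehler_left d m x).ennreal_ofReal.aemeasurable.mul
            (AEStronglyMeasurable.comp_snd hf.restrict).enorm
    _ ≤ _ := by
        refine add_le_add ((mul_le_mul_right h1 _).trans ?_) ((mul_le_mul_right h2 _).trans ?_)
        · rw [← mul_assoc, ← ENNReal.ofReal_mul hA0.le, mul_inv_cancel_left₀ hA0.ne']
          gcongr
          exact le_add_of_nonneg_right (by positivity)
        · rw [← mul_assoc, ← ENNReal.ofReal_mul hA0.le]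
          gcongr ENNReal.ofReal ?_ * _
          calc A * (C₁ * X ^ (((d : ℝ) + m) / 2 + 1 + ν) * Real.exp (‖x‖ ^ 2 / 2))
              ≤ B * (C₁ * X ^ (((d : ℝ) + m) / 2 + 1 + ν) * Real.exp (‖x‖ ^ 2 / 2)) := by gcongr
            _ = B * C₁ * X ^ (((d : ℝ) + m) / 2 + 1 + ν) * Real.exp (‖x‖ ^ 2 / 2) := by ring
            _ ≤ _ := by
              gcongr
              linarith

/-- The weight decreases in t, so its value at t/2 dominates it near t. Continuity reduces the
supremum over t to rational t, hence gives measurability of P*_a f. -/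
theorem continuousAt_poisson (hm : -(d : ℝ) ≤ m) (hν : 0 < ν) {t : ℝ} (ht : 0 < t)
    {f : E d → ℂ} (hf : AEStronglyMeasurable f) (hfφ : phiNorm d m ν f < ∞) (x : E d) :
    ContinuousAt (fun t => poisson d m ν t f x) t := by
  have hmeh : Measurable fun z : ℝ × E d => (mehler d m z.1 x z.2 : ℂ) :=
    Complex.measurable_ofReal.comp (measurable_mehler_left d m x)
  have hheat : AEStronglyMeasurable (fun u => heat d m u f x) (volume.restrict (Ioi 0)) := by
    refine AEStronglyMeasurable.integral_prod_right' (f := fun z : ℝ × E d =>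
      (mehler d m z.1 x z.2 : ℂ) * f z.2) ?_
    exact hmeh.aestronglyMeasurable.mul (AEStronglyMeasurable.comp_snd hf)
  have hsub : ∀ s : ℝ, AEStronglyMeasurable (fun u => (subord ν s u : ℂ) * heat d m u f x)
      (volume.restrict (Ioi 0)) := fun s =>
    (Complex.measurable_ofReal.comp (measurable_subord ν s)).aestronglyMeasurable.mul hheat
  have ht2 : 0 < t / 2 := half_pos ht
  unfold poisson
  refine ContinuousAt.mul ?_ ?_
  · refine Complex.continuous_ofReal.continuousAt.comp ?_
    exact (Real.continuousAt_rpow_const t _ (Or.inl ht.ne')).div_const _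
  · refine continuousAt_of_dominated (bound := fun u => ‖(subord ν (t / 2) u : ℂ) * heat d m u f x‖)
      (Filter.Eventually.of_forall hsub) ?_ ?_ ?_
    · filter_upwards [lt_mem_nhds (half_lt_self ht)] with s hs
      filter_upwards [ae_restrict_mem measurableSet_Ioi] with u hu
      have hu : 0 < u := hu
      rw [norm_mul, norm_mul, Complex.norm_real, Complex.norm_real, Real.norm_eq_abs,
        Real.norm_eq_abs, abs_of_nonneg (subord_nonneg ν _ hu),
        abs_of_nonneg (subord_nonneg ν _ hu)]
      unfold subord
      gcongr
    · refine Integrable.norm ⟨hsub _, ?_⟩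
      rw [hasFiniteIntegral_iff_enorm]
      refine lt_of_le_of_lt (setLIntegral_mono' measurableSet_Ioi fun u hu => ?_)
        (lintegral_subord_heat_lt_top hm hν ht2 hf hfφ x)
      have hu : 0 < u := hu
      rw [enorm_ofReal_mul (subord_nonneg ν _ hu)]
      gcongr
      exact enorm_heat_le hu f x
    · refine Filter.Eventually.of_forall fun u => ?_
      unfold subord
      fun_prop

theorem measurable_poisson (t : ℝ) {f : E d → ℂ} (hf : AEStronglyMeasurable f) :
    Measurable (poisson d m ν t f) := by
  have hheat : ∀ u x, heat d m u f x = heat d m u (hf.mk f) x := fun u x =>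
    integral_congr_ae (hf.ae_eq_mk.mono fun y hy => by simp only [hy])
  have hfm := hf.stronglyMeasurable_mk
  have h1 : StronglyMeasurable fun z : (E d × ℝ) × E d =>
      (mehler d m z.1.2 z.1.1 z.2 : ℂ) * hf.mk f z.2 := by
    refine StronglyMeasurable.mul (Measurable.stronglyMeasurable ?_)
      (hfm.comp_measurable measurable_snd)
    exact Complex.measurable_ofReal.comp ((measurable_mehler d m).comp
      (f := fun z : (E d × ℝ) × E d => (z.1.2, z.1.1, z.2)) (by fun_prop))
  have h2 := h1.integral_prod_right' (ν := (volume : Measure (E d)))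
  have h3 : StronglyMeasurable fun z : E d × ℝ =>
      (subord ν t z.2 : ℂ) * heat d m z.2 f z.1 := by
    simp_rw [hheat]
    refine StronglyMeasurable.mul (Measurable.stronglyMeasurable ?_) h2
    exact Complex.measurable_ofReal.comp ((measurable_subord ν t).comp measurable_snd)
  exact ((h3.integral_prod_right' (ν := volume.restrict (Ioi (0 : ℝ)))).const_mul _).measurable

theorem iSup_Ioo_eq_iSup_rat {a : ℝ} {g : ℝ → ℝ≥0∞} (hg : ∀ t ∈ Ioo 0 a, ContinuousAt g t) :
    ⨆ t ∈ Ioo 0 a, g t = ⨆ q : {q : ℚ // (q : ℝ) ∈ Ioo 0 a}, g q := by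
  refine le_antisymm (iSup₂_le fun t ht => le_of_forall_lt fun c hc => ?_)
    (iSup_le fun q => le_iSup₂ (f := fun (t : ℝ) (_ : t ∈ Ioo 0 a) => g t) (q : ℝ) q.2)
  have h := ((hg t ht).eventually (lt_mem_nhds hc)).and (isOpen_Ioo.mem_nhds ht)
  obtain ⟨U, hU, hUo, htU⟩ := mem_nhds_iff.1 h
  obtain ⟨q, hq⟩ := Rat.denseRange_cast.exists_mem_open hUo ⟨t, htU⟩
  exact (hU hq).1.trans_le (le_iSup (fun q : {q : ℚ // (q : ℝ) ∈ Ioo 0 a} => g q) ⟨q, (hU hq).2⟩)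

theorem measurable_poissonMax (hm : -(d : ℝ) ≤ m) (hν : 0 < ν) (a : ℝ)
    {f : E d → ℂ} (hf : AEStronglyMeasurable f) (hfφ : phiNorm d m ν f < ∞) :
    Measurable (poissonMax d m ν a f) := by
  have : poissonMax d m ν a f = fun x =>
      ⨆ q : {q : ℚ // (q : ℝ) ∈ Ioo 0 a}, ‖poisson d m ν (q : ℝ) f x‖ₑ := by
    funext x
    exact iSup_Ioo_eq_iSup_rat (g := fun t => ‖poisson d m ν t f x‖ₑ) fun t ht =>
      (continuousAt_poisson hm hν ht.1 hf hfφ x).enorm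
  rw [this]
  exact Measurable.iSup fun q => (measurable_poisson _ hf).enorm

end Convergence

/-! ### Weighted bounds for the near and far terms, and integrability of powers of the maximal
function. -/

section Weights

variable {d : ℕ}

theorem max_norm_one_le (x : E d) : max ‖x‖ 1 ≤ 1 + ‖x‖ :=
  max_le (by linarith) (by linarith [norm_nonneg x])

/-- The weight built from `S`, with general exponent `θ`. -/
def weightOf (p θ N : ℝ) (S : E d → ℝ≥0∞) (x : E d) : ℝ≥0∞ :=
  locMax S x ^ (-θ) * ENNReal.ofReal (Real.exp (-(p * ‖x‖ ^ 2 / 2)) * (1 + ‖x‖) ^ (-N))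

theorem measurable_weightOf (p θ N : ℝ) {S : E d → ℝ≥0∞} (hS : AEMeasurable S) :
    Measurable (weightOf p θ N S) :=
  ((measurable_locMax hS).pow_const _).mul (by fun_prop)

theorem locMax_ne_zero {S : E d → ℝ≥0∞} (hS : AEMeasurable S) (hS0 : ∀ᵐ y, S y ≠ 0) (x : E d) :
    locMax S x ≠ 0 := by
  obtain ⟨c, hc, h⟩ := exists_le_locMax hS hS0
  refine (lt_of_lt_of_le ?_ (h x)).ne'
  rw [ENNReal.ofReal_pos]
  positivity

/-- The factor e^{-p|x|²/2} of the weight exactly cancels the p-th power of the growth e^{|x|²/2},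
so only polynomials remain. -/
theorem ofReal_mul_rpow_mul_weight_le {C κ p N : ℝ} (hC : 0 ≤ C) (hκ : 0 ≤ κ) (hp : 0 < p)
    (x : E d) :
    ENNReal.ofReal (C * max ‖x‖ 1 ^ κ * Real.exp (‖x‖ ^ 2 / 2)) ^ p *
      ENNReal.ofReal (Real.exp (-(p * ‖x‖ ^ 2 / 2)) * (1 + ‖x‖) ^ (-N)) ≤
    ENNReal.ofReal (C ^ p) * ENNReal.ofReal ((1 + ‖x‖) ^ (κ * p - N)) := by
  have h0 : 0 < 1 + ‖x‖ := by positivity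
  rw [ENNReal.ofReal_rpow_of_nonneg (by positivity) hp.le, ← ENNReal.ofReal_mul (by positivity),
    ← ENNReal.ofReal_mul (by positivity)]
  refine ENNReal.ofReal_le_ofReal ?_
  calc _ ≤ (C * (1 + ‖x‖) ^ κ * Real.exp (‖x‖ ^ 2 / 2)) ^ p *
        (Real.exp (-(p * ‖x‖ ^ 2 / 2)) * (1 + ‖x‖) ^ (-N)) := by
        have := max_norm_one_le x
        gcongr
    _ = C ^ p * ((1 + ‖x‖) ^ (κ * p) * (1 + ‖x‖) ^ (-N)) *
        (Real.exp (‖x‖ ^ 2 / 2 * p) * Real.exp (-(p * ‖x‖ ^ 2 / 2))) := by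
        rw [Real.mul_rpow (by positivity) (by positivity), Real.mul_rpow hC (by positivity),
          ← Real.rpow_mul h0.le, ← Real.exp_mul]
        ring
    _ = _ := by
        rw [← Real.rpow_add h0, ← Real.exp_add, ← sub_eq_add_neg,
          show ‖x‖ ^ 2 / 2 * p + -(p * ‖x‖ ^ 2 / 2) = 0 by ring, Real.exp_zero, mul_one]

/-- The weighted bound for the local term. -/
theorem exists_lintegral_local_le (hd : 1 ≤ d) {p ε θ N C₀ : ℝ} (hp : 1 < p) (hε : 0 < ε)
    (hθ : θ = p - 1 + ε) (hN : 2 * d * p + 2 * d * ε ≤ N) (hC₀ : 0 ≤ C₀) {S : E d → ℝ≥0∞}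
    (hS : AEMeasurable S) (hS0 : ∀ᵐ y, S y ≠ 0 ∧ S y ≠ ∞) (hA : ∀ᵐ x, locMax S x ≠ ∞) :
    ∃ C : ℝ≥0∞, C ≠ ∞ ∧ ∀ F : E d → ℝ≥0∞, AEMeasurable F →
      ∫⁻ x, (ENNReal.ofReal (C₀ * max ‖x‖ 1 ^ (2 * d) * Real.exp (‖x‖ ^ 2 / 2)) *
        locMax F x) ^ p * weightOf p θ N S x ≤ C * ∫⁻ y, F y ^ p * S y ^ (1 - p) := by
  obtain ⟨C₁, hC₁, h₁⟩ := lintegral_locMax_div_rpow_le hd hp hε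
  have hS0' : ∀ᵐ y, S y ≠ 0 := hS0.mono fun _ h => h.1
  obtain ⟨c, hc, hlow⟩ := exists_le_locMax hS hS0'
  have hA0 := locMax_ne_zero hS hS0'
  set b : ℝ := min 1 c ^ (2 * ε) with hb
  have hmin : 0 < min 1 c := lt_min one_pos hc
  have hb0 : 0 < b := by positivity
  have hb1 : b ≤ 1 := Real.rpow_le_one hmin.le (min_le_left _ _) (by positivity)
  -- The last factor is at most 1 and, by the polynomial lower bound on A = M^loc S, at most A^{2ε}.
  -- Hence W lies below both A^{1-ε} and A^{1+ε}.
  set W : E d → ℝ≥0∞ := fun x => locMax S x * locMax S x ^ (-ε) *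
    ENNReal.ofReal (b * (1 + ‖x‖) ^ (-(2 * d * ε))) with hW
  have hAm := measurable_locMax hS
  have hone : ∀ x : E d, (1 : ℝ) ≤ 1 + ‖x‖ := fun x => by linarith [norm_nonneg x]
  have hWm : AEMeasurable W :=
    (Measurable.mul (hAm.mul (hAm.pow_const _)) (by fun_prop)).aemeasurable
  have hW2 : ∀ x, W x ≤ locMax S x * locMax S x ^ (-ε) := by
    intro x
    refine mul_le_of_le_one_right zero_le (ENNReal.ofReal_le_one.2 ?_)
    exact mul_le_one₀ hb1 (by positivity)
      (Real.rpow_le_one_of_one_le_of_nonpos (hone x) (by simp; positivity))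
  have hW1 : ∀ x, W x ≤ locMax S x * locMax S x ^ ε := by
    intro x
    simp only [hW]
    rw [mul_assoc]
    gcongr
    rcases eq_or_ne (locMax S x) ∞ with ht | ht
    · rw [ht, ENNReal.top_rpow_of_pos hε]
      exact le_top
    have hx : ENNReal.ofReal (b * (1 + ‖x‖) ^ (-(2 * d * ε))) ≤ locMax S x ^ (2 * ε) := by
      calc _ = ENNReal.ofReal (min 1 c * (1 + ‖x‖) ^ (-(d : ℝ))) ^ (2 * ε) := by
            rw [ENNReal.ofReal_rpow_of_nonneg (by positivity) (by positivity),
              Real.mul_rpow hmin.le (by positivity), ← Real.rpow_mul (by positivity), ← hb,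
              show -(d : ℝ) * (2 * ε) = -(2 * d * ε) by ring]
        _ ≤ ENNReal.ofReal (c * (1 + ‖x‖) ^ (-(d : ℝ))) ^ (2 * ε) := by
            gcongr
            exact min_le_right _ _
        _ ≤ _ := by
            gcongr
            exact hlow x
    calc _ ≤ locMax S x ^ (-ε) * locMax S x ^ (2 * ε) := by gcongr
      _ = _ := by
          rw [← ENNReal.rpow_add _ _ (hA0 x) ht]
          ring_nf
  refine ⟨ENNReal.ofReal (C₀ ^ p * b⁻¹) * C₁, ENNReal.mul_ne_top ENNReal.ofReal_ne_top hC₁,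
    fun F hF => ?_⟩
  have hmain := h₁ S F W hS hF hWm hS0 (hA.mono fun x hx => ⟨hA0 x, hx⟩) hW1 hW2
  calc _ ≤ ∫⁻ x, ENNReal.ofReal (C₀ ^ p * b⁻¹) * (W x * (locMax F x / locMax S x) ^ p) := by
        refine lintegral_mono_ae (hA.mono fun x hx => ?_)
        have h := ofReal_mul_rpow_mul_weight_le (κ := ((2 * d : ℕ) : ℝ)) (N := N) hC₀
          (by positivity) (zero_lt_one.trans hp) x
        rw [Real.rpow_natCast] at h
        have hle : ENNReal.ofReal ((1 + ‖x‖) ^ (((2 * d : ℕ) : ℝ) * p - N)) ≤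
            ENNReal.ofReal b⁻¹ * ENNReal.ofReal (b * (1 + ‖x‖) ^ (-(2 * d * ε))) := by
          rw [← ENNReal.ofReal_mul (by positivity), inv_mul_cancel_left₀ hb0.ne']
          refine ENNReal.ofReal_le_ofReal (Real.rpow_le_rpow_of_exponent_le (hone x) ?_)
          push_cast
          linarith
        -- This is the point of θ = p - 1 + ε: the p powers moved into the quotient leave exactly
        -- A^{1-ε}.
        have hAe : locMax F x ^ p * locMax S x ^ (-θ) =
            locMax S x * locMax S x ^ (-ε) * (locMax F x / locMax S x) ^ p := by
          rw [div_eq_mul_inv, ENNReal.mul_rpow_of_nonneg _ _ (by linarith), ENNReal.inv_rpow,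
            ← ENNReal.rpow_neg, mul_left_comm]
          congr 1
          nth_rw 2 [← ENNReal.rpow_one (locMax S x)]
          rw [← ENNReal.rpow_add _ _ (hA0 x) hx, ← ENNReal.rpow_add _ _ (hA0 x) hx, hθ]
          ring_nf
        calc _ = locMax F x ^ p * locMax S x ^ (-θ) *
              (ENNReal.ofReal (C₀ * max ‖x‖ 1 ^ (2 * d) * Real.exp (‖x‖ ^ 2 / 2)) ^ p *
              ENNReal.ofReal (Real.exp (-(p * ‖x‖ ^ 2 / 2)) * (1 + ‖x‖) ^ (-N))) := by
              rw [weightOf, ENNReal.mul_rpow_of_nonneg _ _ (by linarith)]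
              ring
          _ ≤ locMax F x ^ p * locMax S x ^ (-θ) * (ENNReal.ofReal (C₀ ^ p) *
              (ENNReal.ofReal b⁻¹ * ENNReal.ofReal (b * (1 + ‖x‖) ^ (-(2 * d * ε))))) := by
              gcongr locMax F x ^ p * locMax S x ^ (-θ) * ?_
              exact h.trans (mul_le_mul_right hle _)
          _ = _ := by
              rw [hAe, ENNReal.ofReal_mul (p := C₀ ^ p) (by positivity)]
              simp only [hW]
              generalize ENNReal.ofReal (b * (1 + ‖x‖) ^ (-(2 * d * ε))) = r
              ring
    _ = ENNReal.ofReal (C₀ ^ p * b⁻¹) * ∫⁻ x, W x * (locMax F x / locMax S x) ^ p :=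
        lintegral_const_mul' _ _ ENNReal.ofReal_ne_top
    _ ≤ _ := by
        rw [mul_assoc]
        gcongr

/-- The weighted bound for the far term. -/
theorem lintegral_far_lt_top {p θ N κ C₀ : ℝ} (hp : 1 < p) (hθ : 0 ≤ θ) (hκ : 0 ≤ κ)
    (hN : κ * p + d * θ + d < N) (hC₀ : 0 ≤ C₀) {S : E d → ℝ≥0∞} (hS : AEMeasurable S)
    (hS0 : ∀ᵐ y, S y ≠ 0) :
    ∫⁻ x, ENNReal.ofReal (C₀ * max ‖x‖ 1 ^ κ * Real.exp (‖x‖ ^ 2 / 2)) ^ p *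
      weightOf p θ N S x < ∞ := by
  obtain ⟨c, hc, hlow⟩ := exists_le_locMax hS hS0
  -- The losses are κp from the rank-one factor and dθ from the lower bound on the maximal function;
  -- the remaining decay must exceed d.
  have hfin : ∫⁻ x : E d, ENNReal.ofReal ((1 + ‖x‖) ^ (-(N - κ * p - d * θ))) < ∞ := by
    refine finite_integral_one_add_norm ?_
    rw [finrank_euclideanSpace_fin]
    linarith
  refine lt_of_le_of_lt (b := ENNReal.ofReal (C₀ ^ p * c ^ (-θ)) *
    ∫⁻ x : E d, ENNReal.ofReal ((1 + ‖x‖) ^ (-(N - κ * p - d * θ)))) ?_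
    (ENNReal.mul_lt_top ENNReal.ofReal_lt_top hfin)
  rw [← lintegral_const_mul' _ _ ENNReal.ofReal_ne_top]
  refine lintegral_mono fun x => ?_
  have h0 : 0 < 1 + ‖x‖ := by positivity
  have h := ofReal_mul_rpow_mul_weight_le (N := N) hC₀ hκ (zero_lt_one.trans hp) x
  have hA : locMax S x ^ (-θ) ≤ ENNReal.ofReal (c ^ (-θ) * (1 + ‖x‖) ^ (d * θ)) := by
    calc locMax S x ^ (-θ) ≤ ENNReal.ofReal (c * (1 + ‖x‖) ^ (-(d : ℝ))) ^ (-θ) := by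
          rw [ENNReal.rpow_neg, ENNReal.rpow_neg, ENNReal.inv_le_inv]
          gcongr
          exact hlow x
      _ = _ := by
          rw [ENNReal.ofReal_rpow_of_pos (by positivity), Real.mul_rpow hc.le (by positivity),
            ← Real.rpow_mul h0.le]
          ring_nf
  calc _ = locMax S x ^ (-θ) * (ENNReal.ofReal (C₀ * max ‖x‖ 1 ^ κ * Real.exp (‖x‖ ^ 2 / 2)) ^ p *
        ENNReal.ofReal (Real.exp (-(p * ‖x‖ ^ 2 / 2)) * (1 + ‖x‖) ^ (-N))) := by
        rw [weightOf]
        ring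
    _ ≤ ENNReal.ofReal (c ^ (-θ) * (1 + ‖x‖) ^ (d * θ)) *
        (ENNReal.ofReal (C₀ ^ p) * ENNReal.ofReal ((1 + ‖x‖) ^ (κ * p - N))) :=
        mul_le_mul' hA h
    _ = _ := by
        rw [← ENNReal.ofReal_mul (by positivity), ← ENNReal.ofReal_mul (by positivity),
          ← ENNReal.ofReal_mul (by positivity)]
        congr 1
        rw [show -(N - κ * p - d * θ) = d * θ + (κ * p - N) by ring, Real.rpow_add h0]
        ring

theorem exists_one_add_rpow_mul_exp_le (k : ℝ) {c n : ℝ} (hc : 0 < c) :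
    ∃ C : ℝ, 0 ≤ C ∧ ∀ r : ℝ, 0 ≤ r →
      (1 + r) ^ k * Real.exp (-(c * r ^ 2)) ≤ C * (1 + r) ^ (-n) := by
  obtain ⟨C, hC, h⟩ := exists_rpow_le_mul_exp (le_max_right (k + n) 0)
  refine ⟨C * Real.exp (1 + 1 / (4 * c)), by positivity, fun r hr => ?_⟩
  have h0 : 0 < 1 + r := by linarith
  have h1 : (1 + r) ^ (k + n) ≤ C * Real.exp (1 + r) :=
    (Real.rpow_le_rpow_of_exponent_le (by linarith) (le_max_left _ _)).trans (h _ h0.le)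
  have h3 : r ≤ c * r ^ 2 + 1 / (4 * c) := by
    have e : c * r ^ 2 + 1 / (4 * c) - r = (2 * c * r - 1) ^ 2 / (4 * c) := by
      field_simp
      ring
    have : 0 ≤ (2 * c * r - 1) ^ 2 / (4 * c) := by positivity
    linarith
  calc (1 + r) ^ k * Real.exp (-(c * r ^ 2))
      = (1 + r) ^ (-n) * ((1 + r) ^ (k + n) * Real.exp (-(c * r ^ 2))) := by
        rw [← mul_assoc, ← Real.rpow_add h0]
        ring_nf
    _ ≤ (1 + r) ^ (-n) * (C * Real.exp (1 + r) * Real.exp (-(c * r ^ 2))) := by gcongr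
    _ = (1 + r) ^ (-n) * (C * Real.exp (1 + r + -(c * r ^ 2))) := by rw [Real.exp_add (1 + r)]; ring
    _ ≤ (1 + r) ^ (-n) * (C * Real.exp (1 + 1 / (4 * c))) :=
        mul_le_mul_of_nonneg_left (mul_le_mul_of_nonneg_left (Real.exp_le_exp.2 (by linarith))
          hC.le) (by positivity)
    _ = _ := by ring

/-- Powers `θ < 1` of the local maximal function of a function of polynomial growth are integrable
against Gaussians. -/
theorem lintegral_locMax_rpow_mul_gaussian_lt_top (hd : 1 ≤ d) {K θ k c : ℝ} (hK : 0 ≤ K)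
    (hθ : 0 < θ) (hθ1 : θ < 1) (hc : 0 < c) {S : E d → ℝ≥0∞} (hS : AEMeasurable S)
    (hSK : ∫⁻ y, S y * ENNReal.ofReal ((1 + ‖y‖) ^ (-K)) ≠ ∞) :
    ∫⁻ x, locMax S x ^ θ * ENNReal.ofReal ((1 + ‖x‖) ^ k * Real.exp (-(c * ‖x‖ ^ 2))) < ∞ := by
  have hGae : AEMeasurable fun y => S y * ENNReal.ofReal ((1 + ‖y‖) ^ (-K)) :=
    hS.mul (by fun_prop)
  set G := hGae.mk _ with hG
  have hGm : Measurable G := hGae.measurable_mk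
  have hGint : ∫⁻ y, G y ≠ ∞ := by rwa [← lintegral_congr_ae hGae.ae_eq_mk]
  have hHm := measurable_hlMax' hGm
  -- The Gaussian absorbs all polynomial growth and still leaves (1+|x|)^{-(d+1)}, the density of a
  -- finite measure to which Kolmogorov's inequality applies.
  obtain ⟨C, hC, h⟩ := exists_one_add_rpow_mul_exp_le (k + K * θ) (c := c) (n := (d : ℝ) + 1) hc
  set ρ : Measure (E d) := volume.withDensity fun x => ENNReal.ofReal ((1 + ‖x‖) ^ (-((d : ℝ) + 1)))
    with hρ
  have hρm : Measurable fun x : E d => ENNReal.ofReal ((1 + ‖x‖) ^ (-((d : ℝ) + 1))) := by fun_prop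
  have hρfin : ρ univ < ∞ := by
    rw [hρ, withDensity_apply _ MeasurableSet.univ, Measure.restrict_univ]
    refine finite_integral_one_add_norm ?_
    rw [finrank_euclideanSpace_fin]
    linarith
  have hρle : ∀ s, ρ s ≤ volume s := by
    intro s
    refine Measure.le_iff'.1 ?_ s
    calc ρ ≤ (volume : Measure (E d)).withDensity 1 := by
          refine withDensity_mono (Filter.Eventually.of_forall fun x => ?_)
          refine ENNReal.ofReal_le_one.2 (Real.rpow_le_one_of_one_le_of_nonpos ?_ ?_)
          · linarith [norm_nonneg x]
          · linarith [d.cast_nonneg (α := ℝ)]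
      _ = volume := withDensity_one
  have hfin := lintegral_rpow_lt_top_of_weak_type hρfin hρle hHm hθ hθ1
    (K := 5 ^ d * ∫⁻ y, G y) (ENNReal.mul_ne_top (by simp) hGint)
    fun t ht => volume_lt_hlMax_le hd G ht
  rw [hρ, lintegral_withDensity_eq_lintegral_mul _ hρm (hHm.pow_const _)] at hfin
  refine lt_of_le_of_lt (b := ENNReal.ofReal (4 ^ (K * θ) * C) *
    ∫⁻ x, ENNReal.ofReal ((1 + ‖x‖) ^ (-((d : ℝ) + 1))) * hlMax G x ^ θ) ?_
    (ENNReal.mul_lt_top ENNReal.ofReal_lt_top hfin)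
  rw [← lintegral_const_mul' _ _ ENNReal.ofReal_ne_top]
  refine lintegral_mono fun x => ?_
  have h0 : 0 < 1 + ‖x‖ := by positivity
  have h1 : locMax S x ^ θ ≤ ENNReal.ofReal ((4 * (1 + ‖x‖)) ^ (K * θ)) * hlMax G x ^ θ := by
    rw [Real.rpow_mul (by positivity), ← ENNReal.ofReal_rpow_of_nonneg (by positivity) hθ.le,
      ← ENNReal.mul_rpow_of_nonneg _ _ hθ.le, hG, ← hlMax_congr hGae.ae_eq_mk]
    exact ENNReal.rpow_le_rpow (locMax_le_mul_hlMax hK S x) hθ.le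
  calc _ ≤ ENNReal.ofReal ((4 * (1 + ‖x‖)) ^ (K * θ)) * hlMax G x ^ θ *
        ENNReal.ofReal ((1 + ‖x‖) ^ k * Real.exp (-(c * ‖x‖ ^ 2))) := by gcongr
    _ = ENNReal.ofReal (4 ^ (K * θ) *
        ((1 + ‖x‖) ^ (k + K * θ) * Real.exp (-(c * ‖x‖ ^ 2)))) * hlMax G x ^ θ := by
        rw [mul_right_comm, ← ENNReal.ofReal_mul (by positivity)]
        congr 2
        rw [Real.mul_rpow (by norm_num) h0.le, Real.rpow_add h0]
        ring
    _ ≤ ENNReal.ofReal (4 ^ (K * θ) * (C * (1 + ‖x‖) ^ (-((d : ℝ) + 1)))) * hlMax G x ^ θ := by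
        gcongr ENNReal.ofReal (_ * ?_) * _
        exact h _ (norm_nonneg x)
    _ = _ := by
        rw [← mul_assoc, ENNReal.ofReal_mul (by positivity), mul_assoc]

end Weights

/-! ### The dual weight and Hölder's inequality. -/

section DualWeight

variable {d : ℕ} {p : ℝ}

/-- The dual weight `w^{-p'/p} e^{-p'|y|²/2}`. -/
def dualWeight (p : ℝ) (w : E d → ℝ) (y : E d) : ℝ≥0∞ :=
  ‖w y ^ (-(p.conjExponent / p)) * Real.exp (-(p.conjExponent * ‖y‖ ^ 2 / 2))‖ₑ

theorem weightV_eq (α N : ℝ) (w : E d → ℝ) :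
    weightV d p α N w = weightOf p (α / (p.conjExponent / p)) N (dualWeight p w) := rfl

theorem conjExponent_div (hp : 1 < p) : p.conjExponent / p = 1 / (p - 1) := by
  rw [Real.conjExponent]
  have : p ≠ 0 := by linarith
  have : p - 1 ≠ 0 := by linarith
  field_simp

theorem aemeasurable_dualWeight {w : E d → ℝ} (hw : AEMeasurable w) :
    AEMeasurable (dualWeight p w) :=
  ((hw.pow_const _).mul (by fun_prop)).enorm

theorem dualWeight_of_pos {w : E d → ℝ} {y : E d} (hw : 0 < w y) :
    dualWeight p w y = ENNReal.ofReal
      (w y ^ (-(p.conjExponent / p)) * Real.exp (-(p.conjExponent * ‖y‖ ^ 2 / 2))) := by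
  rw [dualWeight, Real.enorm_of_nonneg (by positivity)]

theorem ae_dualWeight {w : E d → ℝ} (hw : ∀ᵐ y, 0 < w y) :
    ∀ᵐ y, dualWeight p w y ≠ 0 ∧ dualWeight p w y ≠ ∞ := by
  filter_upwards [hw] with y hy
  rw [dualWeight_of_pos hy]
  refine ⟨?_, ENNReal.ofReal_ne_top⟩
  rw [Ne, ENNReal.ofReal_eq_zero, not_le]
  positivity

/-- Since p'/p = 1/(p-1) and p'(p-1) = p, the power of w becomes 1 and the Gaussians cancel. This
identifies the right side of the two-weight inequality with the L^p(w) norm. -/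
theorem gaussAbs_rpow_mul_dualWeight (hp : 1 < p) {w : E d → ℝ} (f : E d → ℂ) {y : E d}
    (hw : 0 < w y) :
    gaussAbs f y ^ p * dualWeight p w y ^ (1 - p) = ‖f y‖ₑ ^ p * ENNReal.ofReal (w y) := by
  have hp1 : p - 1 ≠ 0 := by linarith
  rw [dualWeight_of_pos hw, gaussAbs, ENNReal.mul_rpow_of_nonneg _ _ (by linarith),
    ENNReal.ofReal_rpow_of_pos (by positivity), ENNReal.ofReal_rpow_of_pos (by positivity),
    mul_assoc, ← ENNReal.ofReal_mul (by positivity)]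
  congr 2
  rw [Real.mul_rpow (by positivity) (by positivity), ← Real.exp_mul, ← Real.exp_mul,
    ← Real.rpow_mul hw.le, conjExponent_div hp, mul_left_comm, ← Real.exp_add, Real.conjExponent]
  have e1 : -(1 / (p - 1)) * (1 - p) = 1 := by
    field_simp
    ring
  have e2 : -(‖y‖ ^ 2 / 2) * p + -(p / (p - 1) * ‖y‖ ^ 2 / 2) * (1 - p) = 0 := by
    field_simp
    ring
  rw [e1, e2, Real.rpow_one, Real.exp_zero, mul_one]

theorem eLpNorm_withDensity_eq (hp : 1 < p) {X Y : Type*} [MeasurableSpace X] [TopologicalSpace Y]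
    [ContinuousENorm Y] {μ : Measure X} {v : X → ℝ≥0∞} (hv : AEMeasurable v μ) {f : X → Y}
    (hf : AEStronglyMeasurable f μ) :
    eLpNorm f (ENNReal.ofReal p) (μ.withDensity v) = (∫⁻ x, ‖f x‖ₑ ^ p * v x ∂μ) ^ (1 / p) := by
  rw [eLpNorm_eq_lintegral_rpow_enorm_toReal (by simp; linarith) ENNReal.ofReal_ne_top,
    ENNReal.toReal_ofReal (by linarith),
    lintegral_withDensity_eq_lintegral_mul₀ hv (hf.enorm.pow_const _)]
  simp only [Pi.mul_apply, mul_comm]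

theorem aestronglyMeasurable_of_withDensity {w : E d → ℝ} (hw : AEMeasurable w)
    (hw0 : ∀ᵐ y, 0 < w y) {f : E d → ℂ}
    (hf : AEStronglyMeasurable f (volume.withDensity fun x => ENNReal.ofReal (w x))) :
    AEStronglyMeasurable f :=
  hf.mono_ac (withDensity_absolutelyContinuous' hw.ennreal_ofReal
    (hw0.mono fun y hy => by simpa using hy))

/-- Hölder's inequality for the pairing with `φ`. -/
theorem phiNorm_le (hp : 1 < p) {m ν : ℝ} {w : E d → ℝ} (hw : AEMeasurable w)
    (hw0 : ∀ᵐ y, 0 < w y) {f : E d → ℂ} (hf : AEStronglyMeasurable f) :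
    phiNorm d m ν f ≤ (∫⁻ y, ‖f y‖ₑ ^ p * ENNReal.ofReal (w y)) ^ (1 / p) *
      eLpNorm (fun x => w x ^ (-(1 / p)) * phi d m ν x) (ENNReal.ofReal p.conjExponent) volume := by
  have hpq := Real.HolderConjugate.conjExponent hp
  have hq0 := hpq.symm.pos
  rw [eLpNorm_eq_lintegral_rpow_enorm_toReal (by simpa using hq0) ENNReal.ofReal_ne_top,
    ENNReal.toReal_ofReal hq0.le]
  have hphi : Measurable (phi d m ν) := by
    have : phi d m ν = fun y => Real.exp (-(‖y‖ ^ 2 / 2)) * psi (d + m) ν ‖y‖ :=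
      funext fun y => phi_eq d m ν y
    rw [this]
    unfold psi
    split_ifs <;> fun_prop
  have hp0 : 0 < p := by linarith
  calc phiNorm d m ν f = ∫⁻ y, (‖f y‖ₑ * ENNReal.ofReal (w y) ^ (1 / p)) *
        ‖w y ^ (-(1 / p)) * phi d m ν y‖ₑ := by
        refine lintegral_congr_ae (hw0.mono fun y hy => ?_)
        beta_reduce
        have hφ : 0 < phi d m ν y := by
          rw [phi_eq]
          exact mul_pos (Real.exp_pos _) (psi_pos _ _ (norm_nonneg y))
        rw [Real.enorm_of_nonneg (by positivity), ENNReal.ofReal_rpow_of_pos hy, mul_assoc,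
          ← ENNReal.ofReal_mul (by positivity), ← mul_assoc, ← Real.rpow_add hy, add_neg_cancel,
          Real.rpow_zero, one_mul]
    _ ≤ (∫⁻ y, (‖f y‖ₑ * ENNReal.ofReal (w y) ^ (1 / p)) ^ p) ^ (1 / p) *
        (∫⁻ y, ‖w y ^ (-(1 / p)) * phi d m ν y‖ₑ ^ p.conjExponent) ^ (1 / p.conjExponent) :=
        ENNReal.lintegral_mul_le_Lp_mul_Lq volume hpq
          (hf.enorm.mul (hw.ennreal_ofReal.pow_const _))
          ((hw.pow_const _).mul hphi.aemeasurable).enorm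
    _ = _ := by
        congr 2
        refine lintegral_congr fun y => ?_
        rw [ENNReal.mul_rpow_of_nonneg _ _ hp0.le, ← ENNReal.rpow_mul, one_div_mul_cancel hp0.ne',
          ENNReal.rpow_one]

/-- The dual weight is integrable up to polynomial growth. -/
theorem lintegral_dualWeight_ne_top (hp : 1 < p) {m ν : ℝ} (hm : -(d : ℝ) ≤ m) (hν : 0 < ν)
    {w : E d → ℝ} (hw0 : ∀ᵐ y, 0 < w y)
    (hφ : eLpNorm (fun x => w x ^ (-(1 / p)) * phi d m ν x)
      (ENNReal.ofReal p.conjExponent) volume < ∞) :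
    ∫⁻ y, dualWeight p w y *
      ENNReal.ofReal ((1 + ‖y‖) ^ (-((((d : ℝ) + m) / 2 + 1 + ν) * p.conjExponent))) ≠ ∞ := by
  have hpq := Real.HolderConjugate.conjExponent hp
  have hq0 := hpq.symm.pos
  have hβ : 0 ≤ (d : ℝ) + m := by linarith
  set q := p.conjExponent with hq
  set k := ((d : ℝ) + m) / 2 + 1 + ν with hk
  rw [eLpNorm_eq_lintegral_rpow_enorm_toReal (by simpa using hq0) ENNReal.ofReal_ne_top,
    ENNReal.toReal_ofReal hq0.le, ENNReal.rpow_lt_top_iff_of_pos (by positivity)] at hφ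
  refine (lt_of_le_of_lt (b := ENNReal.ofReal (Real.exp 1 ^ (k * q)) *
    ∫⁻ y, ‖w y ^ (-(1 / p)) * phi d m ν y‖ₑ ^ q) ?_
    (ENNReal.mul_lt_top ENNReal.ofReal_lt_top hφ)).ne
  rw [← lintegral_const_mul' _ _ ENNReal.ofReal_ne_top]
  refine lintegral_mono_ae (hw0.mono fun y hy => ?_)
  have hψ := psi_pos (d + m) ν (norm_nonneg y)
  have hge := rpow_le_psi hβ hν (norm_nonneg y)
  have he : 1 ≤ Real.exp 1 := Real.one_le_exp zero_le_one
  have h1 : (Real.exp 1 * (1 + ‖y‖)) ^ (-k) ≤ psi (d + m) ν ‖y‖ := by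
    refine le_trans (Real.rpow_le_rpow_of_nonpos (by positivity) ?_ ?_) hge
    · nlinarith [norm_nonneg y]
    · linarith
  have h2 : (1 + ‖y‖) ^ (-(k * q)) ≤ Real.exp 1 ^ (k * q) * psi (d + m) ν ‖y‖ ^ q := by
    have h3 := Real.rpow_le_rpow (by positivity) h1 hq0.le
    rw [← Real.rpow_mul (by positivity), Real.mul_rpow (by positivity) (by positivity), neg_mul,
      Real.rpow_neg (by positivity), inv_mul_le_iff₀ (by positivity)] at h3
    exact h3
  rw [dualWeight_of_pos hy, phi_eq, Real.enorm_of_nonneg (by positivity),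
    ENNReal.ofReal_rpow_of_nonneg (by positivity) hq0.le, ← ENNReal.ofReal_mul (by positivity),
    ← ENNReal.ofReal_mul (by positivity)]
  refine ENNReal.ofReal_le_ofReal ?_
  calc _ ≤ w y ^ (-(q / p)) * Real.exp (-(q * ‖y‖ ^ 2 / 2)) *
        (Real.exp 1 ^ (k * q) * psi (d + m) ν ‖y‖ ^ q) := by gcongr
    _ = _ := by
        rw [Real.mul_rpow (by positivity) (by positivity),
          Real.mul_rpow (by positivity) (by positivity), ← Real.rpow_mul hy.le,
          ← Real.exp_mul (-(‖y‖ ^ 2 / 2)), show -(1 / p) * q = -(q / p) by ring,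
          show -(‖y‖ ^ 2 / 2) * q = -(q * ‖y‖ ^ 2 / 2) by ring]
        ring

/-- The dual weight damped by a power is integrable, so its full maximal function is finite a.e.;
the cutoff lets the power be restored. -/
theorem ae_locMax_dualWeight_ne_top (hd : 1 ≤ d) (hp : 1 < p) {m ν : ℝ} (hm : -(d : ℝ) ≤ m)
    (hν : 0 < ν) {w : E d → ℝ} (hw0 : ∀ᵐ y, 0 < w y)
    (hφ : eLpNorm (fun x => w x ^ (-(1 / p)) * phi d m ν x)
      (ENNReal.ofReal p.conjExponent) volume < ∞) :
    ∀ᵐ x, locMax (dualWeight p w) x ≠ ∞ := by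
  have hq0 := (Real.HolderConjugate.conjExponent hp).symm.pos
  have hβ : 0 ≤ (d : ℝ) + m := by linarith
  filter_upwards [ae_hlMax_lt_top hd (lintegral_dualWeight_ne_top hp hm hν hw0 hφ)] with x hx
  exact ((locMax_le_mul_hlMax (by positivity) _ x).trans_lt
    (ENNReal.mul_lt_top ENNReal.ofReal_lt_top hx)).ne

end DualWeight

/-! ### Assembly of the estimates. -/

section Main

variable {d : ℕ} {p m ν : ℝ}

theorem div_conjExponent_div (hp : 1 < p) (α : ℝ) :
    α / (p.conjExponent / p) = α * (p - 1) := by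
  rw [conjExponent_div hp, div_div_eq_mul_div, div_one]

theorem ae_weightV_pos_lt_top (hd : 1 ≤ d) (hp : 1 < p) (hm : -(d : ℝ) ≤ m) (hν : 0 < ν)
    (α N : ℝ) {w : E d → ℝ} (hw : AEMeasurable w) (hw0 : ∀ᵐ y, 0 < w y)
    (hφ : eLpNorm (fun x => w x ^ (-(1 / p)) * phi d m ν x)
      (ENNReal.ofReal p.conjExponent) volume < ∞) :
    ∀ᵐ x, 0 < weightV d p α N w x ∧ weightV d p α N w x < ∞ := by
  have hS := aemeasurable_dualWeight (p := p) hw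
  have hS0 : ∀ᵐ y, dualWeight p w y ≠ 0 := (ae_dualWeight hw0).mono fun _ h => h.1
  filter_upwards [ae_locMax_dualWeight_ne_top hd hp hm hν hw0 hφ] with x hx
  have hx0 := locMax_ne_zero hS hS0 x
  rw [weightV_eq, weightOf]
  refine ⟨ENNReal.mul_pos (ENNReal.rpow_pos (pos_iff_ne_zero.2 hx0) hx).ne' ?_,
    ENNReal.mul_lt_top ?_ ENNReal.ofReal_lt_top⟩
  · rw [Ne, ENNReal.ofReal_eq_zero, not_le]
    positivity
  · exact (ENNReal.rpow_ne_top_of_ne_zero hx0 hx).lt_top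

/-- The weighted bound for the local maximal operator of the Poisson integrals. -/
theorem exists_lintegral_poissonMax_le (hd : 1 ≤ d) (hp : 1 < p) (hm : -(d : ℝ) ≤ m) (hν : 0 < ν)
    {α N a : ℝ} (hα : 1 < α) (ha : 0 < a)
    (hN₁ : 2 * d * p + 2 * d * ((α - 1) * (p - 1)) ≤ N)
    (hN₂ : (((d : ℝ) + m) / 2 + 1 + ν) * p + d * (α * (p - 1)) + d < N)
    {w : E d → ℝ} (hw : AEMeasurable w) (hw0 : ∀ᵐ y, 0 < w y)
    (hφ : eLpNorm (fun x => w x ^ (-(1 / p)) * phi d m ν x)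
      (ENNReal.ofReal p.conjExponent) volume < ∞) :
    ∃ C : ℝ≥0∞, C ≠ ∞ ∧ ∀ f : E d → ℂ, AEStronglyMeasurable f →
      ∫⁻ x, poissonMax d m ν a f x ^ p * weightV d p α N w x ≤
        C * ∫⁻ y, ‖f y‖ₑ ^ p * ENNReal.ofReal (w y) := by
  have hp0 : 0 < p := by linarith
  have hε : 0 < (α - 1) * (p - 1) := mul_pos (by linarith) (by linarith)
  have hκ : 0 ≤ ((d : ℝ) + m) / 2 + 1 + ν := by linarith
  have hS := aemeasurable_dualWeight (p := p) hw
  have hSae := ae_dualWeight (p := p) hw0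
  have hA := ae_locMax_dualWeight_ne_top hd hp hm hν hw0 hφ
  obtain ⟨C₀, hC₀, h₀⟩ := exists_poissonMax_le (d := d) hm hν ha
  obtain ⟨C₁, hC₁, h₁⟩ := exists_lintegral_local_le hd (θ := α * (p - 1)) hp hε (by ring) hN₁ hC₀
    hS hSae hA
  have h₂ := lintegral_far_lt_top (θ := α * (p - 1)) hp
    (mul_nonneg (by linarith) (by linarith)) hκ hN₂ hC₀ hS (hSae.mono fun _ h => h.1)
  set Φ := eLpNorm (fun x => w x ^ (-(1 / p)) * phi d m ν x)
      (ENNReal.ofReal p.conjExponent) volume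
  set V := weightOf p (α * (p - 1)) N (dualWeight p w) with hV
  have hVw : weightV d p α N w = V := by rw [weightV_eq, div_conjExponent_div hp]
  have hVm : Measurable V := measurable_weightOf _ _ _ hS
  set J := ∫⁻ x : E d, ENNReal.ofReal
    (C₀ * max ‖x‖ 1 ^ (((d : ℝ) + m) / 2 + 1 + ν) * Real.exp (‖x‖ ^ 2 / 2)) ^ p * V x with hJ
  have h2 : (2 : ℝ≥0∞) ^ (p - 1) ≠ ∞ := ENNReal.rpow_ne_top_of_nonneg (by linarith) (by simp)
  refine ⟨2 ^ (p - 1) * (C₁ + J * Φ ^ p), ENNReal.mul_ne_top h2 (ENNReal.add_ne_top.2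
    ⟨hC₁, ENNReal.mul_ne_top h₂.ne (ENNReal.rpow_ne_top_of_nonneg hp0.le hφ.ne)⟩), fun f hf => ?_⟩
  rw [hVw]
  set I := ∫⁻ y, ‖f y‖ₑ ^ p * ENNReal.ofReal (w y)
  have hI : ∫⁻ y, gaussAbs f y ^ p * dualWeight p w y ^ (1 - p) = I :=
    lintegral_congr_ae (hw0.mono fun y hy => gaussAbs_rpow_mul_dualWeight hp f hy)
  -- The only place where the size of the norm in the hypothesis enters the operator bound: it
  -- controls the rank-one term.
  have hnorm : phiNorm d m ν f ^ p ≤ I * Φ ^ p := by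
    calc _ ≤ (I ^ (1 / p) * Φ) ^ p := ENNReal.rpow_le_rpow (phiNorm_le hp hw hw0 hf) hp0.le
      _ = _ := by
        rw [ENNReal.mul_rpow_of_nonneg _ _ hp0.le, ← ENNReal.rpow_mul, one_div_mul_cancel hp0.ne',
          ENNReal.rpow_one]
  set G := fun x : E d => ENNReal.ofReal (C₀ * max ‖x‖ 1 ^ (2 * d) * Real.exp (‖x‖ ^ 2 / 2)) *
    locMax (gaussAbs f) x
  set H := fun x : E d => ENNReal.ofReal
    (C₀ * max ‖x‖ 1 ^ (((d : ℝ) + m) / 2 + 1 + ν) * Real.exp (‖x‖ ^ 2 / 2))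
  have hHm : Measurable H := by fun_prop
  have hHV : Measurable fun x => H x ^ p * V x := (hHm.pow_const _).mul hVm
  calc _ ≤ ∫⁻ x, 2 ^ (p - 1) * (G x ^ p * V x + H x ^ p * V x * phiNorm d m ν f ^ p) := by
        refine lintegral_mono fun x => ?_
        beta_reduce
        calc _ ≤ (G x + H x * phiNorm d m ν f) ^ p * V x := by
              gcongr
              exact h₀ f hf x
          _ ≤ 2 ^ (p - 1) * (G x ^ p + (H x * phiNorm d m ν f) ^ p) * V x := by
              gcongr
              exact ENNReal.rpow_add_le_mul_rpow_add_rpow _ _ hp.le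
          _ = _ := by
              rw [ENNReal.mul_rpow_of_nonneg (H x) _ hp0.le]
              ring
    _ = 2 ^ (p - 1) * ((∫⁻ x, G x ^ p * V x) + J * phiNorm d m ν f ^ p) := by
        rw [lintegral_const_mul' _ _ h2, lintegral_add_right _ (hHV.mul_const _),
          lintegral_mul_const _ hHV]
    _ ≤ 2 ^ (p - 1) * (C₁ * I + J * (I * Φ ^ p)) := by
        gcongr
        rw [← hI]
        exact h₁ _ (aemeasurable_gaussAbs hf)
    _ = _ := by ring

/-- Integrability of negative powers of the weight. -/
theorem eLpNorm_weightV_rpow_mul_phi_lt_top (hd : 1 ≤ d) (hp : 1 < p) (hm : -(d : ℝ) ≤ m)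
    (hν : 0 < ν) {α σ : ℝ} (N : ℝ) (hα : 1 < α) (hσ : 0 < σ) (hσ1 : σ < 1) (hασ : α < 1 / σ)
    {w : E d → ℝ} (hw : AEMeasurable w) (hw0 : ∀ᵐ y, 0 < w y)
    (hφ : eLpNorm (fun x => w x ^ (-(1 / p)) * phi d m ν x)
      (ENNReal.ofReal p.conjExponent) volume < ∞) :
    eLpNorm (fun x => weightV d p α N w x ^ (-(σ / p)) * ENNReal.ofReal (phi d m ν x))
      (ENNReal.ofReal p.conjExponent) volume < ∞ := by
  have hp0 : 0 < p := by linarith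
  have hq0 := (Real.HolderConjugate.conjExponent hp).symm.pos
  have hβ : 0 ≤ (d : ℝ) + m := by linarith
  have hS := aemeasurable_dualWeight (p := p) hw
  have hS0 : ∀ᵐ y, dualWeight p w y ≠ 0 := (ae_dualWeight hw0).mono fun _ h => h.1
  -- In the power p' of v^{-σ/p}φ, the maximal function appears to the exponent ασ < 1, and
  -- e^{σp'|x|²/2} from v against e^{-p'|x|²/2} from φ leaves the rate (1-σ)p'/2.
  have hfin := lintegral_locMax_rpow_mul_gaussian_lt_top hd
    (K := (((d : ℝ) + m) / 2 + 1 + ν) * p.conjExponent) (θ := α * σ)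
    (k := N * (σ / p * p.conjExponent)) (c := (1 - σ) * p.conjExponent / 2)
    (mul_nonneg (by linarith) hq0.le) (by positivity) ((lt_div_iff₀ hσ).1 hασ)
    (by have : 0 < 1 - σ := by linarith
        positivity) hS (lintegral_dualWeight_ne_top hp hm hν hw0 hφ)
  have hαq : α / (p.conjExponent / p) * (σ / p * p.conjExponent) = α * σ := by
    field_simp
  set q := p.conjExponent with hq
  rw [eLpNorm_eq_lintegral_rpow_enorm_toReal (by simpa using hq0) ENNReal.ofReal_ne_top,
    ENNReal.toReal_ofReal hq0.le]
  refine ENNReal.rpow_lt_top_of_nonneg (by positivity) (lt_of_le_of_lt (lintegral_mono fun x => ?_)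
    hfin).ne
  have h0 : 0 < 1 + ‖x‖ := by positivity
  have hx0 := locMax_ne_zero hS hS0 x
  have hψ0 := psi_pos (d + m) ν (norm_nonneg x)
  have hψ1 := psi_le_one hβ hν (norm_nonneg x)
  beta_reduce
  have hphi : phi d m ν x ≤ Real.exp (-(‖x‖ ^ 2 / 2)) := by
    rw [phi_eq]
    exact mul_le_of_le_one_right (Real.exp_pos _).le hψ1
  have hphi0 : 0 ≤ phi d m ν x := by
    rw [phi_eq]
    positivity
  -- Distributing a negative power over a product in `ℝ≥0∞` requires excluding 0·∞; the maximal
  -- function is nowhere zero.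
  have htop : locMax (dualWeight p w) x ^ (-(α / (q / p))) ≠ ∞ := by
    rw [ENNReal.rpow_neg]
    refine ENNReal.inv_ne_top.2 ?_
    rw [Ne, ENNReal.rpow_eq_zero_iff]
    have : 0 < α / (q / p) := by positivity
    rintro (⟨h, -⟩ | ⟨-, h⟩)
    · exact hx0 h
    · linarith
  rw [enorm_eq_self, ENNReal.mul_rpow_of_nonneg _ _ hq0.le, ← ENNReal.rpow_mul, weightV_eq, weightOf,
    ENNReal.mul_rpow_of_ne_top htop ENNReal.ofReal_ne_top, ← ENNReal.rpow_mul, neg_mul (σ / p) q,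
    neg_mul_neg, hαq, ENNReal.ofReal_rpow_of_pos (by positivity),
    ENNReal.ofReal_rpow_of_nonneg hphi0 hq0.le, mul_assoc, ← ENNReal.ofReal_mul (by positivity)]
  refine mul_le_mul_right (ENNReal.ofReal_le_ofReal ?_) _
  calc _ ≤ (Real.exp (-(p * ‖x‖ ^ 2 / 2)) * (1 + ‖x‖) ^ (-N)) ^ (-(σ / p * q)) *
        Real.exp (-(‖x‖ ^ 2 / 2)) ^ q := by gcongr
    _ = (1 + ‖x‖) ^ (N * (σ / p * q)) * (Real.exp (-(p * ‖x‖ ^ 2 / 2) * (-(σ / p * q))) *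
        Real.exp (-(‖x‖ ^ 2 / 2) * q)) := by
        rw [Real.mul_rpow (by positivity) (by positivity), ← Real.exp_mul, ← Real.exp_mul,
          ← Real.rpow_mul h0.le, neg_mul_neg]
        ring_nf
    _ = _ := by
        rw [← Real.exp_add]
        congr 2
        field_simp
        ring

end Main

end PoissonHermite

end

theorem theorem3 (d : ℕ) (hd : 1 ≤ d) (m : ℝ) (hm : -(d : ℝ) ≤ m) (ν : ℝ) (hν : 0 < ν)
    (p : ℝ) (hp : 1 < p) (α : ℝ) (hα : 1 < α) :
    ∃ N₀ : ℝ, ∀ w : PoissonHermite.E d → ℝ, AEMeasurable w → (∀ᵐ x, 0 < w x) →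
      eLpNorm (fun x => w x ^ (-(1 / p)) * PoissonHermite.phi d m ν x)
        (ENNReal.ofReal p.conjExponent) volume < ∞ →
      ∀ N : ℝ, N₀ < N →
        -- `v` is a weight
        (AEMeasurable (PoissonHermite.weightV d p α N w) ∧
          ∀ᵐ x, 0 < PoissonHermite.weightV d p α N w x ∧
            PoissonHermite.weightV d p α N w x < ∞) ∧
        -- `P_t f` is well defined for `f` in `L^p(w)`
        (∀ f : PoissonHermite.E d → ℂ,
          MemLp f (ENNReal.ofReal p) (volume.withDensity fun x => ENNReal.ofReal (w x)) →
          ∀ t : ℝ, 0 < t → ∀ x, PoissonHermite.PoissonConverges d m ν t f x) ∧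
        -- `P*_a` is bounded from `L^p(w)` to `L^p(v)` for every `a > 0`
        (∀ a : ℝ, 0 < a → ∃ C : ℝ≥0, ∀ f : PoissonHermite.E d → ℂ,
          MemLp f (ENNReal.ofReal p) (volume.withDensity fun x => ENNReal.ofReal (w x)) →
          MemLp (PoissonHermite.poissonMax d m ν a f) (ENNReal.ofReal p)
            (volume.withDensity (PoissonHermite.weightV d p α N w)) ∧
          eLpNorm (PoissonHermite.poissonMax d m ν a f) (ENNReal.ofReal p)
              (volume.withDensity (PoissonHermite.weightV d p α N w)) ≤
            C * eLpNorm f (ENNReal.ofReal p)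
              (volume.withDensity fun x => ENNReal.ofReal (w x))) ∧
        -- integrability of negative powers of `v`
        (∀ σ : ℝ, 0 < σ → σ < 1 → α < 1 / σ →
          eLpNorm (fun x => PoissonHermite.weightV d p α N w x ^ (-(σ / p)) *
              ENNReal.ofReal (PoissonHermite.phi d m ν x))
            (ENNReal.ofReal p.conjExponent) volume < ∞) := by
  -- The two thresholds come from the near and the far term; neither depends on w or a.
  refine ⟨max (2 * d * p + 2 * d * ((α - 1) * (p - 1)))
    ((((d : ℝ) + m) / 2 + 1 + ν) * p + d * (α * (p - 1)) + d), fun w hw hw0 hφ N hN => ?_⟩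
  have hp0 : 0 < p := by linarith
  have hvm : AEMeasurable (PoissonHermite.weightV d p α N w) :=
    (PoissonHermite.measurable_weightOf _ _ _
      (PoissonHermite.aemeasurable_dualWeight hw)).aemeasurable
  have hnorm : ∀ {f : PoissonHermite.E d → ℂ}, AEStronglyMeasurable f →
      eLpNorm f (ENNReal.ofReal p) (volume.withDensity fun x => ENNReal.ofReal (w x)) =
        (∫⁻ y, ‖f y‖ₑ ^ p * ENNReal.ofReal (w y)) ^ (1 / p) := fun hf =>
    PoissonHermite.eLpNorm_withDensity_eq hp hw.ennreal_ofReal hf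
  have hfin : ∀ {f : PoissonHermite.E d → ℂ},
      MemLp f (ENNReal.ofReal p) (volume.withDensity fun x => ENNReal.ofReal (w x)) →
      AEStronglyMeasurable f ∧ PoissonHermite.phiNorm d m ν f < ∞ := by
    intro f hf
    have hfm := PoissonHermite.aestronglyMeasurable_of_withDensity hw hw0 hf.1
    refine ⟨hfm, (PoissonHermite.phiNorm_le hp hw hw0 hfm).trans_lt ?_⟩
    rw [← hnorm hfm]
    exact ENNReal.mul_lt_top hf.2 hφ
  refine ⟨⟨hvm, PoissonHermite.ae_weightV_pos_lt_top hd hp hm hν α N hw hw0 hφ⟩, ?_, ?_, ?_⟩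
  · intro f hf t ht x
    obtain ⟨hfm, hfφ⟩ := hfin hf
    exact PoissonHermite.poissonConverges hm hν ht hfm hfφ x
  · intro a ha
    obtain ⟨C, hC, h⟩ := PoissonHermite.exists_lintegral_poissonMax_le hd hp hm hν hα ha
      ((le_max_left _ _).trans hN.le) ((le_max_right _ _).trans_lt hN) hw hw0 hφ
    have hCp : C ^ (1 / p) ≠ ∞ := ENNReal.rpow_ne_top_of_nonneg (by positivity) hC
    refine ⟨(C ^ (1 / p)).toNNReal, fun f hf => ?_⟩
    obtain ⟨hfm, hfφ⟩ := hfin hf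
    have hPm := PoissonHermite.measurable_poissonMax hm hν a hfm hfφ
    have hle : eLpNorm (PoissonHermite.poissonMax d m ν a f) (ENNReal.ofReal p)
        (volume.withDensity (PoissonHermite.weightV d p α N w)) ≤
        C ^ (1 / p) * eLpNorm f (ENNReal.ofReal p)
          (volume.withDensity fun x => ENNReal.ofReal (w x)) := by
      rw [PoissonHermite.eLpNorm_withDensity_eq hp hvm hPm.aestronglyMeasurable, hnorm hfm,
        ← ENNReal.mul_rpow_of_nonneg _ _ (by positivity)]
      simp only [enorm_eq_self]
      exact ENNReal.rpow_le_rpow (h f hfm) (by positivity)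
    rw [ENNReal.coe_toNNReal hCp]
    exact ⟨⟨hPm.aestronglyMeasurable,
      hle.trans_lt (ENNReal.mul_lt_top hCp.lt_top hf.2)⟩, hle⟩
  · intro σ hσ hσ1 hασ
    exact PoissonHermite.eLpNorm_weightV_rpow_mul_phi_lt_top hd hp hm hν N hα hσ hσ1 hασ hw hw0 hφ
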